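/- Let $S$ be a finite set of $n$ elements $x_0,\dots,x_{n-1}$ with real utility values $u_0,\dots,u_{n-1}$, partially ordered as the semiorder with margin of error one that these utilities define: $x_i<x_j$ if and only if $u_i<u_j-1$ (so elements whose utilities differ by at most one are incomparable). Let $w\colon S\to\mathbb{R}^2$ be an arbitrary system of two-dimensional weights. A lower set of $S$ is a subset $L\subseteq S$ such that $x<y$ and $y\in L$ imply $x\in L$. Let $$\mathrm{poly}(S)=\mathrm{conv}\Bigl\{\sum_{x\in L}w(x) : L \text{ a lower set of } S\Bigr\}\subset\mathbb{R}^2 ,$$ a convex polygon, possibly degenerate to a segment or a point. **Theorem.** (a) There is an absolute constant $C$ such that for every $n\ge 2$ and every $n$-element semiorder with weights as above, $\mathrm{poly}(S)$ has at most $C\,n\log n$ vertices. (b) $\mathrm{poly}(S)$ can be constructed in time $O(n\log^2 n)$ on a real RAM: there are a single program and an absolute constant $C'$ such that for every $n\ge 0$, given $n$, the real numbers $u_i$ (in arbitrary order) and the coordinates of the $w(x_i)$, the program halts with the list of all vertices of $\mathrm{poly}(S)$, each once and in counterclockwise cyclic order, and for $n\ge 2$ it performs at most $C'\,n\log^2 n$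 operations. Here a real RAM has random-access memory for words and for real numbers; it performs, at unit cost each, memory accesses, arithmetic and comparisons on words of $O(\log n)$ bits, and additions, subtractions, multiplications and comparisons on real numbers (with no rounding and no conversion between reals and words). -/

import Mathlib

/-! ### Semiorders, lower sets and their projected polygon -/

/-- The partial order of `S` is the semiorder with utilities `u` and margin of error one:
elements whose utilities differ by at most one are incomparable, and all other pairs are ordered
like their utilities. -/
def IsSemiorderUtility {S : Type*} [PartialOrder S] (u : S → ℝ) : Prop :=
  ∀ x y : S, x < y ↔ u x + 1 < u y

/-- The family of (finite) lower sets of a partially ordered set. -/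
def lowersets (S : Type*) [PartialOrder S] : Set (Finset S) :=
  {L | IsLowerSet (L : Set S)}

/-- The planar point set of the weight sums of the members of a family of sets. -/
def project {S : Type*} (w : S → ℝ × ℝ) (F : Set (Finset S)) : Set (ℝ × ℝ) :=
  (fun L : Finset S => ∑ x ∈ L, w x) '' F

/-- The convex hull of the projected lower sets. -/
def polygon {S : Type*} [PartialOrder S] (w : S → ℝ × ℝ) : Set (ℝ × ℝ) :=
  convexHull ℝ (project w (lowersets S))

/-- Twice the signed area of the triangle `a b c`; positive iff the triangle is
counterclockwise. -/
def orientation (a b c : ℝ × ℝ) : ℝ :=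
  (b.1 - a.1) * (c.2 - a.2) - (b.2 - a.2) * (c.1 - a.1)

/-- `v` lists all vertices of the convex set `K`, each of them once, in counterclockwise cyclic
order (starting anywhere). A point or a segment is a degenerate polygon with one or two
vertices. -/
def IsVertexList {m : ℕ} (v : Fin m → ℝ × ℝ) (K : Set (ℝ × ℝ)) : Prop :=
  Function.Injective v ∧ Set.range v = K.extremePoints ℝ ∧
    ∀ i j k : Fin m, i < j → j < k → 0 < orientation (v i) (v j) (v k)

/-! ### The real RAM

Programs of a real RAM in structured form. A program uses finitely many random-access arrays of
words (natural numbers, used for counting and for addressing) and of real numbers. There is no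
conversion between words and reals, and in particular no rounding of reals. -/

namespace RealRAM

/-- Memory: `words a i` and `reals a i` are the cells at index `i` of the word array and of the
real array with the (static) name `a`. -/
structure State where
  words : ℕ → ℕ → ℕ
  reals : ℕ → ℕ → ℝ

/-- Word expressions. Subtraction is truncated at zero; division rounds down (and `x / 0 = 0`). -/
inductive WExpr where
  | const (c : ℕ)
  | get (a : ℕ) (i : WExpr)
  | add (e f : WExpr)
  | sub (e f : WExpr)
  | mul (e f : WExpr)
  | div (e f : WExpr)

/-- Real expressions. -/
inductive RExpr where
  | const (c : ℤ)
  | get (a : ℕ) (i : WExpr)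
  | add (e f : RExpr)
  | sub (e f : RExpr)
  | mul (e f : RExpr)

/-- Tests: comparisons of words and of reals and their Boolean combinations. -/
inductive Test where
  | wlt (e f : WExpr)
  | weq (e f : WExpr)
  | rlt (e f : RExpr)
  | req (e f : RExpr)
  | not (b : Test)
  | and (b c : Test)
  | or (b c : Test)

/-- Programs. `wset a i e` and `rset a i e` are the assignments `a[i] := e` to word and real
arrays. -/
inductive Program where
  | skip
  | wset (a : ℕ) (i : WExpr) (e : WExpr)
  | rset (a : ℕ) (i : WExpr) (e : RExpr)
  | seq (p q : Program)
  | ite (b : Test) (p q : Program)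
  | loop (b : Test) (p : Program)

/-- The value of a word expression. -/
def WExpr.eval (σ : State) : WExpr → ℕ
  | .const c => c
  | .get a i => σ.words a (i.eval σ)
  | .add e f => e.eval σ + f.eval σ
  | .sub e f => e.eval σ - f.eval σ
  | .mul e f => e.eval σ * f.eval σ
  | .div e f => e.eval σ / f.eval σ

/-- The number of operations in the evaluation of a word expression. -/
def WExpr.cost : WExpr → ℕ
  | .const _ => 1
  | .get _ i => i.cost + 1
  | .add e f => e.cost + f.cost + 1
  | .sub e f => e.cost + f.cost + 1
  | .mul e f => e.cost + f.cost + 1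
  | .div e f => e.cost + f.cost + 1

/-- The value of a real expression. -/
noncomputable def RExpr.eval (σ : State) : RExpr → ℝ
  | .const c => (c : ℝ)
  | .get a i => σ.reals a (i.eval σ)
  | .add e f => e.eval σ + f.eval σ
  | .sub e f => e.eval σ - f.eval σ
  | .mul e f => e.eval σ * f.eval σ

/-- The number of operations in the evaluation of a real expression. -/
def RExpr.cost : RExpr → ℕ
  | .const _ => 1
  | .get _ i => i.cost + 1
  | .add e f => e.cost + f.cost + 1
  | .sub e f => e.cost + f.cost + 1
  | .mul e f => e.cost + f.cost + 1

/-- The truth value of a test. -/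
def Test.eval (σ : State) : Test → Prop
  | .wlt e f => e.eval σ < f.eval σ
  | .weq e f => e.eval σ = f.eval σ
  | .rlt e f => e.eval σ < f.eval σ
  | .req e f => e.eval σ = f.eval σ
  | .not b => ¬ b.eval σ
  | .and b c => b.eval σ ∧ c.eval σ
  | .or b c => b.eval σ ∨ c.eval σ

/-- The number of operations in the evaluation of a test. -/
def Test.cost : Test → ℕ
  | .wlt e f => e.cost + f.cost + 1
  | .weq e f => e.cost + f.cost + 1
  | .rlt e f => e.cost + f.cost + 1
  | .req e f => e.cost + f.cost + 1
  | .not b => b.cost + 1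
  | .and b c => b.cost + c.cost + 1
  | .or b c => b.cost + c.cost + 1

/-- The state after the assignment `a[i] := x` to a word array. -/
def State.setWord (σ : State) (a i x : ℕ) : State :=
  { σ with words := Function.update σ.words a (Function.update (σ.words a) i x) }

/-- The state after the assignment `a[i] := x` to a real array. -/
noncomputable def State.setReal (σ : State) (a i : ℕ) (x : ℝ) : State :=
  { σ with reals := Function.update σ.reals a (Function.update (σ.reals a) i x) }

/-- `Exec B p σ t τ`: started in the state `σ`, the program `p` halts in the state `τ` after
`t` operations, and every index and every word that it stores is smaller than `B`. (A run that
would use a larger index or word in an assignment counts as a failure.) -/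
inductive Exec (B : ℕ) : Program → State → ℕ → State → Prop
  | skip (σ : State) : Exec B .skip σ 1 σ
  | wset (a : ℕ) (i e : WExpr) (σ : State) (hi : i.eval σ < B) (he : e.eval σ < B) :
      Exec B (.wset a i e) σ (i.cost + e.cost + 1) (σ.setWord a (i.eval σ) (e.eval σ))
  | rset (a : ℕ) (i : WExpr) (e : RExpr) (σ : State) (hi : i.eval σ < B) :
      Exec B (.rset a i e) σ (i.cost + e.cost + 1) (σ.setReal a (i.eval σ) (e.eval σ))
  | seq {p q : Program} {σ τ ρ : State} {s t : ℕ} (hp : Exec B p σ s τ) (hq : Exec B q τ t ρ) :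
      Exec B (.seq p q) σ (s + t) ρ
  | ite_true {b : Test} {p q : Program} {σ τ : State} {t : ℕ} (hb : b.eval σ)
      (hp : Exec B p σ t τ) : Exec B (.ite b p q) σ (b.cost + 1 + t) τ
  | ite_false {b : Test} {p q : Program} {σ τ : State} {t : ℕ} (hb : ¬ b.eval σ)
      (hq : Exec B q σ t τ) : Exec B (.ite b p q) σ (b.cost + 1 + t) τ
  | loop_true {b : Test} {p : Program} {σ τ ρ : State} {s t : ℕ} (hb : b.eval σ)
      (hp : Exec B p σ s τ) (hl : Exec B (.loop b p) τ t ρ) :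
      Exec B (.loop b p) σ (b.cost + 1 + s + t) ρ
  | loop_false {b : Test} {p : Program} {σ : State} (hb : ¬ b.eval σ) :
      Exec B (.loop b p) σ (b.cost + 1) σ

/-- The initial memory for `n` elements with utilities `u` and weights `w`: the number `n` is in
cell 0 of word array 0, the utilities are in the first `n` cells of real array 0, and the two
coordinates of the weights in those of the real arrays 1 and 2. All other cells are zero. -/
noncomputable def input {n : ℕ} (u : Fin n → ℝ) (w : Fin n → ℝ × ℝ) : State where
  words a i := if a = 0 ∧ i = 0 then n else 0
  reals a i :=
    if h : i < n then
      if a = 0 then u ⟨i, h⟩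
      else if a = 1 then (w ⟨i, h⟩).1
      else if a = 2 then (w ⟨i, h⟩).2
      else 0
    else 0

/-- The convex polygon `K` is the output in the final memory `τ`: cell 0 of word array 0 holds
the number of its vertices, and the real arrays 1 and 2 hold the coordinates of the vertices, in
counterclockwise order. -/
def Outputs (τ : State) (K : Set (ℝ × ℝ)) : Prop :=
  ∃ m : ℕ, τ.words 0 0 = m ∧ IsVertexList (fun j : Fin m => (τ.reals 1 j, τ.reals 2 j)) K

end RealRAM

/-! Give every element two events, an entrance at time `u i` and a departure at time `u i + 1`, and
list all events chronologically, entrances first at equal times. A set is a lower set exactly when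
the list can be cut so that the elements departed before the cut belong to the set, those not yet
entered do not, and those in between are free (`mem_blockSet_root`). So the projected lower sets
form a union of linearly many zonotopes, one for each cut. Bounding these one by one would only give
a quadratic number of vertices.

Divide and conquer does better. Arrange the events as the leaves of a binary tree. For a block of
leaves, `blockSet` records the cuts inside the block and only the contributions of elements with an
event in the block. By `blockSet_eq_union` a block is the union of its two halves, each enlarged by
a Minkowski sum with segments (and, for the right half, a translation). The segments come from
events of the other half whose partners lie outside the block; an element with one event in each
half is already free in the right way in both halves. A half with `m` events thus gains at most `m`
hull edges, so the number of hull points satisfies `V (2m) ≤ 2 V m + 2m`. This gives the bound `n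
log n` (`upperTree_spec`).

Upper hulls are handled as chains: lists of points that maximise the functionals `lin t`. Adding
segments merges two lists of steps by slope (`IsUpper.addSegments`). A union of two chains is merged
from left to right and cleaned by a hull scan (`scanHull_spec`). The lower hull is the upper hull
for reflected weights, and `isVertexList_cyclicList` joins both chains into the cyclic vertex list.
Padding by elements of weight zero makes the number of elements a power of two
(`project_lowersets_eq`).

For the running time, the events are sorted by slope once, by a mergesort along the same tree, so
every node finds its segments already sorted. The work at a node is then linear in the lengths of
its chains, that is `m log n` for a block of `m` events, and the logarithmically many levels add up
to `n log² n`. Formally, `Tri` is a Hoare triple with a cost bound, `wp` treats loop-free code, and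
`Frame` says which arrays stay unchanged. Each program is shown to cost at most its syntactic
`maxCost` times a size. The hull scan needs an amortised potential (`progScan_spec`). -/

/-! ### Upper chains of planar point sets -/

/-- The linear functional `t x + y`. -/
def lin (t : ℝ) (p : ℝ × ℝ) : ℝ := t * p.1 + p.2

@[simp] theorem lin_add (t : ℝ) (p q : ℝ × ℝ) : lin t (p + q) = lin t p + lin t q := by
  simp [lin]; ring

@[simp] theorem lin_zero (t : ℝ) : lin t 0 = 0 := by simp [lin]

theorem lin_list_sum (t : ℝ) (l : List (ℝ × ℝ)) : lin t l.sum = (l.map (lin t)).sum := by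
  induction l with
  | nil => simp
  | cons a l ih => simp [ih]

/-- The slope of a vector. -/
noncomputable def slopeOf (e : ℝ × ℝ) : ℝ := e.2 / e.1

/-- Nonincreasing slopes, as a Boolean comparison. -/
noncomputable def slopeLe (e f : ℝ × ℝ) : Bool := decide (slopeOf f ≤ slopeOf e)

/-- The comparison of points from left to right, and downwards on vertical lines. -/
noncomputable def lexLe (p q : ℝ × ℝ) : Bool := decide (p.1 < q.1 ∨ (p.1 = q.1 ∧ q.2 ≤ p.2))

/-- The cross-multiplied form is needed because the machine cannot divide: every slope comparison of
the program is this inequality. -/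
theorem slopeLe_iff {e f : ℝ × ℝ} (he : 0 < e.1) (hf : 0 < f.1) :
    slopeLe e f ↔ f.2 * e.1 ≤ e.2 * f.1 := by
  rw [slopeLe, decide_eq_true_eq]
  unfold slopeOf
  rw [div_le_div_iff₀ hf he]

theorem lin_eq_mul_slope {e : ℝ × ℝ} (he : 0 < e.1) (t : ℝ) : lin t e = e.1 * (t + slopeOf e) := by
  unfold lin slopeOf; field_simp

/-- The differences of consecutive points. -/
def steps : List (ℝ × ℝ) → List (ℝ × ℝ)
  | a :: b :: l => (b - a) :: steps (b :: l)
  | _ => []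

/-- The polygonal path that starts at a point and has given steps. -/
def walk (a : ℝ × ℝ) : List (ℝ × ℝ) → List (ℝ × ℝ)
  | [] => [a]
  | e :: l => a :: walk (a + e) l

/-- A chain is its first point together with its steps, so chains can be added by working on step
lists alone. -/
theorem walk_steps (a : ℝ × ℝ) (l : List (ℝ × ℝ)) : walk a (steps (a :: l)) = a :: l := by
  induction l generalizing a with
  | nil => simp [steps, walk]
  | cons b l ih => simp [steps, walk, ih]

theorem length_walk (a : ℝ × ℝ) (l : List (ℝ × ℝ)) : (walk a l).length = l.length + 1 := by
  induction l generalizing a with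
  | nil => simp [walk]
  | cons b l ih => simp [walk, ih]

theorem length_steps (l : List (ℝ × ℝ)) : (steps l).length = l.length - 1 := by
  cases l with
  | nil => simp [steps]
  | cons a l =>
    have := congrArg List.length (walk_steps a l)
    rw [length_walk] at this
    simp at this ⊢
    omega

theorem mem_walk {a q : ℝ × ℝ} {l : List (ℝ × ℝ)} :
    q ∈ walk a l ↔ ∃ l₁ l₂, l = l₁ ++ l₂ ∧ q = a + l₁.sum := by
  induction l generalizing a with
  | nil => simp [walk]
  | cons e l ih =>
    simp only [walk, List.mem_cons, ih]
    constructor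
    · rintro (rfl | ⟨l₁, l₂, rfl, rfl⟩)
      · exact ⟨[], e :: l, rfl, by simp⟩
      · exact ⟨e :: l₁, l₂, rfl, by simp [add_assoc]⟩
    · rintro ⟨l₁, l₂, h, rfl⟩
      cases l₁ with
      | nil => left; simp
      | cons x l₁ =>
        simp at h
        obtain ⟨rfl, rfl⟩ := h
        exact Or.inr ⟨l₁, l₂, rfl, by simp [add_assoc]⟩

theorem pairwise_walk {a : ℝ × ℝ} {l : List (ℝ × ℝ)} (h : ∀ e ∈ l, 0 < e.1) :
    (walk a l).Pairwise (fun p q => p.1 < q.1) := by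
  induction l generalizing a with
  | nil => simp [walk]
  | cons e l ih =>
    simp only [walk, List.pairwise_cons]
    refine ⟨?_, ih fun x hx => h x (by simp [hx])⟩
    intro q hq
    obtain ⟨l₁, l₂, rfl, rfl⟩ := mem_walk.1 hq
    have h1 : 0 < e.1 := h e (by simp)
    have h2 : 0 ≤ l₁.sum.1 := by
      have : ∀ l : List (ℝ × ℝ), (∀ e ∈ l, 0 < e.1) → 0 ≤ l.sum.1 := by
        intro l hl
        induction l with
        | nil => simp
        | cons b l ih' =>
          have := hl b (by simp)
          have := ih' fun x hx => hl x (by simp [hx])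
          simp; linarith
      exact this _ fun x hx => h x (by simp [hx])
    simp; linarith

/-- Every functional `lin t` attains at some listed point at least its value at any point of
the set. -/
def Covers (c : List (ℝ × ℝ)) (P : Set (ℝ × ℝ)) : Prop :=
  ∀ p ∈ P, ∀ t, ∃ q ∈ c, lin t p ≤ lin t q

/-- The list consists of points of `P` and dominates `P` from above. -/
def IsUpper (c : List (ℝ × ℝ)) (P : Set (ℝ × ℝ)) : Prop :=
  (∀ q ∈ c, q ∈ P) ∧ Covers c P

/-- The nonempty list is strictly increasing from left to right, with strictly decreasing slopes. -/
def StrictChain (c : List (ℝ × ℝ)) : Prop :=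
  c ≠ [] ∧ (∀ e ∈ steps c, 0 < e.1) ∧ (steps c).Pairwise fun e f => slopeOf f < slopeOf e

theorem IsUpper.union {c₁ c₂ c : List (ℝ × ℝ)} {P₁ P₂ : Set (ℝ × ℝ)} (h₁ : IsUpper c₁ P₁)
    (h₂ : IsUpper c₂ P₂) (h : ∀ q, q ∈ c ↔ q ∈ c₁ ∨ q ∈ c₂) : IsUpper c (P₁ ∪ P₂) := by
  refine ⟨fun q hq => ((h q).1 hq).imp (h₁.1 q) (h₂.1 q), ?_⟩
  rintro p (hp | hp) t
  · obtain ⟨q, hq, hl⟩ := h₁.2 p hp t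
    exact ⟨q, (h q).2 (Or.inl hq), hl⟩
  · obtain ⟨q, hq, hl⟩ := h₂.2 p hp t
    exact ⟨q, (h q).2 (Or.inr hq), hl⟩

theorem IsUpper.trans {c c' : List (ℝ × ℝ)} {P : Set (ℝ × ℝ)} (h : IsUpper c P)
    (hs : ∀ q ∈ c', q ∈ c) (hc : Covers c' {q | q ∈ c}) : IsUpper c' P := by
  refine ⟨fun q hq => h.1 q (hs q hq), fun p hp t => ?_⟩
  obtain ⟨q, hq, hl⟩ := h.2 p hp t
  obtain ⟨r, hr, hl'⟩ := hc q hq t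
  exact ⟨r, hr, hl.trans hl'⟩

/-- A path with nonincreasing slopes has, for each functional, a split into ascending and
descending steps. -/
theorem exists_split_lin {l : List (ℝ × ℝ)} (hp : ∀ e ∈ l, 0 < e.1)
    (hs : l.Pairwise fun e f => slopeOf f ≤ slopeOf e) (t : ℝ) :
    ∃ l₁ l₂, l = l₁ ++ l₂ ∧ (∀ e ∈ l₁, 0 ≤ lin t e) ∧ ∀ e ∈ l₂, lin t e ≤ 0 := by
  induction l with
  | nil => exact ⟨[], [], rfl, by simp, by simp⟩
  | cons e l ih =>
    have he := hp e (by simp)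
    rw [List.pairwise_cons] at hs
    by_cases h : 0 ≤ lin t e
    · obtain ⟨l₁, l₂, rfl, h1, h2⟩ := ih (fun x hx => hp x (by simp [hx])) hs.2
      refine ⟨e :: l₁, l₂, rfl, ?_, h2⟩
      intro f hf
      rcases List.mem_cons.1 hf with rfl | hf
      · exact h
      · exact h1 f hf
    · refine ⟨[], e :: l, rfl, by simp, ?_⟩
      intro f hf
      rcases List.mem_cons.1 hf with rfl | hf'
      · exact le_of_not_ge h
      · rw [lin_eq_mul_slope he] at h
        rw [lin_eq_mul_slope (hp f hf)]
        have h3 : t + slopeOf e < 0 := by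
          by_contra hc
          exact h (mul_nonneg he.le (not_lt.1 hc))
        have := hs.1 f hf'
        exact mul_nonpos_of_nonneg_of_nonpos (hp f hf).le (by linarith)

/-- The sum of positive parts is the support function of the Minkowski sum of the segments from `0`
to `e`. It is attained by taking exactly the ascending steps, and these form a prefix once the
slopes are sorted. -/
theorem sum_map_max {l₁ l₂ : List (ℝ × ℝ)} {t : ℝ} (h1 : ∀ e ∈ l₁, 0 ≤ lin t e)
    (h2 : ∀ e ∈ l₂, lin t e ≤ 0) :
    ((l₁ ++ l₂).map fun e => max 0 (lin t e)).sum = lin t l₁.sum := by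
  have e1 : (l₁.map fun e => max 0 (lin t e)) = l₁.map (lin t) :=
    List.map_congr_left fun e he => max_eq_right (h1 e he)
  have e2 : (l₂.map fun e => max 0 (lin t e)) = l₂.map fun _ => 0 :=
    List.map_congr_left fun e he => max_eq_left (h2 e he)
  rw [List.map_append, List.sum_append, e1, e2, lin_list_sum]
  simp

theorem lin_sum_le (l₁ l₂ : List (ℝ × ℝ)) (t : ℝ) :
    lin t l₁.sum ≤ ((l₁ ++ l₂).map fun e => max 0 (lin t e)).sum := by
  rw [List.map_append, List.sum_append, lin_list_sum]
  have h1 : (l₁.map (lin t)).sum ≤ (l₁.map fun e => max 0 (lin t e)).sum :=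
    List.sum_le_sum fun e _ => le_max_right _ _
  have h2 : 0 ≤ (l₂.map fun e => max 0 (lin t e)).sum :=
    List.sum_nonneg fun x hx => by
      obtain ⟨e, _, rfl⟩ := List.mem_map.1 hx
      exact le_max_left _ _
  linarith

/-- Sorted slopes make the path pass through a maximiser of every functional. `lin_le_of_mem_walk`
is the matching upper bound, valid for any order of the steps. -/
theorem exists_mem_walk_lin {l : List (ℝ × ℝ)} (hp : ∀ e ∈ l, 0 < e.1)
    (hs : l.Pairwise fun e f => slopeOf f ≤ slopeOf e) (a : ℝ × ℝ) (t : ℝ) :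
    ∃ q ∈ walk a l, lin t q = lin t a + (l.map fun e => max 0 (lin t e)).sum := by
  obtain ⟨l₁, l₂, rfl, h1, h2⟩ := exists_split_lin hp hs t
  exact ⟨a + l₁.sum, mem_walk.2 ⟨l₁, l₂, rfl, rfl⟩, by rw [lin_add, sum_map_max h1 h2]⟩

theorem lin_le_of_mem_walk {l : List (ℝ × ℝ)} {a q : ℝ × ℝ} (hq : q ∈ walk a l) (t : ℝ) :
    lin t q ≤ lin t a + (l.map fun e => max 0 (lin t e)).sum := by
  obtain ⟨l₁, l₂, rfl, rfl⟩ := mem_walk.1 hq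
  rw [lin_add]
  linarith [lin_sum_le l₁ l₂ t]

/-- The sum of a chain and of a family of segments with the given steps. -/
noncomputable def addSegments (c : List (ℝ × ℝ)) (s : ℝ × ℝ) (E : List (ℝ × ℝ)) : List (ℝ × ℝ) :=
  walk (c.headD 0 + s) ((steps c).merge E slopeLe)

theorem slopeLe_trans (a b c : ℝ × ℝ) (h : slopeLe a b) (h' : slopeLe b c) : slopeLe a c := by
  simp only [slopeLe, decide_eq_true_eq] at *
  linarith

theorem slopeLe_total (a b : ℝ × ℝ) : slopeLe a b || slopeLe b a := by
  simp only [slopeLe, Bool.or_eq_true, decide_eq_true_eq]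
  exact le_total _ _

theorem lexLe_trans (a b c : ℝ × ℝ) (h : lexLe a b) (h' : lexLe b c) : lexLe a c := by
  simp only [lexLe, decide_eq_true_eq] at *
  rcases h with h | h <;> rcases h' with h' | h'
  · left; linarith
  · left; linarith [h'.1]
  · left; linarith [h.1]
  · right; constructor <;> linarith [h.1, h.2, h'.1, h'.2]

theorem lexLe_total (a b : ℝ × ℝ) : lexLe a b || lexLe b a := by
  simp only [lexLe, Bool.or_eq_true, decide_eq_true_eq]
  rcases lt_trichotomy a.1 b.1 with h | h | h
  · simp [h]
  · rcases le_total b.2 a.2 with h' | h' <;> simp [h, h']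
  · simp [h]

/-- A prefix of a merged list consists of prefixes of the two lists. -/
theorem merge_prefix_sum {le : ℝ × ℝ → ℝ × ℝ → Bool} (E F l₁ l₂ : List (ℝ × ℝ))
    (h : E.merge F le = l₁ ++ l₂) :
    ∃ E₁ E₂ F₁ F₂, E = E₁ ++ E₂ ∧ F = F₁ ++ F₂ ∧ l₁.sum = E₁.sum + F₁.sum := by
  induction l₁ generalizing E F with
  | nil => exact ⟨[], E, [], F, rfl, rfl, by simp⟩
  | cons a l ih =>
    cases E with
    | nil =>
      simp only [List.nil_merge] at h
      exact ⟨[], [], a :: l, l₂, rfl, h, by simp⟩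
    | cons e E =>
      cases F with
      | nil =>
        simp only [List.merge_right] at h
        exact ⟨a :: l, l₂, [], [], h, rfl, by simp⟩
      | cons f F =>
        rw [List.cons_merge_cons] at h
        split_ifs at h with hl
        · simp only [List.cons_append, List.cons.injEq] at h
          obtain ⟨E₁, E₂, F₁, F₂, h1, h2, h3⟩ := ih E (f :: F) h.2
          exact ⟨e :: E₁, E₂, F₁, F₂, by simp [h1], h2, by simp [h3, ← h.1, add_assoc]⟩
        · simp only [List.cons_append, List.cons.injEq] at h
          obtain ⟨E₁, E₂, F₁, F₂, h1, h2, h3⟩ := ih (e :: E) F h.2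
          exact ⟨E₁, E₂, f :: F₁, F₂, h1, by simp [h2], by
            simp only [List.sum_cons, h3, ← h.1]; abel⟩

theorem addSegments_step_pos {c : List (ℝ × ℝ)} {E : List (ℝ × ℝ)} (hc : StrictChain c)
    (hE : ∀ e ∈ E, 0 < e.1) : ∀ e ∈ (steps c).merge E slopeLe, 0 < e.1 := by
  intro e he
  rcases List.mem_merge.1 he with h | h
  · exact hc.2.1 e h
  · exact hE e h

theorem pairwise_addSegments {c : List (ℝ × ℝ)} (s : ℝ × ℝ) {E : List (ℝ × ℝ)}
    (hc : StrictChain c) (hE : ∀ e ∈ E, 0 < e.1) :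
    (addSegments c s E).Pairwise fun p q => lexLe p q = true :=
  (pairwise_walk (addSegments_step_pos hc hE)).imp fun h => by simp [lexLe, h]

theorem length_addSegments {c : List (ℝ × ℝ)} (s : ℝ × ℝ) (E : List (ℝ × ℝ)) (hc : c ≠ []) :
    (addSegments c s E).length = c.length + E.length := by
  have := List.length_pos_iff.2 hc
  rw [addSegments, length_walk, List.length_merge, length_steps]
  omega

open Pointwise in
/-- Minkowski addition: if `Z` contains the sums of the initial segments of steps, and is bounded by
the support function of the segments, then merging the steps gives the upper chain of the sum. -/
theorem IsUpper.addSegments {c : List (ℝ × ℝ)} {P Z : Set (ℝ × ℝ)} {s : ℝ × ℝ}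
    {E : List (ℝ × ℝ)} (h : IsUpper c P) (hc : StrictChain c) (hE : ∀ e ∈ E, 0 < e.1)
    (hs : E.Pairwise fun e f => slopeLe e f = true)
    (hZ : ∀ E₁ E₂, E = E₁ ++ E₂ → s + E₁.sum ∈ Z)
    (hb : ∀ z ∈ Z, ∀ t, lin t z ≤ lin t s + (E.map fun e => max 0 (lin t e)).sum) :
    IsUpper (addSegments c s E) (P + Z) := by
  obtain ⟨a, l, rfl⟩ := List.exists_cons_of_ne_nil hc.1
  constructor
  · intro q hq
    obtain ⟨l₁, l₂, hl, rfl⟩ := mem_walk.1 hq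
    obtain ⟨E₁, E₂, F₁, F₂, h1, h2, h3⟩ := merge_prefix_sum _ _ _ _ hl
    refine Set.mem_add.2 ⟨a + E₁.sum, h.1 _ ?_, s + F₁.sum, hZ F₁ F₂ h2, ?_⟩
    · rw [← walk_steps a l]
      exact mem_walk.2 ⟨E₁, E₂, h1, rfl⟩
    · simp only [List.headD_cons, h3]; abel
  · rintro _ ⟨p, hp, z, hz, rfl⟩ t
    obtain ⟨q, hq, hl⟩ := h.2 p hp t
    rw [← walk_steps a l] at hq
    have h1 := lin_le_of_mem_walk hq t
    have h2 := hb z hz t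
    have hsort : ((steps (a :: l)).merge E slopeLe).Pairwise fun e f => slopeOf f ≤ slopeOf e := by
      refine (List.pairwise_merge slopeLe_trans slopeLe_total _ _ ?_ hs).imp ?_
      · exact hc.2.2.imp fun h => by simp [slopeLe, h.le]
      · intro e f h; simpa [slopeLe] using h
    obtain ⟨r, hr, hr'⟩ := exists_mem_walk_lin (addSegments_step_pos hc hE) hsort (a + s) t
    refine ⟨r, hr, ?_⟩
    -- The support function depends only on the multiset of steps, so that of the merged list is the
    -- sum of the two.
    have h3 := (((List.merge_perm_append (le := slopeLe) (xs := steps (a :: l)) (ys := E))).map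
      fun e => max 0 (lin t e)).sum_eq
    rw [hr', h3, List.map_append, List.sum_append]
    simp only [lin_add]
    linarith

/-! ### The scan for the upper hull of a sorted point list -/

/-- Remove from a stack the points that a new point makes superfluous. -/
noncomputable def popStack (p : ℝ × ℝ) : List (ℝ × ℝ) → List (ℝ × ℝ)
  | b :: a :: s => open Classical in
      if 0 ≤ orientation a b p then popStack p (a :: s) else b :: a :: s
  | s => s

/-- Process a new point in the scan. -/
noncomputable def pushStack (s : List (ℝ × ℝ)) (p : ℝ × ℝ) : List (ℝ × ℝ) :=
  match s with
  | [] => [p]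
  | b :: s => open Classical in if b.1 = p.1 then b :: s else p :: popStack p (b :: s)

/-- The upper hull of a sorted point list. -/
noncomputable def scanHull (l : List (ℝ × ℝ)) : List (ℝ × ℝ) := (l.foldl pushStack []).reverse

theorem steps_append (l : List (ℝ × ℝ)) (a b : ℝ × ℝ) :
    steps (l ++ [a, b]) = steps (l ++ [a]) ++ [b - a] := by
  induction l with
  | nil => simp [steps]
  | cons c l ih =>
    cases l with
    | nil => simp [steps]
    | cons d l =>
      simp only [List.cons_append, steps] at ih ⊢
      rw [ih]

theorem strictChain_reverse_singleton (p : ℝ × ℝ) : StrictChain [p].reverse := by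
  simp [StrictChain, steps]

/-- Stacks keep the rightmost point on top, so a push adds one step at the right end of the chain
and only the new slope needs to be compared. -/
theorem strictChain_reverse_cons {a b : ℝ × ℝ} {s : List (ℝ × ℝ)} :
    StrictChain (b :: a :: s).reverse ↔ StrictChain (a :: s).reverse ∧ a.1 < b.1 ∧
      ∀ e ∈ steps (a :: s).reverse, slopeOf (b - a) < slopeOf e := by
  have : steps (b :: a :: s).reverse = steps (a :: s).reverse ++ [b - a] := by
    simp only [List.reverse_cons, List.append_assoc, List.cons_append, List.nil_append]
    exact steps_append _ _ _
  unfold StrictChain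
  rw [this]
  simp only [List.pairwise_append, List.mem_append, List.mem_singleton]
  constructor
  · rintro ⟨_, h2, h3, _, h5⟩
    refine ⟨⟨by simp, fun e he => h2 e (Or.inl he), h3⟩, ?_, fun e he => h5 e he _ rfl⟩
    simpa using h2 _ (Or.inr rfl)
  · rintro ⟨⟨_, h2, h3⟩, h4, h5⟩
    refine ⟨by simp, ?_, h3, by simp, ?_⟩
    · rintro e (he | rfl)
      · exact h2 e he
      · simpa using h4
    · rintro e he _ rfl
      exact h5 e he

theorem slope_lt_of_orientation {a b p : ℝ × ℝ} (hab : a.1 < b.1) (hbp : b.1 < p.1)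
    (h : orientation a b p < 0) : slopeOf (p - b) < slopeOf (b - a) := by
  unfold slopeOf orientation at *
  simp only [Prod.fst_sub, Prod.snd_sub]
  rw [div_lt_div_iff₀ (by linarith) (by linarith)]
  nlinarith

/-- Here `b` lies on or below the segment from `a` to `p`, where a linear functional is largest at
an end. -/
theorem lin_le_of_orientation {a b p : ℝ × ℝ} (hab : a.1 < b.1) (hbp : b.1 < p.1)
    (h : 0 ≤ orientation a b p) (t : ℝ) : lin t b ≤ lin t a ∨ lin t b ≤ lin t p := by
  by_contra hc
  push Not at hc
  unfold orientation lin at *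
  nlinarith [mul_pos (sub_pos.2 hbp) (sub_pos.2 hc.1), mul_pos (sub_pos.2 hab) (sub_pos.2 hc.2)]

/-- A popped point is dominated by `p` or by the next stack point. The latter may be popped in turn,
so domination is stated with respect to the final stack together with `p`. -/
theorem popStack_spec (p : ℝ × ℝ) (s : List (ℝ × ℝ)) (hs : StrictChain s.reverse)
    (hp : ∀ b ∈ s.head?, b.1 < p.1) :
    StrictChain (p :: popStack p s).reverse ∧ (∀ q ∈ popStack p s, q ∈ s) ∧
      (∀ q ∈ s, ∀ t, ∃ r ∈ p :: popStack p s, lin t q ≤ lin t r) ∧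
      (popStack p s).length ≤ s.length := by
  induction s with
  | nil => exact ⟨strictChain_reverse_singleton p, by simp [popStack]⟩
  | cons b s ih =>
    have hbp : b.1 < p.1 := hp b (by simp)
    cases s with
    | nil =>
      simp only [popStack]
      refine ⟨?_, by simp, ?_, le_rfl⟩
      · rw [strictChain_reverse_cons]
        exact ⟨strictChain_reverse_singleton b, hbp, by simp [steps]⟩
      · intro q hq t
        exact ⟨q, by simp_all, le_rfl⟩
    | cons a s =>
      have hs' := strictChain_reverse_cons.1 hs
      simp only [popStack]
      split_ifs with h
      · obtain ⟨h1, h2, h3, h4⟩ := ih hs'.1 (by simpa using hs'.2.1.trans hbp)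
        refine ⟨h1, fun q hq => List.mem_cons_of_mem _ (h2 q hq), ?_, h4.trans (by simp)⟩
        intro q hq t
        rcases List.mem_cons.1 hq with rfl | hq
        · rcases lin_le_of_orientation hs'.2.1 hbp h t with h5 | h5
          · obtain ⟨r, hr, h6⟩ := h3 a (by simp) t
            exact ⟨r, hr, h5.trans h6⟩
          · exact ⟨p, by simp, h5⟩
        · exact h3 q hq t
      · refine ⟨?_, fun q hq => hq, fun q hq t => ⟨q, List.mem_cons_of_mem _ hq, le_rfl⟩, le_rfl⟩
        rw [strictChain_reverse_cons]
        have h6 := slope_lt_of_orientation hs'.2.1 hbp (not_le.1 h)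
        refine ⟨hs, hbp, ?_⟩
        intro e he
        have : steps (b :: a :: s).reverse = steps (a :: s).reverse ++ [b - a] := by
          simp only [List.reverse_cons, List.append_assoc, List.cons_append, List.nil_append]
          exact steps_append _ _ _
        rw [this, List.mem_append, List.mem_singleton] at he
        rcases he with he | rfl
        · exact h6.trans (hs'.2.2 e he)
        · exact h6

/-- The induction is over the unread points with an arbitrary stack. The invariant needed is that
the stack top precedes all unread points. -/
theorem foldl_pushStack_spec (l s : List (ℝ × ℝ)) (hs : s = [] ∨ StrictChain s.reverse)
    (hl : l.Pairwise fun p q => lexLe p q = true) (hsl : ∀ b ∈ s.head?, ∀ p ∈ l, lexLe b p = true) :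
    (s ≠ [] ∨ l ≠ [] → StrictChain (l.foldl pushStack s).reverse) ∧
      (∀ q ∈ l.foldl pushStack s, q ∈ s ∨ q ∈ l) ∧
      (∀ q, q ∈ s ∨ q ∈ l → ∀ t, ∃ r ∈ l.foldl pushStack s, lin t q ≤ lin t r) ∧
      (l.foldl pushStack s).length ≤ s.length + l.length := by
  induction l generalizing s with
  | nil =>
    simp only [List.foldl_nil]
    exact ⟨fun h => hs.resolve_left (by simpa using h), fun q hq => Or.inl hq,
      fun q hq t => ⟨q, by simpa using hq, le_rfl⟩, by simp⟩
  | cons p l ih =>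
    rw [List.pairwise_cons] at hl
    have key : StrictChain (pushStack s p).reverse ∧
        (∀ b ∈ (pushStack s p).head?, ∀ q ∈ l, lexLe b q = true) ∧
        (∀ q ∈ pushStack s p, q ∈ s ∨ q = p) ∧
        (∀ q, q ∈ s ∨ q = p → ∀ t, ∃ r ∈ pushStack s p, lin t q ≤ lin t r) ∧
        (pushStack s p).length ≤ s.length + 1 := by
      cases s with
      | nil =>
        simp only [pushStack]
        refine ⟨strictChain_reverse_singleton p, by simpa using hl.1, by simp, ?_, by simp⟩
        intro q hq t
        exact ⟨q, by simpa using hq, le_rfl⟩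
      | cons b s =>
        have hs' := hs.resolve_left (by simp)
        have hbp := hsl b (by simp) p (by simp)
        simp only [lexLe, decide_eq_true_eq] at hbp
        simp only [pushStack]
        split_ifs with h
        · refine ⟨hs', ?_, fun q hq => Or.inl hq, ?_, by simp⟩
          · intro c hc q hq
            exact hsl c hc q (by simp [hq])
          · rintro q (hq | rfl) t
            · exact ⟨q, hq, le_rfl⟩
            -- The discarded point lies weakly below `b` on the same vertical line, because `lexLe`
            -- lists higher points first.
            · refine ⟨b, by simp, ?_⟩
              have := (hbp.resolve_left (by simp [h])).2
              simp only [lin, h]; linarith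
        · have hlt : b.1 < p.1 := hbp.resolve_right fun h' => h h'.1
          obtain ⟨h1, h2, h3, h4⟩ := popStack_spec p (b :: s) hs' (by simpa using hlt)
          refine ⟨h1, by simpa using hl.1, ?_, ?_, by simpa using h4⟩
          · intro q hq
            rcases List.mem_cons.1 hq with rfl | hq
            · exact Or.inr rfl
            · exact Or.inl (h2 q hq)
          · rintro q (hq | rfl) t
            · exact h3 q hq t
            · exact ⟨q, by simp, le_rfl⟩
    obtain ⟨k1, k2, k3, k4, k5⟩ := key
    obtain ⟨h1, h2, h3, h4⟩ := ih (pushStack s p) (Or.inr k1) hl.2 k2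
    simp only [List.foldl_cons]
    refine ⟨fun _ => h1 (Or.inl ?_), ?_, ?_, ?_⟩
    · intro h0
      exact k1.1 (by simp [h0])
    · intro q hq
      rcases h2 q hq with h | h
      · rcases k3 q h with h | rfl
        · exact Or.inl h
        · exact Or.inr (by simp)
      · exact Or.inr (by simp [h])
    · intro q hq t
      have : q ∈ pushStack s p ∨ q ∈ l ∨ (q ∈ s ∨ q = p) := by
        rcases hq with h | h
        · exact Or.inr (Or.inr (Or.inl h))
        · rcases List.mem_cons.1 h with h | h
          · exact Or.inr (Or.inr (Or.inr h))
          · exact Or.inr (Or.inl h)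
      rcases this with h | h | h
      · exact h3 q (Or.inl h) t
      · exact h3 q (Or.inr h) t
      · obtain ⟨r, hr, hl'⟩ := k4 q h t
        obtain ⟨r', hr', hl''⟩ := h3 r (Or.inl hr) t
        exact ⟨r', hr', hl'.trans hl''⟩
    · simp only [List.length_cons]; omega

theorem scanHull_spec {l : List (ℝ × ℝ)} (hn : l ≠ [])
    (hl : l.Pairwise fun p q => lexLe p q = true) :
    StrictChain (scanHull l) ∧ (∀ q ∈ scanHull l, q ∈ l) ∧ Covers (scanHull l) {q | q ∈ l} ∧
      (scanHull l).length ≤ l.length := by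
  obtain ⟨h1, h2, h3, h4⟩ := foldl_pushStack_spec l [] (Or.inl rfl) hl (by simp)
  refine ⟨h1 (Or.inr hn), ?_, ?_, by simpa [scanHull] using h4⟩
  · intro q hq
    simpa using h2 q (by simpa [scanHull] using hq)
  · intro q hq t
    obtain ⟨r, hr, h⟩ := h3 q (Or.inr hq) t
    exact ⟨r, by simpa [scanHull] using hr, h⟩

/-! ### The vertices of a polygon from its two chains -/

/-- The point maximizes two of the functionals `lin t` on `P`. -/
def IsTopPoint (P : Set (ℝ × ℝ)) (q : ℝ × ℝ) : Prop :=
  ∃ t₁ t₂, t₁ < t₂ ∧ ∀ p ∈ P, lin t₁ p ≤ lin t₁ q ∧ lin t₂ p ≤ lin t₂ q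

/-- Either functional may be maximal along a whole edge, but only `q` maximises both. Hence `q` is
the only maximiser of the functional half way between them. -/
theorem IsTopPoint.exists_lt {P : Set (ℝ × ℝ)} {q : ℝ × ℝ} (h : IsTopPoint P q) :
    ∃ t, ∀ p ∈ P, p ≠ q → lin t p < lin t q := by
  obtain ⟨t₁, t₂, h12, h⟩ := h
  refine ⟨(t₁ + t₂) / 2, fun p hp hpq => ?_⟩
  obtain ⟨h1, h2⟩ := h p hp
  by_contra hc
  push Not at hc
  apply hpq
  unfold lin at *
  have h3 : p.1 = q.1 := by
    have : (t₂ - t₁) * (p.1 - q.1) = 0 := by nlinarith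
    rcases mul_eq_zero.1 this with h | h <;> linarith
  rw [h3] at h1 h2 hc
  exact Prod.ext h3 (by linarith)

/-- If `q` is inside a segment of the hull, a functional maximal at `q` is constant on that segment.
Two functionals that jointly separate points force the segment to be a point. -/
theorem mem_extremePoints_of_functionals {P : Set (ℝ × ℝ)} {q : ℝ × ℝ} (f g : ℝ × ℝ →ₗ[ℝ] ℝ)
    (hfg : ∀ x y, f x = f y → g x = g y → x = y) (hq : q ∈ P)
    (h : ∀ p ∈ P, f p ≤ f q ∧ g p ≤ g q) : q ∈ (convexHull ℝ P).extremePoints ℝ := by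
  have hull : ∀ k : ℝ × ℝ →ₗ[ℝ] ℝ, (∀ p ∈ P, k p ≤ k q) → ∀ p ∈ convexHull ℝ P, k p ≤ k q :=
    fun k hk p hp => convexHull_min hk (convex_halfSpace_le k.isLinear _) hp
  have h1 := hull f fun p hp => (h p hp).1
  have h2 := hull g fun p hp => (h p hp).2
  rw [mem_extremePoints]
  refine ⟨subset_convexHull ℝ P hq, ?_⟩
  rintro x hx y hy ⟨a, b, ha, hb, hab, rfl⟩
  have key : ∀ k : ℝ × ℝ →ₗ[ℝ] ℝ, k x ≤ k (a • x + b • y) → k y ≤ k (a • x + b • y) →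
      k x = k y := by
    intro k hx hy
    rw [map_add, map_smul, map_smul, smul_eq_mul, smul_eq_mul] at hx hy
    obtain rfl : b = 1 - a := by linarith
    refine le_antisymm ?_ ?_ <;> nlinarith
  obtain rfl := hfg x y (key f (h1 x hx) (h1 y hy)) (key g (h2 x hx) (h2 y hy))
  rw [← add_smul, hab, one_smul]
  exact ⟨rfl, rfl⟩

/-- The functional `lin t` as a linear map. -/
def linMap (t : ℝ) : ℝ × ℝ →ₗ[ℝ] ℝ := t • LinearMap.fst ℝ ℝ ℝ + LinearMap.snd ℝ ℝ ℝ

theorem linMap_apply (t : ℝ) (p : ℝ × ℝ) : linMap t p = lin t p := by simp [linMap, lin]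

theorem eq_of_lin_eq {t₁ t₂ : ℝ} (h : t₁ < t₂) {x y : ℝ × ℝ} (h1 : lin t₁ x = lin t₁ y)
    (h2 : lin t₂ x = lin t₂ y) : x = y := by
  unfold lin at *
  have h3 : x.1 = y.1 := by
    have : (t₂ - t₁) * (x.1 - y.1) = 0 := by linarith
    rcases mul_eq_zero.1 this with h | h <;> linarith
  rw [h3] at h1
  exact Prod.ext h3 (by linarith)

theorem IsTopPoint.mem_extremePoints {P : Set (ℝ × ℝ)} {q : ℝ × ℝ} (h : IsTopPoint P q)
    (hq : q ∈ P) : q ∈ (convexHull ℝ P).extremePoints ℝ := by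
  obtain ⟨t₁, t₂, h12, h⟩ := h
  refine mem_extremePoints_of_functionals (linMap t₁) (linMap t₂) ?_ hq ?_
  · simp only [linMap_apply]
    exact fun x y => eq_of_lin_eq h12
  · simpa only [linMap_apply] using h

/-- A chain point maximises `lin t` as soon as all earlier steps ascend and all later steps descend
for `t`. Strictly decreasing slopes leave a proper interval of such `t`. -/
theorem IsUpper.isTopPoint {c : List (ℝ × ℝ)} {P : Set (ℝ × ℝ)} (h : IsUpper c P)
    (hc : StrictChain c) {q : ℝ × ℝ} (hq : q ∈ c) : IsTopPoint P q := by
  obtain ⟨a, l, rfl⟩ := List.exists_cons_of_ne_nil hc.1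
  obtain ⟨_, hpos, hsl⟩ := hc
  rw [← walk_steps a l] at hq
  obtain ⟨l₁, l₂, hl, hq⟩ := mem_walk.1 hq
  rw [hl, List.pairwise_append] at hsl
  have hpos1 : ∀ e ∈ l₁, 0 < e.1 := fun e he => hpos e (by rw [hl]; simp [he])
  have hpos2 : ∀ e ∈ l₂, 0 < e.1 := fun e he => hpos e (by rw [hl]; simp [he])
  have key : ∀ t, (∀ e ∈ l₁, 0 ≤ t + slopeOf e) → (∀ e ∈ l₂, t + slopeOf e ≤ 0) →
      ∀ p ∈ P, lin t p ≤ lin t q := by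
    intro t h1 h2 p hp
    obtain ⟨r, hr, hle⟩ := h.2 p hp t
    rw [← walk_steps a l] at hr
    have h3 := lin_le_of_mem_walk hr t
    rw [hl, sum_map_max, ← lin_add, ← hq] at h3
    · exact hle.trans h3
    · intro e he
      rw [lin_eq_mul_slope (hpos1 e he)]
      exact mul_nonneg (hpos1 e he).le (h1 e he)
    · intro e he
      rw [lin_eq_mul_slope (hpos2 e he)]
      exact mul_nonpos_of_nonneg_of_nonpos (hpos2 e he).le (h2 e he)
  suffices ∃ t₁ t₂, t₁ < t₂ ∧ (∀ e ∈ l₁, 0 ≤ t₁ + slopeOf e) ∧ (∀ e ∈ l₂, t₂ + slopeOf e ≤ 0) by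
    obtain ⟨t₁, t₂, h12, h1, h2⟩ := this
    exact ⟨t₁, t₂, h12, fun p hp => ⟨key t₁ h1 (fun e he => by linarith [h2 e he]) p hp,
      key t₂ (fun e he => by linarith [h1 e he]) h2 p hp⟩⟩
  -- Only the step entering `q` and the step leaving `q` constrain `t`; they have the extreme slopes
  -- of their sides.
  have hlast : l₁ = [] ∨ ∃ e₁ ∈ l₁, ∀ e ∈ l₁, slopeOf e₁ ≤ slopeOf e := by
    rcases List.eq_nil_or_concat l₁ with h | ⟨l', e₁, rfl⟩
    · exact Or.inl h
    · right
      refine ⟨e₁, by simp, fun e he => ?_⟩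
      have := hsl.1
      simp only [List.concat_eq_append, List.pairwise_append, List.mem_append,
        List.mem_singleton] at this he
      rcases he with he | rfl
      · exact (this.2.2 e he e₁ rfl).le
      · exact le_rfl
  have hfirst : l₂ = [] ∨ ∃ e₂ ∈ l₂, ∀ e ∈ l₂, slopeOf e ≤ slopeOf e₂ := by
    cases l₂ with
    | nil => exact Or.inl rfl
    | cons e₂ l' =>
      right
      refine ⟨e₂, by simp, fun e he => ?_⟩
      rcases List.mem_cons.1 he with rfl | he
      · exact le_rfl
      · exact ((List.pairwise_cons.1 hsl.2.1).1 e he).le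
  -- The admissible `t` lie between minus the slope of the entering step and minus the slope of the
  -- leaving step. At an end of the chain one bound is missing, and an interval of length one
  -- serves.
  rcases hlast with rfl | ⟨e₁, he₁, h1⟩ <;> rcases hfirst with rfl | ⟨e₂, he₂, h2⟩
  · exact ⟨0, 1, by norm_num, by simp, by simp⟩
  · exact ⟨-slopeOf e₂ - 1, -slopeOf e₂, by linarith, by simp, fun e he => by linarith [h2 e he]⟩
  · exact ⟨-slopeOf e₁, -slopeOf e₁ + 1, by linarith, fun e he => by linarith [h1 e he], by simp⟩
  · exact ⟨-slopeOf e₁, -slopeOf e₂, by linarith [hsl.2.2 e₁ he₁ e₂ he₂],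
      fun e he => by linarith [h1 e he], fun e he => by linarith [h2 e he]⟩

theorem StrictChain.pairwise_fst {c : List (ℝ × ℝ)} (hc : StrictChain c) :
    c.Pairwise fun p q => p.1 < q.1 := by
  obtain ⟨a, l, rfl⟩ := List.exists_cons_of_ne_nil hc.1
  rw [← walk_steps a l]
  exact pairwise_walk hc.2.1

/-- The reflection at the horizontal axis. -/
def reflectY (p : ℝ × ℝ) : ℝ × ℝ := (p.1, -p.2)

@[simp] theorem reflectY_reflectY (p : ℝ × ℝ) : reflectY (reflectY p) = p := by simp [reflectY]

theorem reflectY_injective : Function.Injective reflectY := fun p q h => by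
  simpa using congrArg reflectY h

theorem orientation_reflectY (a b c : ℝ × ℝ) :
    orientation (reflectY a) (reflectY b) (reflectY c) = -orientation a b c := by
  simp [orientation, reflectY]; ring

/-- Take a functional with `q` as unique maximiser. Weight its inequality at `p` by the horizontal
distance from `q` to `r`, and the one at `r` by the distance from `p` to `q`. The sum does not
involve `t` and is the orientation. One weight may vanish, but not both. -/
theorem IsTopPoint.orientation_neg {P : Set (ℝ × ℝ)} {p q r : ℝ × ℝ} (h : IsTopPoint P q) (hp : p ∈ P)
    (hr : r ∈ P) (hpq : p ≠ q) (hrq : r ≠ q) (h1 : p.1 ≤ q.1) (h2 : q.1 ≤ r.1) (h3 : p.1 < r.1) :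
    orientation p q r < 0 := by
  obtain ⟨t, ht⟩ := h.exists_lt
  have k1 := ht p hp hpq
  have k2 := ht r hr hrq
  unfold orientation lin at *
  rcases h1.lt_or_eq with h | h
  · nlinarith [mul_le_mul_of_nonneg_left k1.le (sub_nonneg.2 h2), mul_lt_mul_of_pos_left k2
      (sub_pos.2 h)]
  · have h' : q.1 < r.1 := by linarith
    nlinarith [mul_le_mul_of_nonneg_left k2.le (sub_nonneg.2 h1), mul_lt_mul_of_pos_left k1
      (sub_pos.2 h')]

theorem IsTopPoint.orientation_pos {P : Set (ℝ × ℝ)} {p q r : ℝ × ℝ}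
    (h : IsTopPoint (reflectY '' P) (reflectY q)) (hp : p ∈ P)
    (hr : r ∈ P) (hpq : p ≠ q) (hrq : r ≠ q) (h1 : p.1 ≤ q.1) (h2 : q.1 ≤ r.1) (h3 : p.1 < r.1) :
    0 < orientation p q r := by
  have := h.orientation_neg (p := reflectY p) (r := reflectY r) ⟨p, hp, rfl⟩ ⟨r, hr, rfl⟩
    (fun h => hpq (reflectY_injective h)) (fun h => hrq (reflectY_injective h)) h1 h2 h3
  rw [orientation_reflectY] at this
  linarith

theorem orientation_rotate (a b c : ℝ × ℝ) : orientation b c a = orientation a b c := by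
  unfold orientation; ring

theorem orientation_swap (a b c : ℝ × ℝ) : orientation b a c = -orientation a b c := by
  unfold orientation; ring

/-- A set is contained in the convex hull of its upper and lower chain. -/
theorem subset_convexHull_chains {P : Set (ℝ × ℝ)} {U D : List (ℝ × ℝ)} (hU : Covers U P)
    (hD : Covers D (reflectY '' P)) :
    P ⊆ convexHull ℝ ({q | q ∈ U} ∪ reflectY '' {q | q ∈ D}) := by
  intro p hp
  set F : Set (ℝ × ℝ) := {q | q ∈ U} ∪ reflectY '' {q | q ∈ D}
  have hUfin : {q | q ∈ U}.Finite := U.finite_toSet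
  have hF : F.Finite := hUfin.union (D.finite_toSet.image _)
  -- A point outside is strictly separated by some `α x + β y`. The sign of `β` tells which chain
  -- contradicts this.
  by_contra hc
  obtain ⟨f, s, h1, h2⟩ := geometric_hahn_banach_closed_point (convex_convexHull ℝ F)
    (hF.isClosed_convexHull ℝ) hc
  have hf : ∀ q : ℝ × ℝ, f q = f (1, 0) * q.1 + f (0, 1) * q.2 := by
    intro q
    have : q = q.1 • ((1 : ℝ), (0 : ℝ)) + q.2 • ((0 : ℝ), (1 : ℝ)) := by simp
    conv_lhs => rw [this]
    rw [map_add, map_smul, map_smul]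
    simp only [smul_eq_mul]
    ring
  set α := f (1, 0)
  set β := f (0, 1)
  have h3 : ∀ q ∈ F, f q < f p := fun q hq => (h1 q (subset_convexHull ℝ F hq)).trans h2
  rcases lt_trichotomy β 0 with hβ | hβ | hβ
  · obtain ⟨q, hq, hl⟩ := hD (reflectY p) ⟨p, hp, rfl⟩ (-(α / β))
    have := h3 (reflectY q) (Or.inr ⟨q, hq, rfl⟩)
    rw [hf, hf p] at this
    simp only [lin, reflectY] at hl this
    have h4 := mul_le_mul_of_nonneg_left hl (neg_nonneg.2 hβ.le)
    have h5 : β * (α / β) = α := mul_div_cancel₀ α hβ.ne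
    nlinarith [congrArg (· * p.1) h5, congrArg (· * q.1) h5]
  -- A vertical separating line corresponds to no `lin t`. It is replaced by a functional steeper
  -- than all slopes from `p` to the finitely many chain points; the factor `α` gives the right
  -- sign.
  · obtain ⟨M, hM⟩ := (hUfin.image fun q => (q.2 - p.2) / (α * (p.1 - q.1))).bddAbove
    obtain ⟨q, hq, hl⟩ := hU p hp (α * (|M| + 1))
    have h4 := hM ⟨q, hq, rfl⟩
    have h5 := h3 q (Or.inl hq)
    rw [hf, hf p, hβ] at h5
    have h6 : 0 < α * (p.1 - q.1) := by linarith
    simp only at h4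
    rw [div_le_iff₀ h6] at h4
    simp only [lin] at hl
    nlinarith [le_abs_self M, mul_le_mul_of_nonneg_right (le_abs_self M) h6.le]
  · obtain ⟨q, hq, hl⟩ := hU p hp (α / β)
    have := h3 q (Or.inl hq)
    rw [hf, hf p] at this
    simp only [lin] at hl
    have h4 := mul_le_mul_of_nonneg_left hl hβ.le
    have h5 : β * (α / β) = α := mul_div_cancel₀ α hβ.ne'
    nlinarith [congrArg (· * p.1) h5, congrArg (· * q.1) h5]

/-- The chains span the polygon, so they contain its extreme points. Conversely every chain point
maximises two functionals on the point set, after reflection for the lower chain. -/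
theorem extremePoints_eq_chains {P : Set (ℝ × ℝ)} {U D : List (ℝ × ℝ)} (hU : IsUpper U P)
    (hD : IsUpper D (reflectY '' P)) (cU : StrictChain U) (cD : StrictChain D) :
    (convexHull ℝ P).extremePoints ℝ = {q | q ∈ U} ∪ reflectY '' {q | q ∈ D} := by
  set F : Set (ℝ × ℝ) := {q | q ∈ U} ∪ reflectY '' {q | q ∈ D}
  have hFP : F ⊆ P := by
    rintro q (hq | ⟨r, hr, rfl⟩)
    · exact hU.1 q hq
    · obtain ⟨p, hp, rfl⟩ := hD.1 r hr
      simpa using hp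
  have hhull : convexHull ℝ P = convexHull ℝ F :=
    (convexHull_min (subset_convexHull_chains hU.2 hD.2) (convex_convexHull ℝ F)).antisymm
      (convexHull_mono hFP)
  apply Set.Subset.antisymm
  · rw [hhull]
    exact extremePoints_convexHull_subset
  · rintro q (hq | ⟨r, hr, rfl⟩)
    · exact (hU.isTopPoint cU hq).mem_extremePoints (hU.1 q hq)
    · obtain ⟨t₁, t₂, h12, h⟩ := hD.isTopPoint cD hr
      have hr' : reflectY r ∈ P := hFP (Or.inr ⟨r, hr, rfl⟩)
      let ρ : ℝ × ℝ →ₗ[ℝ] ℝ × ℝ :=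
        (LinearMap.fst ℝ ℝ ℝ).prod (-LinearMap.snd ℝ ℝ ℝ)
      have hρ : ∀ p, ρ p = reflectY p := fun p => rfl
      refine mem_extremePoints_of_functionals (linMap t₁ ∘ₗ ρ) (linMap t₂ ∘ₗ ρ) ?_ hr' ?_
      · simp only [LinearMap.comp_apply, hρ, linMap_apply]
        exact fun x y h1 h2 => reflectY_injective (eq_of_lin_eq h12 h1 h2)
      · simp only [LinearMap.comp_apply, hρ, linMap_apply, reflectY_reflectY]
        exact fun p hp => h _ ⟨p, hp, rfl⟩

/-- The lower chain followed by the upper chain from right to left, without the common end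
points. -/
noncomputable def cyclicList (U D : List (ℝ × ℝ)) : List (ℝ × ℝ) :=
  D.map reflectY ++ U.reverse.filter fun p =>
    decide (¬ (p = reflectY (D.headD 0) ∨ p = reflectY (D.getLastD 0)))

/-- The lower chain runs to the right and the upper chain back to the left. Vertical edges need no
special treatment: the upper ends are dropped only when they coincide with lower ends. -/
theorem isVertexList_cyclicList {P : Set (ℝ × ℝ)} {U D : List (ℝ × ℝ)} (hU : IsUpper U P)
    (hD : IsUpper D (reflectY '' P)) (cU : StrictChain U) (cD : StrictChain D) :
    IsVertexList (fun j : Fin (cyclicList U D).length => (cyclicList U D)[j]) (convexHull ℝ P) := by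
  set A := D.map reflectY with hA
  set R := U.reverse.filter fun p =>
    decide (¬ (p = reflectY (D.headD 0) ∨ p = reflectY (D.getLastD 0))) with hR
  have hV : cyclicList U D = A ++ R := rfl
  have memA : ∀ q ∈ A, q ∈ P ∧ IsTopPoint (reflectY '' P) (reflectY q) := by
    intro q hq
    obtain ⟨r, hr, rfl⟩ := List.mem_map.1 hq
    obtain ⟨p, hp, hpr⟩ := hD.1 r hr
    refine ⟨by rw [← hpr]; simpa using hp, ?_⟩
    simpa using hD.isTopPoint cD hr
  have memR : ∀ q ∈ R, q ∈ P ∧ IsTopPoint P q := by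
    intro q hq
    have : q ∈ U := by simpa using (List.mem_filter.1 hq).1
    exact ⟨hU.1 q this, hU.isTopPoint cU this⟩
  have incA : A.Pairwise fun p q => p.1 < q.1 := by
    rw [hA, List.pairwise_map]
    exact cD.pairwise_fst
  have decR : R.Pairwise fun p q => q.1 < p.1 :=
    (List.pairwise_reverse.2 cU.pairwise_fst).filter _
  -- A common point strictly between the ends of the lower chain would lie both strictly above and
  -- strictly below the chord joining these ends.
  have disj : ∀ q ∈ R, q ∉ A := by
    intro q hqR hqA
    have hq := (List.mem_filter.1 hqR).2
    simp only [decide_eq_true_eq, not_or] at hq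
    obtain ⟨r, hr, rfl⟩ := List.mem_map.1 hqA
    have hne := cD.1
    obtain ⟨a, D', rfl⟩ := List.exists_cons_of_ne_nil hne
    have ha : r ≠ a := fun h => hq.1 (by simp [h])
    have hr' : r ∈ D' := (List.mem_cons.1 hr).resolve_left ha
    have har : a.1 < r.1 := (List.pairwise_cons.1 cD.pairwise_fst).1 r hr'
    obtain ⟨D'', b, rfl⟩ := (List.eq_nil_or_concat D').resolve_left (List.ne_nil_of_mem hr')
    have hb : r ≠ b := fun h => hq.2 (by
      rw [h, List.concat_eq_append, ← List.cons_append, List.getLastD_concat])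
    have hrb : r.1 < b.1 := by
      have h1 := (List.pairwise_cons.1 cD.pairwise_fst).2
      simp only [List.concat_eq_append, List.pairwise_append, List.mem_append,
        List.mem_singleton] at h1 hr'
      exact h1.2.2 r (hr'.resolve_right hb) b rfl
    have hPa := (memA (reflectY a) (by simp [hA])).1
    have hPb := (memA (reflectY b) (by simp [hA])).1
    have h1 := (memR _ hqR).2.orientation_neg hPa hPb (fun h => ha (reflectY_injective h).symm)
      (fun h => hb (reflectY_injective h).symm) har.le hrb.le (har.trans hrb)
    have h2 := (memA _ hqA).2.orientation_pos hPa hPb (fun h => ha (reflectY_injective h).symm)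
      (fun h => hb (reflectY_injective h).symm) har.le hrb.le (har.trans hrb)
    linarith
  have nodup : (A ++ R).Nodup := by
    refine List.Nodup.append (incA.imp fun h e => ?_) (decR.imp fun h e => ?_) ?_
    · rw [e] at h; exact lt_irrefl _ h
    · rw [e] at h; exact lt_irrefl _ h
    · exact fun q h1 h2 => disj q h2 h1
  have hinj : ∀ i j : ℕ, ∀ hi hj, i ≠ j → (A ++ R)[i]'hi ≠ (A ++ R)[j]'hj := by
    intro i j hi hj hij h
    exact hij ((nodup.getElem_inj_iff).1 h)
  refine ⟨?_, ?_, ?_⟩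
  · intro i j h
    by_contra hij
    exact hinj i j i.2 j.2 (fun h => hij (Fin.ext h)) h
  · rw [extremePoints_eq_chains hU hD cU cD]
    ext q
    have h1 : q ∈ Set.range (fun j : Fin (cyclicList U D).length => (cyclicList U D)[j]) ↔
        q ∈ A ++ R := by
      rw [← hV, List.mem_iff_getElem]
      constructor
      · rintro ⟨j, rfl⟩; exact ⟨j, j.2, rfl⟩
      · rintro ⟨j, hj, rfl⟩; exact ⟨⟨j, hj⟩, rfl⟩
    have hh : D.headD 0 ∈ D := by
      obtain ⟨a, D', rfl⟩ := List.exists_cons_of_ne_nil cD.1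
      simp
    have hl : D.getLastD 0 ∈ D := by
      obtain ⟨D', b, rfl⟩ := (List.eq_nil_or_concat D).resolve_left cD.1
      simp
    rw [h1, List.mem_append, hR, List.mem_filter, hA, List.mem_map]
    simp only [decide_eq_true_eq, List.mem_reverse, Set.mem_union, Set.mem_ofPred_eq, Set.mem_image]
    constructor
    · rintro (h | h)
      · exact Or.inr h
      · exact Or.inl h.1
    · rintro (h | h)
      · by_cases hc : q = reflectY (D.headD 0) ∨ q = reflectY (D.getLastD 0)
        · left
          rcases hc with rfl | rfl
          · exact ⟨_, hh, rfl⟩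
          · exact ⟨_, hl, rfl⟩
        · exact Or.inr ⟨h, hc⟩
      · exact Or.inl h
  · rintro ⟨i, hi⟩ ⟨j, hj⟩ ⟨k, hk⟩ hij hjk
    simp only [Fin.mk_lt_mk] at hij hjk
    have nij := hinj i j hi hj (by omega)
    have njk := hinj j k hj hk (by omega)
    have nik := hinj i k hi hk (by omega)
    change 0 < orientation ((A ++ R)[i]'hi) ((A ++ R)[j]'hj) ((A ++ R)[k]'hk)
    have lA : ∀ m (hm : m < (A ++ R).length), m < A.length → (A ++ R)[m] ∈ A := by
      intro m hm hm'
      rw [List.getElem_append_left hm']; exact List.getElem_mem _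
    have lR : ∀ m (hm : m < (A ++ R).length), ¬ m < A.length → (A ++ R)[m] ∈ R := by
      intro m hm hm'
      rw [List.getElem_append_right (not_lt.1 hm')]; exact List.getElem_mem _
    have oA : ∀ m m' (hm : m < (A ++ R).length) (hm' : m' < (A ++ R).length), m < m' →
        m' < A.length → (A ++ R)[m].1 < (A ++ R)[m'].1 := by
      intro m m' hm hm' h h'
      rw [List.getElem_append_left h', List.getElem_append_left (h.trans h')]
      exact List.pairwise_iff_getElem.1 incA _ _ _ _ h
    have oR : ∀ m m' (hm : m < (A ++ R).length) (hm' : m' < (A ++ R).length), m < m' →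
        ¬ m < A.length → (A ++ R)[m'].1 < (A ++ R)[m].1 := by
      intro m m' hm hm' h h'
      rw [List.getElem_append_right (by omega), List.getElem_append_right (by omega)]
      exact List.pairwise_iff_getElem.1 decR _ _ _ _ (by omega)
    have PP : ∀ m (hm : m < (A ++ R).length), (A ++ R)[m] ∈ P := by
      intro m hm
      by_cases h : m < A.length
      · exact (memA _ (lA m hm h)).1
      · exact (memR _ (lR m hm h)).1
    generalize_proofs at *
    set a := (A ++ R)[i]'hi
    set b := (A ++ R)[j]'hj
    set c := (A ++ R)[k]'hk
    have Pa : a ∈ P := PP i hi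
    have Pb : b ∈ P := PP j hj
    have Pc : c ∈ P := PP k hk
    -- The point with the middle abscissa decides. On the lower chain it is below the chord of the
    -- other two, on the upper chain above. Rotations and swaps bring the triple back to the listed
    -- order.
    by_cases hjA : j < A.length
    · have hab : a.1 < b.1 := oA i j hi hj hij hjA
      have Ta := (memA a (lA i hi (hij.trans hjA))).2
      have Tb := (memA b (lA j hj hjA)).2
      by_cases hkA : k < A.length
      · exact Tb.orientation_pos Pa Pc nij njk.symm hab.le (oA j k hj hk hjk hkA).le
          (hab.trans (oA j k hj hk hjk hkA))
      · have Tc := (memR c (lR k hk hkA)).2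
        rcases le_total c.1 a.1 with h | h
        · rw [← orientation_rotate, ← orientation_rotate]
          exact Ta.orientation_pos Pc Pb nik.symm nij.symm h hab.le (h.trans_lt hab)
        · rcases le_total c.1 b.1 with h' | h'
          · have := Tc.orientation_neg Pa Pb nik njk h h' hab
            rw [← orientation_rotate, ← orientation_rotate, orientation_swap] at this
            linarith
          · exact Tb.orientation_pos Pa Pc nij njk.symm hab.le h' (hab.trans_le h')
    · have hbc : c.1 < b.1 := oR j k hj hk hjk hjA
      have Tb := (memR b (lR j hj hjA)).2
      have Tc := (memR c (lR k hk (by omega))).2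
      by_cases hiA : i < A.length
      · have Ta := (memA a (lA i hi hiA)).2
        rcases le_total a.1 c.1 with h | h
        · have := Tc.orientation_neg Pa Pb nik njk h hbc.le (h.trans_lt hbc)
          rw [← orientation_rotate, ← orientation_rotate, orientation_swap] at this
          linarith
        · rcases le_total a.1 b.1 with h' | h'
          · have := Ta.orientation_pos Pc Pb nik.symm nij.symm h h' hbc
            rw [orientation_rotate, orientation_rotate] at this
            exact this
          · have := Tb.orientation_neg Pc Pa njk.symm nij hbc.le h' (hbc.trans_le h')
            rw [← orientation_rotate, orientation_swap] at this
            linarith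
      · have hab : b.1 < a.1 := oR i j hi hj hij hiA
        have := Tb.orientation_neg Pc Pa njk.symm nij hbc.le hab.le (hbc.trans hab)
        rw [← orientation_rotate, orientation_swap] at this
        linarith

/-! ### Sorting along a binary tree -/

/-- Mergesort along a binary tree with heap numbering: the node `v` of height `h` has the children
`2 v` and `2 v + 1`, and the leaf `q` carries `f q`. -/
def treeSort (le : ℕ → ℕ → Bool) (f : ℕ → ℕ) : ℕ → ℕ → List ℕ
  | 0, v => [f v]
  | h + 1, v => (treeSort le f h (2 * v)).merge (treeSort le f h (2 * v + 1)) le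

theorem length_treeSort (le : ℕ → ℕ → Bool) (f : ℕ → ℕ) (h v : ℕ) :
    (treeSort le f h v).length = 2 ^ h := by
  induction h generalizing v with
  | zero => simp [treeSort]
  | succ h ih => simp [treeSort, ih, pow_succ]; ring

theorem treeSort_perm (le : ℕ → ℕ → Bool) (f : ℕ → ℕ) (h v : ℕ) :
    (treeSort le f h v).Perm ((List.range' (v * 2 ^ h) (2 ^ h)).map f) := by
  induction h generalizing v with
  | zero => simp [treeSort]
  | succ h ih =>
    have e : List.range' (v * 2 ^ (h + 1)) (2 ^ (h + 1)) =
        List.range' (2 * v * 2 ^ h) (2 ^ h) ++ List.range' ((2 * v + 1) * 2 ^ h) (2 ^ h) := by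
      have e1 : v * 2 ^ (h + 1) = 2 * v * 2 ^ h := by ring
      have e2 : 2 ^ (h + 1) = 2 ^ h + 2 ^ h := by ring
      have e3 : (2 * v + 1) * 2 ^ h = 2 * v * 2 ^ h + 2 ^ h := by ring
      rw [e1, e2, e3, ← List.range'_append_1]
    rw [treeSort, e, List.map_append]
    exact (List.merge_perm_append (le := le)).trans ((ih _).append (ih _))

theorem pairwise_treeSort {le : ℕ → ℕ → Bool} (trans : ∀ a b c, le a b → le b c → le a c)
    (total : ∀ a b, le a b || le b a) (f : ℕ → ℕ) (h v : ℕ) :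
    (treeSort le f h v).Pairwise fun a b => le a b = true := by
  induction h generalizing v with
  | zero => simp [treeSort]
  | succ h ih => exact List.pairwise_merge trans total _ _ (ih _) (ih _)

theorem sum_map_filter_eq_ite {α M : Type*} [AddCommMonoid M] (p : α → Bool) (f : α → M)
    (l : List α) : ((l.filter p).map f).sum = (l.map fun e => if p e then f e else 0).sum := by
  induction l with
  | nil => simp
  | cons a l ih => by_cases h : p a <;> simp [h, ih]

/-! ### The events of a semiorder -/

section Events

variable (H : ℕ) (u : ℕ → ℝ) (w : ℕ → ℝ × ℝ)

/-- The element of an event: `i` enters at event `i` and leaves at event `2 ^ H + i`. -/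
def evElem (e : ℕ) : ℕ := if e < 2 ^ H then e else e - 2 ^ H

/-- The other event of the same element. -/
def evPartner (e : ℕ) : ℕ := if e < 2 ^ H then e + 2 ^ H else e - 2 ^ H

/-- The time of an event. -/
noncomputable def evKey (e : ℕ) : ℝ := if e < 2 ^ H then u e else u (e - 2 ^ H) + 1

/-- The weight of the element of an event. -/
def evWeight (e : ℕ) : ℝ × ℝ := w (evElem H e)

/-- The chronological order of the events; at equal times, elements enter first. -/
noncomputable def keyLe (a b : ℕ) : Bool :=
  decide (evKey H u a < evKey H u b ∨ (evKey H u a = evKey H u b ∧ a ≤ b))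

/-- The chronological list of events. -/
noncomputable def evOrder : List ℕ :=
  treeSort (keyLe H u) (fun q => q - 2 ^ (H + 1)) (H + 1) 1

/-- The event at a leaf of the tree. -/
noncomputable def evAt (q : ℕ) : ℕ := (evOrder H u).getD (q - 2 ^ (H + 1)) 0

/-- The leaf of an event. -/
noncomputable def leafOf (e : ℕ) : ℕ := 2 ^ (H + 1) + (evOrder H u).idxOf e

theorem keyLe_trans (a b c : ℕ) (h : keyLe H u a b) (h' : keyLe H u b c) : keyLe H u a c := by
  simp only [keyLe, decide_eq_true_eq] at *
  rcases h with h | h <;> rcases h' with h' | h'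
  · left; linarith
  · left; linarith [h'.1]
  · left; linarith [h.1]
  · right; exact ⟨by linarith [h.1, h'.1], by omega⟩

theorem keyLe_total (a b : ℕ) : keyLe H u a b || keyLe H u b a := by
  simp only [keyLe, Bool.or_eq_true, decide_eq_true_eq]
  rcases lt_trichotomy (evKey H u a) (evKey H u b) with h | h | h
  · simp [h]
  · rcases le_total a b with h' | h' <;> simp [h, h']
  · simp [h]

theorem evOrder_perm : (evOrder H u).Perm (List.range (2 ^ (H + 1))) := by
  refine (treeSort_perm _ _ _ _).trans ?_
  rw [one_mul, List.range'_eq_map_range, List.map_map]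
  refine List.Perm.of_eq ?_
  conv_rhs => rw [← List.map_id (List.range _)]
  exact List.map_congr_left fun x _ => by simp

theorem length_evOrder : (evOrder H u).length = 2 ^ (H + 1) := length_treeSort _ _ _ _

theorem nodup_evOrder : (evOrder H u).Nodup := (evOrder_perm H u).nodup_iff.2 List.nodup_range

theorem mem_evOrder {e : ℕ} : e ∈ evOrder H u ↔ e < 2 ^ (H + 1) := by
  rw [(evOrder_perm H u).mem_iff, List.mem_range]

theorem leafOf_lt {e : ℕ} (he : e < 2 ^ (H + 1)) : leafOf H u e < 2 * 2 ^ (H + 1) := by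
  have := List.idxOf_lt_length_iff.2 ((mem_evOrder H u).2 he)
  rw [length_evOrder] at this
  unfold leafOf; omega

theorem le_leafOf (e : ℕ) : 2 ^ (H + 1) ≤ leafOf H u e := Nat.le_add_right _ _

theorem evAt_lt (q : ℕ) : evAt H u q < 2 ^ (H + 1) := by
  unfold evAt
  by_cases h : q - 2 ^ (H + 1) < (evOrder H u).length
  · rw [List.getD_eq_getElem _ _ h]
    exact (mem_evOrder H u).1 (List.getElem_mem h)
  · rw [List.getD_eq_default _ _ (not_lt.1 h)]
    positivity

theorem evAt_leafOf {e : ℕ} (he : e < 2 ^ (H + 1)) : evAt H u (leafOf H u e) = e := by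
  have := List.idxOf_lt_length_iff.2 ((mem_evOrder H u).2 he)
  unfold evAt leafOf
  rw [Nat.add_sub_cancel_left, List.getD_eq_getElem _ _ this, List.getElem_idxOf]

theorem leafOf_evAt {q : ℕ} (h1 : 2 ^ (H + 1) ≤ q) (h2 : q < 2 * 2 ^ (H + 1)) :
    leafOf H u (evAt H u q) = q := by
  have : q - 2 ^ (H + 1) < (evOrder H u).length := by rw [length_evOrder]; omega
  unfold evAt leafOf
  rw [List.getD_eq_getElem _ _ this, (nodup_evOrder H u).idxOf_getElem]
  omega

theorem keyLe_of_leafOf_lt {a b : ℕ} (ha : a < 2 ^ (H + 1)) (hb : b < 2 ^ (H + 1))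
    (h : leafOf H u a < leafOf H u b) : keyLe H u a b := by
  have ha' := List.idxOf_lt_length_iff.2 ((mem_evOrder H u).2 ha)
  have hb' := List.idxOf_lt_length_iff.2 ((mem_evOrder H u).2 hb)
  have hs := List.pairwise_iff_getElem.1
    (pairwise_treeSort (keyLe_trans H u) (keyLe_total H u) (fun q => q - 2 ^ (H + 1)) (H + 1) 1)
    _ _ ha' hb' (by unfold leafOf at h; omega)
  have e1 := List.getElem_idxOf ha'
  have e2 := List.getElem_idxOf hb'
  have hs' : keyLe H u ((evOrder H u)[(evOrder H u).idxOf a]) ((evOrder H u)[(evOrder H u).idxOf b]) :=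
    hs
  rwa [e1, e2] at hs'

theorem leafOf_lt_of_key {a b : ℕ} (ha : a < 2 ^ (H + 1)) (hb : b < 2 ^ (H + 1))
    (h : ¬ keyLe H u b a) : leafOf H u a < leafOf H u b := by
  by_contra hc
  rcases (not_lt.1 hc).lt_or_eq with h' | h'
  · exact h (keyLe_of_leafOf_lt H u hb ha h')
  · have : b = a := by rw [← evAt_leafOf H u ha, ← evAt_leafOf H u hb, h']
    subst this
    exact h (by simp [keyLe])

theorem leafOf_enter_lt_leave {i : ℕ} (hi : i < 2 ^ H) :
    leafOf H u i < leafOf H u (2 ^ H + i) := by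
  refine leafOf_lt_of_key H u (by rw [pow_succ]; omega) (by rw [pow_succ]; omega) ?_
  simp [keyLe, evKey, hi]

/-- A sum over a block of leaves is a sum over elements. -/
theorem sum_treeSort {M : Type*} [AddCommMonoid M] (le : ℕ → ℕ → Bool) (f : ℕ → M) {h v : ℕ}
    (h1 : 2 ^ (H + 1) ≤ v * 2 ^ h) (h2 : (v + 1) * 2 ^ h ≤ 2 * 2 ^ (H + 1)) :
    ((treeSort le (evAt H u) h v).map f).sum = ∑ i ∈ Finset.range (2 ^ H),
      ((if v * 2 ^ h ≤ leafOf H u i ∧ leafOf H u i < (v + 1) * 2 ^ h then f i else 0) +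
       (if v * 2 ^ h ≤ leafOf H u (2 ^ H + i) ∧ leafOf H u (2 ^ H + i) < (v + 1) * 2 ^ h
        then f (2 ^ H + i) else 0)) := by
  classical
  rw [((treeSort_perm le (evAt H u) h v).map f).sum_eq, List.map_map, Finset.sum_add_distrib,
    ← Finset.sum_range_add (fun e => if v * 2 ^ h ≤ leafOf H u e ∧
      leafOf H u e < (v + 1) * 2 ^ h then f e else 0)]
  have e0 : 2 ^ H + 2 ^ H = 2 ^ (H + 1) := by ring
  rw [e0, ← Finset.sum_filter]
  have e1 : ((List.range' (v * 2 ^ h) (2 ^ h)).map (f ∘ evAt H u)).sum =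
      ∑ q ∈ Finset.Ico (v * 2 ^ h) ((v + 1) * 2 ^ h), f (evAt H u q) := by
    have e2 : (v + 1) * 2 ^ h - v * 2 ^ h = 2 ^ h := by rw [add_mul]; omega
    rw [Finset.sum_Ico_eq_sum_range, List.range'_eq_map_range, List.map_map, e2]
    rfl
  rw [e1]
  refine Finset.sum_nbij' (evAt H u) (leafOf H u) ?_ ?_ ?_ ?_ ?_
  · intro q hq
    rw [Finset.mem_Ico] at hq
    rw [Finset.mem_filter, leafOf_evAt H u (h1.trans hq.1) (hq.2.trans_le h2)]
    exact ⟨Finset.mem_range.2 (evAt_lt H u q), hq⟩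
  · intro e he
    exact Finset.mem_Ico.2 (Finset.mem_filter.1 he).2
  · intro q hq
    rw [Finset.mem_Ico] at hq
    exact leafOf_evAt H u (h1.trans hq.1) (hq.2.trans_le h2)
  · intro e he
    exact evAt_leafOf H u (Finset.mem_range.1 (Finset.mem_filter.1 he).1)
  · intros; rfl

/-- What an element with weight `z` whose events are at the leaves `a < b` contributes when exactly
the leaves before `p` of the block from `s` to `t` have been passed. -/
def stateTerm (s t p a b : ℕ) (z : ℝ × ℝ) : Set (ℝ × ℝ) :=
  if (s ≤ a ∧ a < t) ∨ (s ≤ b ∧ b < t) then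
    if p ≤ a then {0} else if p ≤ b then {0, z} else {z}
  else {0}

open Pointwise in
/-- The sums that are possible within a block of leaves. -/
noncomputable def blockSet (s t : ℕ) : Set (ℝ × ℝ) :=
  {x | ∃ p, s ≤ p ∧ p ≤ t ∧ x ∈ ∑ i ∈ Finset.range (2 ^ H),
    stateTerm s t p (leafOf H u i) (leafOf H u (2 ^ H + i)) (w i)}

-- With the cut in the left half, no event of the right half has been passed. An element entering
-- there contributes nothing; one leaving there is free if it entered before the block. If it
-- entered in the left half, the left half already accounts for it.
open Pointwise in
theorem stateTerm_left {s m t p a b : ℕ} (z : ℝ × ℝ) (hmt : m ≤ t) (hab : a < b)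
    (h1 : s ≤ p) (h2 : p ≤ m) :
    stateTerm s t p a b z = stateTerm s m p a b z + if m ≤ b ∧ b < t ∧ a < s then {0, z} else 0 := by
  simp only [stateTerm, ← Set.singleton_zero]
  split_ifs <;> first | omega | simp

-- With the cut in the right half, all events of the left half have been passed. A departure there
-- fixes the weight; an entrance there makes the element free if it departs after the block. If it
-- departs in the right half, that half accounts for it.
open Pointwise in
theorem stateTerm_right {s m t p a b : ℕ} (z : ℝ × ℝ) (hsm : s ≤ m) (hab : a < b)
    (h1 : m ≤ p) (h2 : p ≤ t) :
    stateTerm s t p a b z = stateTerm m t p a b z +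
      ((if s ≤ a ∧ a < m ∧ t ≤ b then {0, z} else 0) + if s ≤ b ∧ b < m then {z} else 0) := by
  simp only [stateTerm, ← Set.singleton_zero]
  split_ifs <;> first | omega | simp

open Pointwise in
/-- A block is the union of its halves, each of them enlarged by the events of the other half. -/
theorem blockSet_eq_union {s m t : ℕ} (hsm : s ≤ m) (hmt : m ≤ t) :
    blockSet H u w s t =
      (blockSet H u w s m + ∑ i ∈ Finset.range (2 ^ H),
        if m ≤ leafOf H u (2 ^ H + i) ∧ leafOf H u (2 ^ H + i) < t ∧ leafOf H u i < s
          then {0, w i} else 0) ∪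
      (blockSet H u w m t + ∑ i ∈ Finset.range (2 ^ H),
        ((if s ≤ leafOf H u i ∧ leafOf H u i < m ∧ t ≤ leafOf H u (2 ^ H + i)
          then {0, w i} else 0) +
         if s ≤ leafOf H u (2 ^ H + i) ∧ leafOf H u (2 ^ H + i) < m then {w i} else 0)) := by
  have hl : ∀ p, s ≤ p → p ≤ m → ∑ i ∈ Finset.range (2 ^ H),
      stateTerm s t p (leafOf H u i) (leafOf H u (2 ^ H + i)) (w i) =
      (∑ i ∈ Finset.range (2 ^ H),
        stateTerm s m p (leafOf H u i) (leafOf H u (2 ^ H + i)) (w i)) +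
      ∑ i ∈ Finset.range (2 ^ H),
        if m ≤ leafOf H u (2 ^ H + i) ∧ leafOf H u (2 ^ H + i) < t ∧ leafOf H u i < s
          then {0, w i} else 0 := by
    intro p h1 h2
    rw [← Finset.sum_add_distrib]
    exact Finset.sum_congr rfl fun i hi => stateTerm_left _ hmt
      (leafOf_enter_lt_leave H u (Finset.mem_range.1 hi)) h1 h2
  have hr : ∀ p, m ≤ p → p ≤ t → ∑ i ∈ Finset.range (2 ^ H),
      stateTerm s t p (leafOf H u i) (leafOf H u (2 ^ H + i)) (w i) =
      (∑ i ∈ Finset.range (2 ^ H),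
        stateTerm m t p (leafOf H u i) (leafOf H u (2 ^ H + i)) (w i)) +
      ∑ i ∈ Finset.range (2 ^ H),
        ((if s ≤ leafOf H u i ∧ leafOf H u i < m ∧ t ≤ leafOf H u (2 ^ H + i)
          then {0, w i} else 0) +
         if s ≤ leafOf H u (2 ^ H + i) ∧ leafOf H u (2 ^ H + i) < m then {w i} else 0) := by
    intro p h1 h2
    rw [← Finset.sum_add_distrib]
    exact Finset.sum_congr rfl fun i hi => stateTerm_right _ hsm
      (leafOf_enter_lt_leave H u (Finset.mem_range.1 hi)) h1 h2
  ext x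
  simp only [Set.mem_union, Set.mem_add, blockSet, Set.mem_ofPred_eq]
  constructor
  · rintro ⟨p, h1, h2, hx⟩
    rcases le_total p m with h | h
    · rw [hl p h1 h, Set.mem_add] at hx
      obtain ⟨y, hy, z, hz, rfl⟩ := hx
      exact Or.inl ⟨y, ⟨p, h1, h, hy⟩, z, hz, rfl⟩
    · rw [hr p h h2, Set.mem_add] at hx
      obtain ⟨y, hy, z, hz, rfl⟩ := hx
      exact Or.inr ⟨y, ⟨p, h, h2, hy⟩, z, hz, rfl⟩
  · rintro (⟨y, ⟨p, h1, h2, hy⟩, z, hz, rfl⟩ | ⟨y, ⟨p, h1, h2, hy⟩, z, hz, rfl⟩)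
    · exact ⟨p, h1, h2.trans hmt, by rw [hl p h1 h2]; exact Set.add_mem_add hy hz⟩
    · exact ⟨p, hsm.trans h1, h2, by rw [hr p h1 h2]; exact Set.add_mem_add hy hz⟩

/-! ### Upper chains along the tree -/

/-- The left end of the segment from `0` to `z`, and the upper end of a vertical segment. -/
noncomputable def segBase (z : ℝ × ℝ) : ℝ × ℝ :=
  if 0 < z.1 then 0 else if z.1 < 0 then z else (0, if 0 < z.2 then z.2 else 0)

/-- The segment from `0` to `z`, directed to the right, and an arbitrary vector to the right if the
segment is vertical. -/
noncomputable def segStep (z : ℝ × ℝ) : ℝ × ℝ :=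
  if 0 < z.1 then z else if z.1 < 0 then -z else (1, 0)

theorem segStep_pos (z : ℝ × ℝ) : 0 < (segStep z).1 := by
  unfold segStep
  split_ifs with h1 h2 <;> simp [*]

theorem segBase_mem (z : ℝ × ℝ) : segBase z ∈ ({0, z} : Set (ℝ × ℝ)) := by
  unfold segBase
  split_ifs with h1 h2 h3
  · simp
  · simp
  · right
    exact Prod.ext (by simp; linarith) rfl
  · left; rfl

theorem segBase_add_segStep_mem {z : ℝ × ℝ} (hz : z.1 ≠ 0) :
    segBase z + segStep z ∈ ({0, z} : Set (ℝ × ℝ)) := by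
  unfold segBase segStep
  split_ifs with h1 h2 h3
  · simp
  · simp
  all_goals exact absurd (le_antisymm (not_lt.1 h1) (not_lt.1 h2)) hz

/-- This is the support function of a segment. On vertical vectors `lin t` does not depend on `t`,
so a vertical segment only shifts the chain to its upper end and needs no step. -/
theorem lin_segment_le {z y : ℝ × ℝ} (hy : y ∈ ({0, z} : Set (ℝ × ℝ))) (t : ℝ) :
    lin t y ≤ lin t (segBase z) + if z.1 ≠ 0 then max 0 (lin t (segStep z)) else 0 := by
  have : y = 0 ∨ y = z := by simpa using hy
  unfold segBase segStep
  by_cases h1 : 0 < z.1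
  · rcases this with rfl | rfl <;> simp [h1, h1.ne']
  · by_cases h2 : z.1 < 0
    · rcases this with rfl | rfl
      · simp only [h1, if_false, h2, if_true, h2.ne, ne_eq, not_false_eq_true]
        have : lin t (-z) = - lin t z := by simp [lin]; ring
        rw [this, lin_zero]
        have := le_max_right 0 (-lin t z)
        linarith
      · simp [h1, h2, h2.ne]
    · have h3 : z.1 = 0 := le_antisymm (not_lt.1 h1) (not_lt.1 h2)
      by_cases h4 : 0 < z.2
      · rcases this with rfl | rfl <;> simp [h3, h4, h4.le, lin]
      · rcases this with rfl | rfl <;> simp [h3, h4, lin]; linarith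

/-- The steps of the nonvertical segments of a list of events. -/
noncomputable def segSteps (l : List ℕ) : List (ℝ × ℝ) :=
  (l.filter fun e => decide ((evWeight H w e).1 ≠ 0)).map fun e => segStep (evWeight H w e)

theorem segSteps_cons (e : ℕ) (l : List ℕ) : segSteps H w (e :: l) =
    if (evWeight H w e).1 ≠ 0 then segStep (evWeight H w e) :: segSteps H w l
    else segSteps H w l := by
  unfold segSteps
  split_ifs with h <;> simp [h]

-- A prefix of the steps means going to the right end for the first nonvertical segments and staying
-- at the left end for the others. Hence every point of the merged path is a genuine sum.
open Pointwise in
theorem segSteps_prefix_mem (l : List ℕ) (E₁ E₂ : List (ℝ × ℝ)) (h : segSteps H w l = E₁ ++ E₂) :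
    (l.map fun e => segBase (evWeight H w e)).sum + E₁.sum ∈
      (l.map fun e => ({0, evWeight H w e} : Set (ℝ × ℝ))).sum := by
  induction l generalizing E₁ E₂ with
  | nil =>
    have : E₁ = [] := by simpa [segSteps] using (List.append_eq_nil_iff.1 h.symm).1
    simp [this]
  | cons e l ih =>
    simp only [List.map_cons, List.sum_cons]
    rw [segSteps_cons] at h
    split_ifs at h with hz
    · cases E₁ with
      | nil =>
        have := ih [] _ rfl
        rw [List.sum_nil, add_zero] at this ⊢
        exact Set.add_mem_add (segBase_mem _) this
      | cons x E₁ =>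
        simp only [List.cons_append, List.cons.injEq] at h
        have := Set.add_mem_add (segBase_add_segStep_mem hz) (ih E₁ _ h.2)
        rw [List.sum_cons, ← h.1]
        convert this using 1
        abel
    · have := Set.add_mem_add (segBase_mem (evWeight H w e)) (ih E₁ _ h)
      rwa [← add_assoc] at this

open Pointwise in
theorem lin_le_of_mem_sum_segments (l : List ℕ) {z : ℝ × ℝ}
    (hz : z ∈ (l.map fun e => ({0, evWeight H w e} : Set (ℝ × ℝ))).sum) (t : ℝ) :
    lin t z ≤ lin t (l.map fun e => segBase (evWeight H w e)).sum +
      ((segSteps H w l).map fun e => max 0 (lin t e)).sum := by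
  induction l generalizing z with
  | nil =>
    have : z = 0 := by simpa using hz
    simp [this, segSteps]
  | cons e l ih =>
    rw [List.map_cons, List.sum_cons, Set.mem_add] at hz
    obtain ⟨x, hx, y, hy, rfl⟩ := hz
    have h1 := lin_segment_le hx t
    have h2 := ih hy
    rw [segSteps_cons]
    split_ifs at h1 ⊢ with h
    · simp only [List.map_cons, List.sum_cons, lin_add]; linarith
    · simp only [List.map_cons, List.sum_cons, lin_add]; linarith

/-- The order of events by nonincreasing slopes. -/
noncomputable def evSlopeLe (a b : ℕ) : Bool :=
  slopeLe (segStep (evWeight H w a)) (segStep (evWeight H w b))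

/-- The events of a block by nonincreasing slopes. -/
noncomputable def slopeTree (h v : ℕ) : List ℕ := treeSort (evSlopeLe H w) (evAt H u) h v

/-- The events of a list whose partners lie outside of a range of leaves. -/
noncomputable def openEvents (l : List ℕ) (s t : ℕ) : List ℕ :=
  l.filter fun e => decide (leafOf H u (evPartner H e) < s ∨ t ≤ leafOf H u (evPartner H e))

/-- The sum of a chain and of the segments of the events whose partners lie outside of a range
of leaves, translated by the weights of the events from `g` on. -/
noncomputable def sideChain (c : List (ℝ × ℝ)) (l : List ℕ) (s t g : ℕ) : List (ℝ × ℝ) :=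
  addSegments c
    (((openEvents H u l s t).map fun e => segBase (evWeight H w e)).sum +
      ((l.filter fun e => decide (g ≤ e)).map (evWeight H w)).sum)
    (segSteps H w (openEvents H u l s t))

/-- The upper chain of a block. -/
noncomputable def upperTree : ℕ → ℕ → List (ℝ × ℝ)
  | 0, v =>
    if (evWeight H w (evAt H u v)).1 ≠ 0 then
      [segBase (evWeight H w (evAt H u v)),
        segBase (evWeight H w (evAt H u v)) + segStep (evWeight H w (evAt H u v))]
    else [segBase (evWeight H w (evAt H u v))]
  | h + 1, v => scanHull
      ((sideChain H u w (upperTree h (2 * v)) (slopeTree H u w h (2 * v + 1))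
        (v * 2 ^ (h + 1)) (2 * 2 ^ (H + 1)) (2 ^ (H + 1))).merge
      (sideChain H u w (upperTree h (2 * v + 1)) (slopeTree H u w h (2 * v))
        0 ((v + 1) * 2 ^ (h + 1)) (2 ^ H)) lexLe)

theorem segSteps_pos (l : List ℕ) : ∀ e ∈ segSteps H w l, 0 < e.1 := by
  intro e he
  obtain ⟨x, _, rfl⟩ := List.mem_map.1 he
  exact segStep_pos _

/-- Filtering keeps a list sorted. So the mergesort tree by slopes already contains the sorted steps
for every node, and no node has to sort again. -/
theorem pairwise_segSteps (h v s t : ℕ) :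
    (segSteps H w (openEvents H u (slopeTree H u w h v) s t)).Pairwise
      fun e f => slopeLe e f = true := by
  unfold segSteps openEvents
  rw [List.pairwise_map]
  exact ((pairwise_treeSort (le := evSlopeLe H w) (fun a b c => slopeLe_trans _ _ _)
    (fun a b => slopeLe_total _ _) _ h v).filter _).filter _

theorem length_sideChain_le {c : List (ℝ × ℝ)} (hc : c ≠ []) (l : List ℕ) (s t g : ℕ) :
    (sideChain H u w c l s t g).length ≤ c.length + l.length := by
  unfold sideChain
  rw [length_addSegments _ _ hc]
  unfold segSteps openEvents
  rw [List.length_map]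
  have h1 := List.length_filter_le (fun e => decide ((evWeight H w e).1 ≠ 0)) (l.filter fun e =>
    decide (leafOf H u (evPartner H e) < s ∨ t ≤ leafOf H u (evPartner H e)))
  have h2 := List.length_filter_le (fun e =>
    decide (leafOf H u (evPartner H e) < s ∨ t ≤ leafOf H u (evPartner H e))) l
  omega

open Pointwise in
theorem IsUpper.sideChain {c : List (ℝ × ℝ)} {P Z : Set (ℝ × ℝ)} (h v s t g : ℕ)
    (hc : IsUpper c P) (hs : StrictChain c)
    (hZ : Z = ((openEvents H u (slopeTree H u w h v) s t).map
        fun e => ({0, evWeight H w e} : Set (ℝ × ℝ))).sum +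
      {(((slopeTree H u w h v).filter fun e => decide (g ≤ e)).map (evWeight H w)).sum}) :
    IsUpper (sideChain H u w c (slopeTree H u w h v) s t g) (P + Z) := by
  refine hc.addSegments hs (segSteps_pos H w _) (pairwise_segSteps H u w h v s t) ?_ ?_
  · intro E₁ E₂ hE
    rw [hZ, add_right_comm]
    exact Set.add_mem_add (segSteps_prefix_mem H w _ E₁ E₂ hE) rfl
  · intro z hz t
    rw [hZ, Set.mem_add] at hz
    obtain ⟨x, hx, y, hy, rfl⟩ := hz
    rw [Set.mem_singleton_iff] at hy
    subst hy
    have := lin_le_of_mem_sum_segments H w _ hx t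
    simp only [lin_add]
    linarith

/-- A leaf carries one event, so all other elements contribute `0`. At an entrance the two cuts
allow `{0}` and `{0, z}`, at a departure `{0, z}` and `{z}`; the union is the same. -/
theorem blockSet_leaf {v : ℕ} (h1 : 2 ^ (H + 1) ≤ v) (h2 : v < 2 * 2 ^ (H + 1)) :
    blockSet H u w v (v + 1) = {0, evWeight H w (evAt H u v)} := by
  open Pointwise in
  have key : ∀ p, v ≤ p → p ≤ v + 1 → ∃ i₀ < 2 ^ H, evElem H (evAt H u v) = i₀ ∧
      ∑ i ∈ Finset.range (2 ^ H), stateTerm v (v + 1) p (leafOf H u i) (leafOf H u (2 ^ H + i)) (w i)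
      = stateTerm v (v + 1) p (leafOf H u i₀) (leafOf H u (2 ^ H + i₀)) (w i₀) ∧
      (leafOf H u i₀ = v ∨ leafOf H u (2 ^ H + i₀) = v) := by
    intro p _ _
    have he := evAt_lt H u v
    have hv := leafOf_evAt H u h1 h2
    have hp : 2 ^ (H + 1) = 2 ^ H + 2 ^ H := by ring
    have hi₀ : evElem H (evAt H u v) < 2 ^ H := by unfold evElem; split_ifs <;> omega
    have hor : evAt H u v = evElem H (evAt H u v) ∨ evAt H u v = 2 ^ H + evElem H (evAt H u v) := by
      unfold evElem; split_ifs <;> omega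
    refine ⟨_, hi₀, rfl, ?_, ?_⟩
    · refine Finset.sum_eq_single_of_mem _ (Finset.mem_range.2 hi₀) fun i hi hne => ?_
      rw [Finset.mem_range] at hi
      unfold stateTerm
      rw [if_neg]
      · rfl
      rintro (h | h)
      · have : leafOf H u i = v := by omega
        have h3 := evAt_leafOf H u (e := i) (by omega)
        rw [this] at h3
        omega
      · have : leafOf H u (2 ^ H + i) = v := by omega
        have h3 := evAt_leafOf H u (e := 2 ^ H + i) (by omega)
        rw [this] at h3
        omega
    · rcases hor with h | h
      · left; rw [← h]; exact hv
      · right; rw [← h]; exact hv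
  ext x
  simp only [blockSet, Set.mem_ofPred_eq, evWeight]
  constructor
  · rintro ⟨p, hp1, hp2, hx⟩
    obtain ⟨i, hi, hie, he, _⟩ := key p hp1 hp2
    rw [he] at hx
    rw [hie]
    unfold stateTerm at hx
    split_ifs at hx <;> simp_all
  · intro hx
    obtain ⟨i, hi, hie, he, hor⟩ := key v le_rfl (by omega)
    obtain ⟨i', hi', hie', he', _⟩ := key (v + 1) (by omega) le_rfl
    obtain rfl : i = i' := by omega
    rw [hie] at hx
    have hlt := leafOf_enter_lt_leave H u hi
    rcases hor with h | h
    · rcases hx with rfl | hx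
      · refine ⟨v, le_rfl, by omega, ?_⟩
        rw [he]
        simp [stateTerm, h]
      · refine ⟨v + 1, by omega, by omega, ?_⟩
        rw [he', hx]
        have : v + 1 ≤ leafOf H u (2 ^ H + i) := by omega
        simp [stateTerm, h, this]
    · refine ⟨v, le_rfl, by omega, ?_⟩
      rw [he]
      have : ¬ v ≤ leafOf H u i := by omega
      simpa [stateTerm, h, this] using hx

theorem isUpper_segment (z : ℝ × ℝ) :
    IsUpper (if z.1 ≠ 0 then [segBase z, segBase z + segStep z] else [segBase z]) {0, z} ∧
      StrictChain (if z.1 ≠ 0 then [segBase z, segBase z + segStep z] else [segBase z]) := by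
  split_ifs with hz
  · refine ⟨⟨?_, ?_⟩, by simp, ?_, by simp [steps]⟩
    · intro q hq
      rcases List.mem_cons.1 hq with rfl | hq
      · exact segBase_mem z
      · rw [List.mem_singleton.1 hq]; exact segBase_add_segStep_mem hz
    · intro p hp t
      have := lin_segment_le hp t
      rw [if_pos hz] at this
      rcases le_total 0 (lin t (segStep z)) with h | h
      · exact ⟨segBase z + segStep z, by simp, by rwa [max_eq_right h, ← lin_add] at this⟩
      · exact ⟨segBase z, by simp, by rwa [max_eq_left h, add_zero] at this⟩
    · intro e he
      have : e = segStep z := by simpa [steps] using he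
      rw [this]; exact segStep_pos z
  · refine ⟨⟨?_, ?_⟩, by simp [StrictChain, steps]⟩
    · intro q hq
      rw [List.mem_singleton.1 hq]; exact segBase_mem z
    · intro p hp t
      have := lin_segment_le hp t
      rw [if_neg hz, add_zero] at this
      exact ⟨segBase z, by simp, this⟩

open Pointwise in
/-- The recursion computes the upper chains of the blocks. -/
theorem upperTree_spec (h v : ℕ) (h1 : 2 ^ (H + 1) ≤ v * 2 ^ h)
    (h2 : (v + 1) * 2 ^ h ≤ 2 * 2 ^ (H + 1)) :
    IsUpper (upperTree H u w h v) (blockSet H u w (v * 2 ^ h) ((v + 1) * 2 ^ h)) ∧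
      StrictChain (upperTree H u w h v) ∧ (upperTree H u w h v).length ≤ 2 ^ h * (h + 2) := by
  induction h generalizing v with
  | zero =>
    simp only [pow_zero, mul_one] at h1 h2 ⊢
    rw [blockSet_leaf H u w h1 (by omega)]
    refine ⟨(isUpper_segment _).1, (isUpper_segment _).2, ?_⟩
    unfold upperTree
    split_ifs <;> simp
  | succ h ih =>
    have e1 : v * 2 ^ (h + 1) = 2 * v * 2 ^ h := by ring
    have e2 : (v + 1) * 2 ^ (h + 1) = (2 * v + 1 + 1) * 2 ^ h := by ring
    rw [e1] at h1
    rw [e2] at h2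
    have e3 : (2 * v + 1) * 2 ^ h = 2 * v * 2 ^ h + 2 ^ h := by ring
    have e4 : (2 * v + 1 + 1) * 2 ^ h = 2 * v * 2 ^ h + 2 ^ h + 2 ^ h := by ring
    have hN : 2 ^ (H + 1) = 2 ^ H + 2 ^ H := by ring
    have hc : 0 < 2 ^ h := by positivity
    obtain ⟨iu, sc, hl⟩ := ih (2 * v) h1 (by omega)
    obtain ⟨iu', sc', hl'⟩ := ih (2 * v + 1) (by omega) h2
    -- For the left half, the bound `2 * 2 ^ (H + 1)` exceeds all leaves, so only partners before
    -- the block count, and these belong to departures. The bound `2 ^ (H + 1)` exceeds all event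
    -- numbers, so there is no translation.
    have u1 : IsUpper _ (blockSet H u w (2 * v * 2 ^ h) ((2 * v + 1) * 2 ^ h) +
        ∑ i ∈ Finset.range (2 ^ H), if (2 * v + 1) * 2 ^ h ≤ leafOf H u (2 ^ H + i) ∧
          leafOf H u (2 ^ H + i) < (2 * v + 1 + 1) * 2 ^ h ∧ leafOf H u i < 2 * v * 2 ^ h
          then ({0, w i} : Set (ℝ × ℝ)) else 0) :=
      iu.sideChain H u w h (2 * v + 1) (v * 2 ^ (h + 1)) (2 * 2 ^ (H + 1)) (2 ^ (H + 1)) sc (by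
        have e5 : (slopeTree H u w h (2 * v + 1)).filter (fun e => decide (2 ^ (H + 1) ≤ e)) = [] := by
          rw [List.filter_eq_nil_iff]
          intro e he
          rw [slopeTree, (treeSort_perm _ _ _ _).mem_iff, List.mem_map] at he
          obtain ⟨q, _, rfl⟩ := he
          simpa using evAt_lt H u q
        rw [e5, List.map_nil, List.sum_nil, Set.singleton_zero, add_zero, openEvents,
          sum_map_filter_eq_ite, slopeTree, sum_treeSort H u _ _ (by omega) h2]
        refine Finset.sum_congr rfl fun i hi => ?_
        have hi := Finset.mem_range.1 hi
        have hlt := leafOf_enter_lt_leave H u hi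
        have k1 := leafOf_lt H u (e := i) (by omega)
        have k2 := leafOf_lt H u (e := 2 ^ H + i) (by omega)
        simp only [evPartner, evWeight, evElem, hi, if_true, decide_eq_true_eq, e1,
          add_comm i (2 ^ H), Nat.add_sub_cancel_left, not_lt.2 (Nat.le_add_right (2 ^ H) i),
          if_false]
        split_ifs <;> first | omega | simp)
    -- For the right half, the bound `0` leaves only partners after the block, which belong to
    -- entrances. The events from `2 ^ H` on are the departures, whose weights are fixed.
    have u2 : IsUpper _ (blockSet H u w ((2 * v + 1) * 2 ^ h) ((2 * v + 1 + 1) * 2 ^ h) +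
        ∑ i ∈ Finset.range (2 ^ H), ((if 2 * v * 2 ^ h ≤ leafOf H u i ∧
          leafOf H u i < (2 * v + 1) * 2 ^ h ∧ (2 * v + 1 + 1) * 2 ^ h ≤ leafOf H u (2 ^ H + i)
          then ({0, w i} : Set (ℝ × ℝ)) else 0) +
          if 2 * v * 2 ^ h ≤ leafOf H u (2 ^ H + i) ∧ leafOf H u (2 ^ H + i) < (2 * v + 1) * 2 ^ h
          then {w i} else 0)) :=
      iu'.sideChain H u w h (2 * v) 0 ((v + 1) * 2 ^ (h + 1)) (2 ^ H) sc' (by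
        have hsing : ∀ l : List (ℝ × ℝ), ({l.sum} : Set (ℝ × ℝ)) =
            (l.map fun z => ({z} : Set (ℝ × ℝ))).sum := by
          intro l
          induction l with
          | nil => simp [Set.singleton_zero]
          | cons a l ih => simp [← ih]
        rw [hsing, List.map_map, openEvents, sum_map_filter_eq_ite,
          sum_map_filter_eq_ite, ← List.sum_map_add, slopeTree,
          sum_treeSort H u _ _ h1 (by omega)]
        refine Finset.sum_congr rfl fun i hi => ?_
        have hi := Finset.mem_range.1 hi
        have hlt := leafOf_enter_lt_leave H u hi
        have k1 := leafOf_lt H u (e := i) (by omega)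
        have k2 := leafOf_lt H u (e := 2 ^ H + i) (by omega)
        simp only [evPartner, evWeight, evElem, hi, if_true, decide_eq_true_eq, e2,
          add_comm i (2 ^ H), Nat.add_sub_cancel_left, not_lt.2 (Nat.le_add_right (2 ^ H) i),
          if_false, Function.comp]
        split_ifs <;> first | omega | simp)
    have hne : ((sideChain H u w (upperTree H u w h (2 * v)) (slopeTree H u w h (2 * v + 1))
        (v * 2 ^ (h + 1)) (2 * 2 ^ (H + 1)) (2 ^ (H + 1))).merge
      (sideChain H u w (upperTree H u w h (2 * v + 1)) (slopeTree H u w h (2 * v))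
        0 ((v + 1) * 2 ^ (h + 1)) (2 ^ H)) lexLe) ≠ [] := by
      rw [← List.length_pos_iff, List.length_merge, sideChain, length_addSegments _ _ sc.1]
      have := List.length_pos_iff.2 sc.1
      omega
    obtain ⟨s1, s2, s3, s4⟩ := scanHull_spec hne (List.pairwise_merge lexLe_trans lexLe_total _ _
      (pairwise_addSegments _ sc (segSteps_pos H w _))
      (pairwise_addSegments _ sc' (segSteps_pos H w _)))
    rw [e1, e2, blockSet_eq_union H u w (m := (2 * v + 1) * 2 ^ h) (by omega) (by omega)]
    refine ⟨?_, s1, ?_⟩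
    · exact (u1.union u2 fun q => List.mem_merge).trans s2 s3
    · refine s4.trans ?_
      rw [List.length_merge]
      have l1 := length_sideChain_le H u w sc.1 (slopeTree H u w h (2 * v + 1))
        (v * 2 ^ (h + 1)) (2 * 2 ^ (H + 1)) (2 ^ (H + 1))
      have l2 := length_sideChain_le H u w sc'.1 (slopeTree H u w h (2 * v))
        0 ((v + 1) * 2 ^ (h + 1)) (2 ^ H)
      rw [slopeTree, length_treeSort] at l1 l2
      -- This is the recursion for the number of hull points: two children, each lengthened by the
      -- `2 ^ h` events of its sibling.
      have : 2 ^ (h + 1) * (h + 1 + 2) = 2 ^ h * (h + 2) + 2 ^ h * (h + 2) + 2 ^ h + 2 ^ h := by ring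
      unfold slopeTree
      omega

/-! ### The lower sets of a semiorder -/

open Pointwise in
/-- The sums over the lower sets are the sums at the prefixes of the chronological event list. -/
theorem mem_blockSet_root (x : ℝ × ℝ) :
    x ∈ blockSet H u w (2 ^ (H + 1)) (2 * 2 ^ (H + 1)) ↔ ∃ L ⊆ Finset.range (2 ^ H),
      (∀ i < 2 ^ H, ∀ j ∈ L, u i + 1 < u j → i ∈ L) ∧ x = ∑ i ∈ L, w i := by
  have hN : 2 ^ (H + 1) = 2 ^ H + 2 ^ H := by ring
  have hterm : ∀ p, ∀ i < 2 ^ H, stateTerm (2 ^ (H + 1)) (2 * 2 ^ (H + 1)) p (leafOf H u i)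
      (leafOf H u (2 ^ H + i)) (w i) = if p ≤ leafOf H u i then {0} else
        if p ≤ leafOf H u (2 ^ H + i) then {0, w i} else {w i} := by
    intro p i hi
    unfold stateTerm
    rw [if_pos (Or.inl ⟨le_leafOf H u i, leafOf_lt H u (by omega)⟩)]
  -- The order relation is the order of a departure before an entrance. Entrances come first at
  -- equal times, which matches the strict inequality.
  have hkey : ∀ i < 2 ^ H, ∀ j < 2 ^ H,
      (leafOf H u (2 ^ H + i) < leafOf H u j ↔ u i + 1 < u j) := by
    intro i hi j hj
    have hi' : ¬ (2 ^ H + i < 2 ^ H) := by omega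
    constructor
    · intro h
      have := keyLe_of_leafOf_lt H u (by omega) (by omega) h
      simp only [keyLe, evKey, hj, hi', if_true, if_false, decide_eq_true_eq,
        Nat.add_sub_cancel_left] at this
      rcases this with h | h
      · exact h
      · omega
    · intro h
      apply leafOf_lt_of_key H u (by omega) (by omega)
      simp only [keyLe, evKey, hj, hi', if_true, if_false, decide_eq_true_eq,
        Nat.add_sub_cancel_left]
      rintro (h' | h')
      · linarith
      · linarith [h'.1]
  simp only [blockSet, Set.mem_ofPred_eq, Set.mem_finsetSum]
  constructor
  · rintro ⟨p, -, -, c, hc, rfl⟩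
    have hc' : ∀ i < 2 ^ H, (¬ p ≤ leafOf H u i ∧ c i = w i) ∨
        (p ≤ leafOf H u (2 ^ H + i) ∧ c i = 0) := by
      intro i hi
      have := hc (Finset.mem_range.2 hi)
      rw [hterm p i hi] at this
      have hlt := leafOf_enter_lt_leave H u hi
      split_ifs at this with k1 k2
      · exact Or.inr ⟨by omega, this⟩
      · rcases this with h | h
        · exact Or.inr ⟨k2, h⟩
        · exact Or.inl ⟨k1, h⟩
      · exact Or.inl ⟨k1, this⟩
    classical
    -- The lower set consists of the entered elements whose summand is their weight. This includes
    -- everything departed before the cut.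
    refine ⟨(Finset.range (2 ^ H)).filter fun i => ¬ p ≤ leafOf H u i ∧ c i = w i,
      Finset.filter_subset _ _, ?_, ?_⟩
    · intro i hi j hj hij
      rw [Finset.mem_filter, Finset.mem_range] at hj ⊢
      have h1 := (hkey i hi j hj.1).2 hij
      refine ⟨hi, (hc' i hi).resolve_right fun h => ?_⟩
      omega
    · rw [Finset.sum_filter]
      refine Finset.sum_congr rfl fun i hi => ?_
      split_ifs with h
      · exact h.2
      · exact ((hc' i (Finset.mem_range.1 hi)).resolve_left h).2
  · rintro ⟨L, hL, hlow, rfl⟩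
    classical
    have hp : ∃ p, 2 ^ (H + 1) ≤ p ∧ p ≤ 2 * 2 ^ (H + 1) ∧ (∀ i ∈ L, leafOf H u i < p) ∧
        ∀ i < 2 ^ H, i ∉ L → p ≤ leafOf H u (2 ^ H + i) := by
      rcases L.eq_empty_or_nonempty with rfl | hne
      · exact ⟨2 ^ (H + 1), le_rfl, by omega, by simp, fun i _ _ => le_leafOf H u _⟩
      · obtain ⟨j, hj, hmax⟩ := L.exists_max_image (leafOf H u) hne
        have hj' := Finset.mem_range.1 (hL hj)
        -- The cut is placed just behind the last entrance of a member of `L`. An element departed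
        -- before it lies below that member, hence belongs to `L`.
        refine ⟨leafOf H u j + 1, (le_leafOf H u j).trans (by omega),
          leafOf_lt H u (by omega), fun i hi => Nat.lt_succ_of_le (hmax i hi), ?_⟩
        intro i hi hiL
        by_contra hcon
        have hne' : leafOf H u (2 ^ H + i) ≠ leafOf H u j := by
          intro h
          have h1 := evAt_leafOf H u (e := 2 ^ H + i) (by omega)
          rw [h, evAt_leafOf H u (by omega)] at h1
          omega
        exact hiL (hlow i hi j hj ((hkey i hi j hj').1 (by omega)))
    obtain ⟨p, hp1, hp2, hp3, hp4⟩ := hp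
    refine ⟨p, hp1, hp2, fun i => if i ∈ L then w i else 0, ?_, ?_⟩
    · intro i hi
      have hi := Finset.mem_range.1 hi
      rw [hterm p i hi]
      by_cases hiL : i ∈ L
      · have := hp3 i hiL
        rw [if_neg (by omega)]
        split_ifs <;> simp [hiL]
      · have := hp4 i hi hiL
        simp only [if_neg hiL]
        split_ifs <;> simp
    · rw [← Finset.sum_filter]
      refine Finset.sum_congr ?_ fun _ _ => rfl
      rw [Finset.filter_mem_eq_inter, Finset.inter_eq_right.2 hL]

end Events

/-! ### The polygon of a semiorder from its chains -/

theorem reflectY_sum {ι : Type*} (s : Finset ι) (f : ι → ℝ × ℝ) :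
    reflectY (∑ i ∈ s, f i) = ∑ i ∈ s, reflectY (f i) := by
  ext <;> simp [reflectY, Prod.fst_sum, Prod.snd_sum]

/-- Admissibility of a set depends on the utilities only, and the weights enter linearly. -/
theorem blockSet_root_reflectY (H : ℕ) (u : ℕ → ℝ) (w : ℕ → ℝ × ℝ) :
    blockSet H u (reflectY ∘ w) (2 ^ (H + 1)) (2 * 2 ^ (H + 1)) =
      reflectY '' blockSet H u w (2 ^ (H + 1)) (2 * 2 ^ (H + 1)) := by
  ext x
  simp only [Set.mem_image, mem_blockSet_root]
  constructor
  · rintro ⟨L, hL, h, rfl⟩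
    exact ⟨_, ⟨L, hL, h, rfl⟩, reflectY_sum _ _⟩
  · rintro ⟨_, ⟨L, hL, h, rfl⟩, rfl⟩
    exact ⟨L, hL, h, reflectY_sum _ _⟩

/-- The sequence that continues a finite family by zeros. -/
def extendZero {α : Type*} [Zero α] {n : ℕ} (f : Fin n → α) (i : ℕ) : α :=
  if h : i < n then f ⟨i, h⟩ else 0

/-- The indices from `n` on are dummy elements of utility and weight zero. They do not change sums,
but they take part in the order, so a lower set must be extended to them; restriction in the other
direction is immediate. -/
theorem project_lowersets_eq {S : Type*} [PartialOrder S] {n H : ℕ} (x : Fin n ≃ S) {u : S → ℝ}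
    (w : S → ℝ × ℝ) (hu : IsSemiorderUtility u) (hn : n ≤ 2 ^ H) :
    project w (lowersets S) = blockSet H (extendZero (u ∘ x)) (extendZero (w ∘ x))
      (2 ^ (H + 1)) (2 * 2 ^ (H + 1)) := by
  classical
  have hw : ∀ s, extendZero (w ∘ x) (x.symm s) = w s := by
    intro s; simp [extendZero]
  have huu : ∀ s, extendZero (u ∘ x) (x.symm s) = u s := by
    intro s; simp [extendZero]
  have hw0 : ∀ i, n ≤ i → extendZero (w ∘ x) i = 0 := by
    intro i hi; simp [extendZero, not_lt.2 hi]
  have hu0 : ∀ i, n ≤ i → extendZero (u ∘ x) i = 0 := by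
    intro i hi; simp [extendZero, not_lt.2 hi]
  have hidx : ∀ i, n ≤ i ∨ ∃ s, i = (x.symm s : Fin n) := by
    intro i
    rcases le_or_gt n i with h | h
    · exact Or.inl h
    · exact Or.inr ⟨x ⟨i, h⟩, by simp⟩
  have hinj : Function.Injective fun s : S => ((x.symm s : Fin n) : ℕ) :=
    fun a b h => x.symm.injective (Fin.ext h)
  have hnot : ∀ s : S, ¬ n ≤ (x.symm s : Fin n) := fun s => not_le.2 (x.symm s).2
  ext p
  rw [mem_blockSet_root]
  constructor
  · rintro ⟨L, hL, rfl⟩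
    have hL' : ∀ s t : S, t ∈ L → u s + 1 < u t → s ∈ L := fun s t ht h =>
      hL ((hu s t).2 h).le ht
    have hmem : ∀ s : S, ((x.symm s : Fin n) : ℕ) ∈ L.map ⟨_, hinj⟩ ↔ s ∈ L := fun s =>
      Finset.mem_map' ⟨_, hinj⟩
    -- All dummies are added as soon as a member of `L` has utility above `1` and thus lies above
    -- them. Whatever is below a dummy is then below that member, hence already in `L`.
    refine ⟨L.map ⟨_, hinj⟩ ∪ (Finset.range (2 ^ H)).filter (fun i => n ≤ i ∧ ∃ s ∈ L, 1 < u s),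
      ?_, ?_, ?_⟩
    · intro i hi
      rcases Finset.mem_union.1 hi with h | h
      · obtain ⟨s, _, rfl⟩ := Finset.mem_map.1 h
        exact Finset.mem_range.2 ((x.symm s).2.trans_le hn)
      · exact (Finset.mem_filter.1 h).1
    · intro i hi j hj hij
      rw [Finset.mem_union, Finset.mem_filter] at hj ⊢
      rcases hidx i with hin | ⟨s, rfl⟩ <;> rcases hidx j with hjn | ⟨t, rfl⟩
      · rw [hu0 i hin, hu0 j hjn] at hij; linarith
      · rw [hu0 i hin, huu, zero_add] at hij
        rw [hmem] at hj
        refine Or.inr ⟨Finset.mem_range.2 hi, hin, t, hj.resolve_right fun h => hnot t h.2.1, hij⟩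
      · rw [huu, hu0 j hjn] at hij
        rcases hj with hj | ⟨_, _, t, ht, h⟩
        · obtain ⟨t, _, rfl⟩ := Finset.mem_map.1 hj
          exact absurd hjn (hnot t)
        · exact Or.inl ((hmem s).2 (hL' s t ht (by linarith)))
      · rw [huu, huu] at hij
        rw [hmem] at hj
        exact Or.inl ((hmem s).2 (hL' s t (hj.resolve_right fun h => hnot t h.2.1) hij))
    · rw [← Finset.sum_subset Finset.subset_union_left, Finset.sum_map]
      · exact Finset.sum_congr rfl fun s _ => (hw s).symm
      · intro i hi hi'
        exact hw0 i (Finset.mem_filter.1 ((Finset.mem_union.1 hi).resolve_left hi')).2.1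
  · rintro ⟨L, hL, hlow, rfl⟩
    refine ⟨(Finset.univ.filter fun k : Fin n => (k : ℕ) ∈ L).map x.toEmbedding, ?_, ?_⟩
    · intro t s hst ht
      have hmem : ∀ s : S, s ∈ (Finset.univ.filter fun k : Fin n => (k : ℕ) ∈ L).map x.toEmbedding
          ↔ ((x.symm s : Fin n) : ℕ) ∈ L := by
        intro s
        rw [Finset.mem_map_equiv]; simp
      rcases hst.eq_or_lt with rfl | hst
      · exact ht
      · rw [Finset.mem_coe, hmem] at *
        refine hlow _ ((x.symm s).2.trans_le hn) _ ht ?_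
        rw [huu, huu]
        exact (hu s t).1 hst
    · change ∑ s ∈ _, w s = _
      rw [Finset.sum_map]
      have : (Finset.univ.filter fun k : Fin n => (k : ℕ) ∈ L).map Fin.valEmbedding ⊆ L := by
        intro i hi
        obtain ⟨k, hk, rfl⟩ := Finset.mem_map.1 hi
        exact (Finset.mem_filter.1 hk).2
      rw [← Finset.sum_subset this, Finset.sum_map]
      · exact Finset.sum_congr rfl fun k _ => by simp [extendZero]
      · intro i hi hi'
        refine hw0 i (not_lt.1 fun h => hi' ?_)
        exact Finset.mem_map.2 ⟨⟨i, h⟩, by simp [hi], rfl⟩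

/-- The upper chain of a semiorder with `2 ^ H` elements. -/
noncomputable def rootChain (H : ℕ) (u : ℕ → ℝ) (w : ℕ → ℝ × ℝ) : List (ℝ × ℝ) :=
  upperTree H u w (H + 1) 1

theorem rootChain_spec (H : ℕ) (u : ℕ → ℝ) (w : ℕ → ℝ × ℝ) :
    IsUpper (rootChain H u w) (blockSet H u w (2 ^ (H + 1)) (2 * 2 ^ (H + 1))) ∧
      StrictChain (rootChain H u w) ∧ (rootChain H u w).length ≤ 2 ^ (H + 1) * (H + 3) := by
  have := upperTree_spec H u w (H + 1) 1 (by simp) (by simp)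
  rw [one_mul, one_add_one_eq_two] at this
  exact this

/-- The vertex list of the polygon of a semiorder. -/
noncomputable def rootVertices (H : ℕ) (u : ℕ → ℝ) (w : ℕ → ℝ × ℝ) : List (ℝ × ℝ) :=
  cyclicList (rootChain H u w) (rootChain H u (reflectY ∘ w))

theorem isVertexList_rootVertices {S : Type*} [PartialOrder S] {n H : ℕ} (x : Fin n ≃ S)
    {u : S → ℝ} (w : S → ℝ × ℝ) (hu : IsSemiorderUtility u) (hn : n ≤ 2 ^ H) :
    IsVertexList (fun j : Fin (rootVertices H (extendZero (u ∘ x)) (extendZero (w ∘ x))).length =>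
      (rootVertices H (extendZero (u ∘ x)) (extendZero (w ∘ x)))[j]) (polygon w) := by
  unfold polygon
  rw [project_lowersets_eq x w hu hn]
  obtain ⟨h1, h2, -⟩ := rootChain_spec H (extendZero (u ∘ x)) (extendZero (w ∘ x))
  obtain ⟨h3, h4, -⟩ := rootChain_spec H (extendZero (u ∘ x)) (reflectY ∘ extendZero (w ∘ x))
  rw [blockSet_root_reflectY] at h3
  exact isVertexList_cyclicList h1 h3 h2 h4

theorem length_rootVertices_le (H : ℕ) (u : ℕ → ℝ) (w : ℕ → ℝ × ℝ) :
    (rootVertices H u w).length ≤ 2 * (2 ^ (H + 1) * (H + 3)) := by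
  have h1 := (rootChain_spec H u w).2.2
  have h2 := (rootChain_spec H u (reflectY ∘ w)).2.2
  unfold rootVertices cyclicList
  rw [List.length_append, List.length_map]
  have h3 := List.length_filter_le (fun p => decide (¬ (p = reflectY
    ((rootChain H u (reflectY ∘ w)).headD 0) ∨ p = reflectY
    ((rootChain H u (reflectY ∘ w)).getLastD 0)))) (rootChain H u w).reverse
  rw [List.length_reverse] at h3
  omega

/-! ### The logarithmic bound for the number of vertices -/

/-- The height of the smallest tree for `n ≥ 2` elements is logarithmic. -/
theorem clog_add_le {n : ℕ} (hn : 2 ≤ n) (c : ℕ) :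
    ((Nat.clog 2 n + c : ℕ) : ℝ) ≤ (2 * c + 4) * Real.log n := by
  -- Since `log n ≥ log 2 > 1/2`, the height minus one is at most `2 log n`, and the remaining `c +
  -- 1` is at most `(2 c + 2) log n`.
  have h2 : (1 / 2 : ℝ) < Real.log 2 := by linarith [Real.log_two_gt_d9]
  have hlog : Real.log 2 ≤ Real.log n := Real.log_le_log (by norm_num) (by exact_mod_cast hn)
  have h : 2 ^ (Nat.clog 2 n - 1) ≤ n :=
    (Nat.pow_pred_clog_lt_self (by norm_num) (by omega)).le
  have h3 : ((Nat.clog 2 n - 1 : ℕ) : ℝ) * Real.log 2 ≤ Real.log n := by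
    rw [← Real.log_pow]
    exact Real.log_le_log (by positivity) (by exact_mod_cast h)
  have h4 : 1 ≤ Nat.clog 2 n := Nat.clog_pos (by norm_num) hn
  rw [Nat.cast_sub h4] at h3
  push_cast at h3 ⊢
  have h5 : (0 : ℝ) ≤ c := Nat.cast_nonneg c
  have h6 : (1 : ℝ) ≤ Nat.clog 2 n := by exact_mod_cast h4
  nlinarith [mul_nonneg h5 (sub_nonneg.2 (h2.le.trans hlog))]

theorem two_pow_clog_le {n : ℕ} (hn : 1 ≤ n) : 2 ^ Nat.clog 2 n ≤ 2 * n := by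
  rcases hn.eq_or_lt with rfl | h
  · simp
  · have h1 : 2 ^ (Nat.clog 2 n - 1) < n := Nat.pow_pred_clog_lt_self (by norm_num) h
    have h2 : 1 ≤ Nat.clog 2 n := Nat.clog_pos (by norm_num) h
    calc 2 ^ Nat.clog 2 n = 2 * 2 ^ (Nat.clog 2 n - 1) := by
          rw [← pow_succ']; congr 1; omega
      _ ≤ 2 * n := by omega

/-- The two chains have at most `2 * 2 ^ (H + 1) * (H + 3)` points, where `2 ^ H ≤ 2 n` and `H + 3 ≤
10 log n`; so the constant is `8 * 10`. -/
theorem card_extremePoints_le {S : Type*} [PartialOrder S] {n : ℕ} (x : Fin n ≃ S)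
    {u : S → ℝ} (w : S → ℝ × ℝ) (hu : IsSemiorderUtility u) (hn : 2 ≤ n) :
    ((polygon w).extremePoints ℝ).Finite ∧
      (((polygon w).extremePoints ℝ).ncard : ℝ) ≤ 80 * (n * Real.log n) := by
  obtain ⟨h1, h2, -⟩ := isVertexList_rootVertices x w hu (Nat.le_pow_clog one_lt_two n)
  rw [← h2]
  refine ⟨Set.finite_range _, ?_⟩
  rw [← Set.image_univ, Set.ncard_image_of_injective _ h1, Set.ncard_univ, Nat.card_eq_fintype_card,
    Fintype.card_fin]
  have h3 := length_rootVertices_le (Nat.clog 2 n) (extendZero (u ∘ x)) (extendZero (w ∘ x))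
  have h4 := clog_add_le hn 3
  have h5 := two_pow_clog_le (n := n) (by omega)
  have h6 : (((2 * (2 ^ (Nat.clog 2 n + 1) * (Nat.clog 2 n + 3)) : ℕ)) : ℝ) ≤
      80 * (n * Real.log n) := by
    have : 2 * (2 ^ (Nat.clog 2 n + 1) * (Nat.clog 2 n + 3)) ≤ 8 * n * (Nat.clog 2 n + 3) := by
      rw [pow_succ, ← mul_assoc]
      exact Nat.mul_le_mul_right _ (by omega)
    calc _ ≤ ((8 * n * (Nat.clog 2 n + 3) : ℕ) : ℝ) := by exact_mod_cast this
      _ = 8 * n * ((Nat.clog 2 n + 3 : ℕ) : ℝ) := by push_cast; ring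
      _ ≤ 8 * n * ((2 * 3 + 4) * Real.log n) := by
        refine mul_le_mul_of_nonneg_left ?_ (by positivity)
        exact_mod_cast h4
      _ = _ := by ring
  exact le_trans (by exact_mod_cast h3) h6

/-! ### A program logic for the real RAM -/

/-- The list of the entries of a sequence at the places `b, …, b + n - 1`. -/
def arr {α : Type*} (f : ℕ → α) (b n : ℕ) : List α := (List.range n).map fun i => f (b + i)

section arr

variable {α : Type*}

@[simp] theorem length_arr (f : ℕ → α) (b n : ℕ) : (arr f b n).length = n := by simp [arr]

@[simp] theorem arr_zero (f : ℕ → α) (b : ℕ) : arr f b 0 = [] := rfl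

theorem arr_succ (f : ℕ → α) (b n : ℕ) : arr f b (n + 1) = arr f b n ++ [f (b + n)] := by
  simp [arr, List.range_succ]

theorem arr_congr {f g : ℕ → α} {b c n : ℕ} (h : ∀ i < n, f (b + i) = g (c + i)) :
    arr f b n = arr g c n :=
  List.map_congr_left fun i hi => h i (List.mem_range.1 hi)

/-- The hypothesis has the form in which an array appears after one assignment. -/
theorem arr_snoc {f g : ℕ → α} {b n : ℕ} {x : α} (h : ∀ y, g y = if y = b + n then x else f y) :
    arr g b (n + 1) = arr f b n ++ [x] := by
  rw [arr_succ, h, if_pos rfl]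
  congr 1
  exact arr_congr fun k hk => by rw [h, if_neg (by omega)]

@[simp] theorem getElem_arr (f : ℕ → α) (b n i : ℕ) (h : i < (arr f b n).length) :
    (arr f b n)[i] = f (b + i) := by simp [arr]

theorem arr_eq_iff {f : ℕ → α} {b n : ℕ} {l : List α} (hl : l.length = n) :
    arr f b n = l ↔ ∀ i (h : i < l.length), f (b + i) = l[i] := by
  constructor
  · rintro rfl i h; simp
  · intro h
    refine List.ext_getElem (by simp [hl]) fun i h1 h2 => ?_
    rw [getElem_arr, h]

/-- The state of a merge is a pair of counters. The comparison is demanded only while the second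
list has entries left, so its exhaustion needs no separate rule. -/
theorem merge_drop_left {le : α → α → Bool} {l₁ l₂ : List α} {i j : ℕ} (hi : i < l₁.length)
    (h : ∀ hj : j < l₂.length, le l₁[i] l₂[j]) :
    (l₁.drop i).merge (l₂.drop j) le = l₁[i] :: (l₁.drop (i + 1)).merge (l₂.drop j) le := by
  rw [List.drop_eq_getElem_cons hi]
  by_cases hj : j < l₂.length
  · rw [List.drop_eq_getElem_cons hj, List.cons_merge_cons_pos _ _ _ (h hj)]
  · rw [List.drop_eq_nil_of_le (not_lt.1 hj), List.merge_right, List.merge_right]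

theorem merge_drop_right {le : α → α → Bool} {l₁ l₂ : List α} {i j : ℕ} (hj : j < l₂.length)
    (h : ∀ hi : i < l₁.length, ¬ le l₁[i] l₂[j]) :
    (l₁.drop i).merge (l₂.drop j) le = l₂[j] :: (l₁.drop i).merge (l₂.drop (j + 1)) le := by
  rw [List.drop_eq_getElem_cons hj]
  by_cases hi : i < l₁.length
  · rw [List.drop_eq_getElem_cons hi, List.cons_merge_cons_neg _ _ _ (h hi)]
  · rw [List.drop_eq_nil_of_le (not_lt.1 hi), List.nil_merge, List.nil_merge]

end arr

namespace RealRAM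

instance : Add WExpr := ⟨.add⟩
instance : Sub WExpr := ⟨.sub⟩
instance : Mul WExpr := ⟨.mul⟩
instance : Add RExpr := ⟨.add⟩
instance : Sub RExpr := ⟨.sub⟩
instance : Mul RExpr := ⟨.mul⟩

/-- The word variable with a given name. -/
def V (a : ℕ) : WExpr := .get a (.const 0)

/-- The real variable with a given name. -/
def R (a : ℕ) : RExpr := .get a (.const 0)

/-- Assignment to a word variable. -/
def setV (a : ℕ) (e : WExpr) : Program := .wset a (.const 0) e

/-- Assignment to a real variable. -/
def setR (a : ℕ) (e : RExpr) : Program := .rset a (.const 0) e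

/-- Sequential composition. -/
def block : List Program → Program
  | [] => .skip
  | [p] => p
  | p :: q :: l => .seq p (block (q :: l))

section eval

variable (σ : State)

@[simp] theorem weval_const (c : ℕ) : (WExpr.const c).eval σ = c := rfl
@[simp] theorem weval_get (a : ℕ) (i : WExpr) : (WExpr.get a i).eval σ = σ.words a (i.eval σ) := rfl
@[simp] theorem weval_add (e f : WExpr) : (e + f).eval σ = e.eval σ + f.eval σ := rfl
@[simp] theorem weval_sub (e f : WExpr) : (e - f).eval σ = e.eval σ - f.eval σ := rfl
@[simp] theorem weval_mul (e f : WExpr) : (e * f).eval σ = e.eval σ * f.eval σ := rfl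
@[simp] theorem weval_V (a : ℕ) : (V a).eval σ = σ.words a 0 := rfl
@[simp] theorem reval_const (c : ℤ) : (RExpr.const c).eval σ = c := rfl
@[simp] theorem reval_get (a : ℕ) (i : WExpr) : (RExpr.get a i).eval σ = σ.reals a (i.eval σ) := rfl
@[simp] theorem reval_add (e f : RExpr) : (e + f).eval σ = e.eval σ + f.eval σ := rfl
@[simp] theorem reval_sub (e f : RExpr) : (e - f).eval σ = e.eval σ - f.eval σ := rfl
@[simp] theorem reval_mul (e f : RExpr) : (e * f).eval σ = e.eval σ * f.eval σ := rfl
@[simp] theorem reval_R (a : ℕ) : (R a).eval σ = σ.reals a 0 := rfl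
@[simp] theorem teval_wlt (e f : WExpr) : (Test.wlt e f).eval σ ↔ e.eval σ < f.eval σ := Iff.rfl
@[simp] theorem teval_rlt (e f : RExpr) : (Test.rlt e f).eval σ ↔ e.eval σ < f.eval σ := Iff.rfl
@[simp] theorem teval_req (e f : RExpr) : (Test.req e f).eval σ ↔ e.eval σ = f.eval σ := Iff.rfl
@[simp] theorem teval_not (b : Test) : (Test.not b).eval σ ↔ ¬ b.eval σ := Iff.rfl
@[simp] theorem teval_and (b c : Test) : (Test.and b c).eval σ ↔ b.eval σ ∧ c.eval σ := Iff.rfl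
@[simp] theorem teval_or (b c : Test) : (Test.or b c).eval σ ↔ b.eval σ ∨ c.eval σ := Iff.rfl

@[simp] theorem setWord_words (a i x b j : ℕ) :
    (σ.setWord a i x).words b j = if b = a ∧ j = i then x else σ.words b j := by
  unfold State.setWord
  by_cases h : b = a
  · subst h
    by_cases h' : j = i <;> simp [h']
  · simp [h]

@[simp] theorem setWord_reals (a i x : ℕ) : (σ.setWord a i x).reals = σ.reals := rfl

@[simp] theorem setReal_words (a i : ℕ) (x : ℝ) : (σ.setReal a i x).words = σ.words := rfl

@[simp] theorem setReal_reals (a i b j : ℕ) (x : ℝ) :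
    (σ.setReal a i x).reals b j = if b = a ∧ j = i then x else σ.reals b j := by
  unfold State.setReal
  by_cases h : b = a
  · subst h
    by_cases h' : j = i <;> simp [h']
  · simp [h]

end eval

/-- The word arrays that a program assigns to. -/
def Program.wmods : Program → List ℕ
  | .skip => []
  | .wset a _ _ => [a]
  | .rset _ _ _ => []
  | .seq p q => p.wmods ++ q.wmods
  | .ite _ p q => p.wmods ++ q.wmods
  | .loop _ p => p.wmods

/-- The real arrays that a program assigns to. -/
def Program.rmods : Program → List ℕ
  | .skip => []
  | .wset _ _ _ => []
  | .rset a _ _ => [a]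
  | .seq p q => p.rmods ++ q.rmods
  | .ite _ p q => p.rmods ++ q.rmods
  | .loop _ p => p.rmods

/-- The states agree on all arrays that the program does not assign to. -/
def Frame (p : Program) (σ τ : State) : Prop :=
  (∀ a ∉ p.wmods, τ.words a = σ.words a) ∧ ∀ a ∉ p.rmods, τ.reals a = σ.reals a

theorem Frame.refl (p : Program) (σ : State) : Frame p σ σ := ⟨fun _ _ => rfl, fun _ _ => rfl⟩

theorem Frame.trans {p : Program} {σ τ ρ : State} (h : Frame p σ τ) (h' : Frame p τ ρ) :
    Frame p σ ρ :=
  ⟨fun a ha => (h'.1 a ha).trans (h.1 a ha), fun a ha => (h'.2 a ha).trans (h.2 a ha)⟩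

theorem Frame.mono {p q : Program} {σ τ : State} (h : Frame p σ τ)
    (hw : ∀ a ∈ p.wmods, a ∈ q.wmods) (hr : ∀ a ∈ p.rmods, a ∈ q.rmods) : Frame q σ τ :=
  ⟨fun a ha => h.1 a fun h' => ha (hw a h'), fun a ha => h.2 a fun h' => ha (hr a h')⟩

/-- Which arrays survive a program is thereby read off its text. Most frame facts below reduce to a
decidable membership in `wmods` or `rmods`. -/
theorem Exec.frame {B : ℕ} {p : Program} {σ τ : State} {t : ℕ} (h : Exec B p σ t τ) :
    Frame p σ τ := by
  induction h with
  | skip => exact Frame.refl _ _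
  | wset a i e σ =>
    refine ⟨fun b hb => ?_, fun _ _ => rfl⟩
    have : b ≠ a := by simpa [Program.wmods] using hb
    funext j; simp [this]
  | rset a i e σ =>
    refine ⟨fun _ _ => rfl, fun b hb => ?_⟩
    have : b ≠ a := by simpa [Program.rmods] using hb
    funext j; simp [this]
  | seq _ _ ih1 ih2 =>
    exact (ih1.mono (by simp +contextual [Program.wmods]) (by simp +contextual [Program.rmods])).trans
      (ih2.mono (by simp +contextual [Program.wmods]) (by simp +contextual [Program.rmods]))
  | ite_true _ _ ih =>
    exact ih.mono (by simp +contextual [Program.wmods]) (by simp +contextual [Program.rmods])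
  | ite_false _ _ ih =>
    exact ih.mono (by simp +contextual [Program.wmods]) (by simp +contextual [Program.rmods])
  | loop_true _ _ _ ih1 ih2 => exact Frame.trans ih1 ih2
  | loop_false => exact Frame.refl _ _

/-- From the state `σ`, the program halts after at most `T` operations in a state with `Q`. -/
def Tri (B : ℕ) (p : Program) (σ : State) (T : ℕ) (Q : State → Prop) : Prop :=
  ∃ t τ, Exec B p σ t τ ∧ t ≤ T ∧ Q τ

theorem Tri.mono {B : ℕ} {p : Program} {σ : State} {T T' : ℕ} {Q Q' : State → Prop}
    (h : Tri B p σ T Q) (hT : T ≤ T') (hQ : ∀ τ, Frame p σ τ → Q τ → Q' τ) : Tri B p σ T' Q' := by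
  obtain ⟨t, τ, he, ht, hq⟩ := h
  exact ⟨t, τ, he, ht.trans hT, hQ τ he.frame hq⟩

theorem Tri.seq {B : ℕ} {p q : Program} {σ : State} {T₁ T₂ : ℕ} {P Q : State → Prop}
    (h₁ : Tri B p σ T₁ P) (h₂ : ∀ τ, Frame p σ τ → P τ → Tri B q τ T₂ Q) :
    Tri B (.seq p q) σ (T₁ + T₂) Q := by
  obtain ⟨t, τ, he, ht, hp⟩ := h₁
  obtain ⟨t', ρ, he', ht', hq⟩ := h₂ τ he.frame hp
  exact ⟨t + t', ρ, he.seq he', by omega, hq⟩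

/-- The weakest precondition of a loop-free program. -/
def wp (B : ℕ) : Program → (State → Prop) → State → Prop
  | .skip, Q, σ => Q σ
  | .wset a i e, Q, σ =>
    i.eval σ < B ∧ e.eval σ < B ∧ Q (σ.setWord a (i.eval σ) (e.eval σ))
  | .rset a i e, Q, σ => i.eval σ < B ∧ Q (σ.setReal a (i.eval σ) (e.eval σ))
  | .seq p q, Q, σ => wp B p (wp B q Q) σ
  | .ite b p q, Q, σ => (b.eval σ → wp B p Q σ) ∧ (¬ b.eval σ → wp B q Q σ)
  | .loop _ _, _, _ => False

/-- A bound for the cost of a program in which every loop body is executed once. -/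
def Program.maxCost : Program → ℕ
  | .skip => 1
  | .wset _ i e => i.cost + e.cost + 1
  | .rset _ i e => i.cost + e.cost + 1
  | .seq p q => p.maxCost + q.maxCost
  | .ite b p q => b.cost + 1 + p.maxCost + q.maxCost
  | .loop b p => p.maxCost + b.cost + 1

theorem wp_mono {B : ℕ} {p : Program} {σ : State} {Q Q' : State → Prop} (h : wp B p Q σ)
    (hQ : ∀ τ, Frame p σ τ → Q τ → Q' τ) : wp B p Q' σ := by
  induction p generalizing σ Q Q' with
  | skip => exact hQ _ (Frame.refl _ _) h
  | wset a i e => exact ⟨h.1, h.2.1, hQ _ (Exec.wset a i e σ h.1 h.2.1).frame h.2.2⟩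
  | rset a i e => exact ⟨h.1, hQ _ (Exec.rset a i e σ h.1).frame h.2⟩
  | seq p q ih1 ih2 =>
    refine ih1 h fun τ hF hτ => ih2 hτ fun ρ hF' hρ => hQ ρ ?_ hρ
    exact (hF.mono (by simp +contextual [Program.wmods]) (by simp +contextual [Program.rmods])).trans
      (hF'.mono (by simp +contextual [Program.wmods]) (by simp +contextual [Program.rmods]))
  | ite b p q ih1 ih2 =>
    refine ⟨fun hb => ih1 (h.1 hb) fun τ hF hτ => hQ τ (hF.mono ?_ ?_) hτ,
      fun hb => ih2 (h.2 hb) fun τ hF hτ => hQ τ (hF.mono ?_ ?_) hτ⟩ <;>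
    simp +contextual [Program.wmods, Program.rmods]
  | loop b p _ => exact h.elim

theorem wp_seq {B : ℕ} {p q : Program} {σ : State} {P Q : State → Prop} (h₁ : wp B p P σ)
    (h₂ : ∀ τ, Frame p σ τ → P τ → wp B q Q τ) : wp B (.seq p q) Q σ := by
  change wp B p (wp B q Q) σ
  exact wp_mono h₁ h₂

/-- For loop-free code the symbolic run gives correctness, and the cost is bounded syntactically by
charging both branches of each test. -/
theorem Tri.of_wp {B : ℕ} {p : Program} {σ : State} {Q : State → Prop} (h : wp B p Q σ) :
    Tri B p σ p.maxCost Q := by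
  induction p generalizing σ Q with
  | skip => exact ⟨1, σ, .skip σ, le_rfl, h⟩
  | wset a i e => exact ⟨_, _, .wset a i e σ h.1 h.2.1, le_rfl, h.2.2⟩
  | rset a i e => exact ⟨_, _, .rset a i e σ h.1, le_rfl, h.2⟩
  | seq p q ih1 ih2 => exact (ih1 h).seq fun τ _ hτ => ih2 hτ
  | ite b p q ih1 ih2 =>
    by_cases hb : b.eval σ
    · obtain ⟨t, τ, he, ht, hq⟩ := ih1 (h.1 hb)
      exact ⟨_, τ, .ite_true hb he, by simp only [Program.maxCost]; omega, hq⟩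
    · obtain ⟨t, τ, he, ht, hq⟩ := ih2 (h.2 hb)
      exact ⟨_, τ, .ite_false hb he, by simp only [Program.maxCost]; omega, hq⟩
  | loop b p _ => exact h.elim

theorem Tri.ite {B : ℕ} {b : Test} {p q : Program} {σ : State} {T₁ T₂ : ℕ} {Q : State → Prop}
    (h₁ : b.eval σ → Tri B p σ T₁ Q) (h₂ : ¬ b.eval σ → Tri B q σ T₂ Q) :
    Tri B (.ite b p q) σ (b.cost + 1 + (T₁ + T₂)) Q := by
  by_cases hb : b.eval σ
  · obtain ⟨t, τ, he, ht, hq⟩ := h₁ hb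
    exact ⟨_, τ, .ite_true hb he, by omega, hq⟩
  · obtain ⟨t, τ, he, ht, hq⟩ := h₂ hb
    exact ⟨_, τ, .ite_false hb he, by omega, hq⟩

/-- The rule for loops, with a potential that pays for the remaining operations. -/
theorem Tri.loop {B : ℕ} {b : Test} {p : Program} {σ : State} (I : State → Prop) (Φ : State → ℕ)
    (hI : I σ) (h : ∀ τ, Frame p σ τ → I τ → b.eval τ →
      ∃ T, Tri B p τ T fun ρ => I ρ ∧ Φ ρ + T + b.cost + 1 ≤ Φ τ) :
    Tri B (.loop b p) σ (Φ σ + b.cost + 1) fun τ => I τ ∧ ¬ b.eval τ := by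
  -- Every iteration costs at least its test, so the potential decreases strictly and serves as the
  -- induction variable.
  suffices ∀ n τ, Φ τ = n → Frame p σ τ → I τ →
      Tri B (.loop b p) τ (Φ τ + b.cost + 1) fun τ => I τ ∧ ¬ b.eval τ from
    this _ σ rfl (Frame.refl _ _) hI
  intro n
  induction n using Nat.strong_induction_on with
  | _ n ih =>
    rintro τ rfl hF hI
    by_cases hb : b.eval τ
    · obtain ⟨T, t, ρ, he, ht, hI', hΦ⟩ := h τ hF hI hb
      obtain ⟨t', ρ', he', ht', hq⟩ := ih (Φ ρ) (by omega) ρ rfl (hF.trans he.frame) hI'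
      exact ⟨_, ρ', .loop_true hb he he', by omega, hq⟩
    · exact ⟨_, τ, .loop_false hb, by omega, hI, hb⟩

/-- The rule for loops with a loop-free body and a variant. -/
theorem Tri.while {B : ℕ} {b : Test} {p : Program} {σ : State} (I : State → Prop) (m : State → ℕ)
    (hI : I σ) (h : ∀ τ, Frame p σ τ → I τ → b.eval τ → wp B p (fun ρ => I ρ ∧ m ρ < m τ) τ) :
    Tri B (.loop b p) σ ((Program.loop b p).maxCost * (m σ + 1)) fun τ => I τ ∧ ¬ b.eval τ := by
  refine (Tri.loop I (fun τ => m τ * (Program.loop b p).maxCost) hI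
    fun τ hF hI hb => ⟨p.maxCost, ?_⟩).mono ?_ fun _ _ h => h
  · refine (Tri.of_wp (h τ hF hI hb)).mono le_rfl fun ρ _ hρ => ⟨hρ.1, ?_⟩
    have := Nat.mul_le_mul_right (Program.loop b p).maxCost (Nat.succ_le_of_lt hρ.2)
    rw [Nat.succ_mul] at this
    have e : (Program.loop b p).maxCost = p.maxCost + b.cost + 1 := rfl
    omega
  · rw [mul_add, mul_one, mul_comm]
    have e : (Program.loop b p).maxCost = p.maxCost + b.cost + 1 := rfl
    omega

/-- Straight-line code is charged an arbitrary positive multiple of its cost. All parts of a program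
then carry the same size factor, and `Tri.seq'` adds them up. -/
theorem Tri.of_wp' {B : ℕ} {p : Program} {σ : State} {Q : State → Prop} (x : ℕ)
    (h : wp B p Q σ) : Tri B p σ (p.maxCost * (x + 1)) Q :=
  (Tri.of_wp h).mono (Nat.le_mul_of_pos_right _ (Nat.succ_pos x)) fun _ _ h => h

theorem Tri.seq' {B : ℕ} {p q : Program} {σ : State} {x : ℕ} {P Q : State → Prop}
    (h₁ : Tri B p σ (p.maxCost * x) P)
    (h₂ : ∀ τ, Frame p σ τ → P τ → Tri B q τ (q.maxCost * x) Q) :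
    Tri B (.seq p q) σ ((Program.seq p q).maxCost * x) Q :=
  (h₁.seq h₂).mono (by rw [Program.maxCost, add_mul]) fun _ _ h => h

end RealRAM

namespace RealRAM

/-! ### The program: memory layout and preparation

Word variables: 1 number of elements (padded), 2 number of events, 3 length of a chain region,
4 current node, 5–8 counters, 9–14 parameters of a side chain, 15–19 lengths.
Word arrays: 20 chronological mergesort tree, 21 mergesort tree by slopes, 22 block sizes,
23 partners, 24 leaves, 25 flags of nonvertical segments, 26 open events, 27 chain lengths.
Real variables: 3 sign of the second coordinate, 15–16 and 19–20 current point.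
Real arrays: 4 keys, 5–6 weights, 7–8 segment bases, 9–10 segment steps, 11–12 chains, 13–14 side
chains, 17–18 saved chain. -/

/-- Compute the sizes. -/
def progSize : Program := block [
  setV 1 (.const 1),
  .loop (.wlt (V 1) (V 0)) (setV 1 (V 1 * .const 2)),
  setV 2 (V 1 * .const 2),
  setV 3 (.const 2 * V 2 * V 2)]

/-- The key and the partner of an event. -/
def progKey : Program :=
  .ite (.wlt (V 8) (V 1))
    (block [setV 5 (V 8), .rset 4 (V 8) (.get 0 (V 8)), .wset 23 (V 8) (V 8 + V 1)])
    (block [setV 5 (V 8 - V 1), .rset 4 (V 8) (.get 0 (V 5) + .const 1),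
      .wset 23 (V 8) (V 8 - V 1)])

/-- The weight of an event. -/
def progWeight : Program :=
  .seq (.rset 5 (V 8) (.get 1 (V 5))) (.rset 6 (V 8) (R 3 * .get 2 (V 5)))

/-- The segment of an event. -/
def progSegment : Program :=
  .ite (.rlt (.const 0) (.get 5 (V 8)))
    (block [.rset 7 (V 8) (.const 0), .rset 8 (V 8) (.const 0),
      .rset 9 (V 8) (.get 5 (V 8)), .rset 10 (V 8) (.get 6 (V 8)), .wset 25 (V 8) (.const 1)])
    (.ite (.rlt (.get 5 (V 8)) (.const 0))
      (block [.rset 7 (V 8) (.get 5 (V 8)), .rset 8 (V 8) (.get 6 (V 8)),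
        .rset 9 (V 8) (.const 0 - .get 5 (V 8)), .rset 10 (V 8) (.const 0 - .get 6 (V 8)),
        .wset 25 (V 8) (.const 1)])
      (block [.rset 7 (V 8) (.const 0), .ite (.rlt (.const 0) (.get 6 (V 8)))
          (.rset 8 (V 8) (.get 6 (V 8))) (.rset 8 (V 8) (.const 0)),
        .rset 9 (V 8) (.const 1), .rset 10 (V 8) (.const 0), .wset 25 (V 8) (.const 0)]))

/-- The leaf of an event and the step to the next event. -/
def progNext : Program := block [
  .wset 20 ((V 2 + V 8) * V 2) (V 8),
  .wset 22 (V 2 + V 8) (.const 1),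
  setV 8 (V 8 + .const 1)]

/-- The body of the loop that initializes the events. -/
def progEvent : Program := block [progKey, progWeight, progSegment, progNext]

/-- Initialize the events. -/
def progEvents : Program := block [setV 8 (.const 0), .loop (.wlt (V 8) (V 2)) progEvent]

/-- The sizes for `2 ^ H` elements are stored. -/
def Sizes (H : ℕ) (σ : State) : Prop :=
  σ.words 1 0 = 2 ^ H ∧ σ.words 2 0 = 2 ^ (H + 1) ∧ σ.words 3 0 = 2 * 2 ^ (H + 1) * 2 ^ (H + 1)

/-- Doubling from `1` stops at the first power of two that is at least `n`, whose exponent is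
`Nat.clog 2 n`. The crude variant `n - 2 ^ k` suffices, as linear time is affordable. -/
theorem progSize_spec {B n : ℕ} {σ : State} (hn : σ.words 0 0 = n)
    (hB : 2 * 2 ^ (Nat.clog 2 n + 1) * (2 * 2 ^ (Nat.clog 2 n + 1) * 2 ^ (Nat.clog 2 n + 1)) ≤ B) :
    Tri B progSize σ (progSize.maxCost * (n + 1)) (Sizes (Nat.clog 2 n)) := by
  set M := 2 ^ Nat.clog 2 n with hM
  have hM1 : 1 ≤ M := Nat.one_le_two_pow
  have hN : 2 ^ (Nat.clog 2 n + 1) = M * 2 := by rw [hM]; ring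
  rw [hN] at hB
  have hM2 : M ≤ M * M := Nat.le_mul_of_pos_left _ hM1
  have hM3 : M * M ≤ M * M * M := Nat.le_mul_of_pos_right _ hM1
  have hB' : 16 * (M * M * M) ≤ B := by linarith
  have h1 : Tri B (setV 1 (.const 1)) σ _ fun τ => τ.words 1 0 = 1 := Tri.of_wp' n (by
    simp [wp, setV]; omega)
  refine h1.seq' fun τ hF hτ => ((Tri.while
    (fun τ => ∃ k ≤ Nat.clog 2 n, τ.words 1 0 = 2 ^ k) (fun τ => n - τ.words 1 0)
      ⟨0, by omega, hτ⟩ ?_).mono (Nat.mul_le_mul_left _ (by omega)) fun _ _ h => h).seq' ?_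
  · rintro τ hF' ⟨k, hk, hk'⟩ hb
    have h0 : τ.words 0 0 = n := by rw [hF'.1 0 (by decide), hF.1 0 (by decide), hn]
    simp only [teval_wlt, weval_V, h0, hk'] at hb
    have hk2 : k < Nat.clog 2 n := (Nat.lt_clog_iff_pow_lt one_lt_two).2 hb
    have hk3 : 2 ^ (k + 1) ≤ M := Nat.pow_le_pow_right (by norm_num) hk2
    rw [pow_succ] at hk3
    have hk4 : 1 ≤ 2 ^ k := Nat.one_le_two_pow
    simp only [wp, setV, weval_const, weval_mul, weval_V, setWord_words, hk']
    refine ⟨by omega, by omega, ⟨k + 1, hk2, by simp [pow_succ]⟩, ?_⟩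
    simp; omega
  · rintro τ' hF' ⟨⟨k, hk, hk'⟩, hb⟩
    have h0 : τ'.words 0 0 = n := by rw [hF'.1 0 (by decide), hF.1 0 (by decide), hn]
    simp only [teval_wlt, weval_V, h0, hk', not_lt] at hb
    have : k = Nat.clog 2 n := le_antisymm hk (Nat.clog_le_of_le_pow hb)
    rw [this, ← hM] at hk'
    have c1 : 0 < B := by omega
    have c2 : M * 2 < B := by omega
    have c3 : 2 * (M * 2) * (M * 2) < B := by nlinarith
    exact Tri.of_wp' _ (by simp [block, wp, setV, Sizes, hN, hk', c1, c2, c3, ← hM])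

/-- The initial data of an event are stored. -/
def EventStored (H : ℕ) (u : ℕ → ℝ) (w : ℕ → ℝ × ℝ) (σ : State) (e : ℕ) : Prop :=
  σ.reals 4 e = evKey H u e ∧ σ.words 23 e = evPartner H e ∧
  (σ.reals 5 e, σ.reals 6 e) = evWeight H w e ∧
  (σ.reals 7 e, σ.reals 8 e) = segBase (evWeight H w e) ∧
  (σ.reals 9 e, σ.reals 10 e) = segStep (evWeight H w e) ∧
  σ.words 25 e = (if (evWeight H w e).1 ≠ 0 then 1 else 0) ∧
  σ.words 20 ((2 ^ (H + 1) + e) * 2 ^ (H + 1)) = e ∧ σ.words 22 (2 ^ (H + 1) + e) = 1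

/-- The real cell `3 0` holds a sign, so the same code prepares the given weights and the reflected
ones. -/
theorem progEvents_spec {B H : ℕ} {u : ℕ → ℝ} {w : ℕ → ℝ × ℝ} {σ : State} (hs : Sizes H σ)
    (hB : 2 * 2 ^ (H + 1) * (2 * 2 ^ (H + 1) * 2 ^ (H + 1)) ≤ B) (hu : σ.reals 0 = u)
    (hx : ∀ i, σ.reals 1 i = (w i).1) (hy : ∀ i, σ.reals 3 0 * σ.reals 2 i = (w i).2) :
    Tri B progEvents σ (progEvents.maxCost * (2 ^ (H + 1) + 1))
      fun τ => ∀ e < 2 ^ (H + 1), EventStored H u w τ e := by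
  obtain ⟨h1, h2, h3⟩ := hs
  have hN2 : 2 ^ (H + 1) = 2 ^ H + 2 ^ H := by ring
  have hpos : 0 < 2 ^ H := by positivity
  set N := 2 ^ (H + 1) with hN
  have hN1 : N ≤ N * N := Nat.le_mul_of_pos_left _ (by omega)
  have hN3 : N * N ≤ N * N * N := Nat.le_mul_of_pos_right _ (by omega)
  have hB' : 4 * (N * N * N) ≤ B := by linarith
  have hi : Tri B (setV 8 (.const 0)) σ _ fun τ => τ.words 8 0 = 0 := Tri.of_wp' N (by
    simp [wp, setV]; omega)
  refine hi.seq' fun τ hF hτ => (Tri.while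
    (fun τ => τ.words 8 0 ≤ N ∧ ∀ e < τ.words 8 0, EventStored H u w τ e)
    (fun τ => N - τ.words 8 0) (by simp [hτ]) ?_).mono (by simp [hτ, block]) ?_
  · rintro τ' hF' ⟨hle, hI⟩ hb
    have k1 : τ'.words 1 0 = 2 ^ H := by rw [hF'.1 1 (by decide), hF.1 1 (by decide), h1]
    have k2 : τ'.words 2 0 = N := by rw [hF'.1 2 (by decide), hF.1 2 (by decide), h2]
    have k3 : ∀ i, τ'.reals 0 i = u i := fun i => by
      rw [hF'.2 0 (by decide), hF.2 0 (by decide), hu]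
    have k4 : ∀ i, τ'.reals 1 i = (w i).1 := fun i => by
      rw [hF'.2 1 (by decide), hF.2 1 (by decide), hx]
    have k5 : ∀ i, τ'.reals 3 0 * τ'.reals 2 i = (w i).2 := fun i => by
      rw [hF'.2 2 (by decide), hF.2 2 (by decide), hF'.2 3 (by decide), hF.2 3 (by decide), hy]
    simp only [teval_wlt, weval_V, k2] at hb
    generalize he : τ'.words 8 0 = e at *
    have hlt : (N + e) * N < B := by nlinarith
    have heB : e < B := by omega
    have a1 : wp B progKey (fun ρ => ρ.words 5 0 = evElem H e ∧
        (∀ j, ρ.reals 4 j = if j = e then evKey H u e else τ'.reals 4 j) ∧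
        ∀ j, ρ.words 23 j = if j = e then evPartner H e else τ'.words 23 j) τ' := by
      by_cases c1 : e < 2 ^ H
      · simp [progKey, block, wp, setV, he, k1, k3, c1, evElem, evKey, evPartner]
        omega
      · simp [progKey, block, wp, setV, he, k1, k3, c1, evElem, evKey, evPartner]
        omega
    -- The four pieces of the body are summarised one by one by what they write at index `e`; all
    -- other entries keep their old values.
    refine wp_seq a1 fun τ₁ F₁ ⟨p1, p2, p3⟩ => ?_
    have g8 : τ₁.words 8 0 = e := by rw [F₁.1 8 (by decide), he]
    have a2 : wp B progWeight (fun ρ =>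
        (∀ j, ρ.reals 5 j = if j = e then (evWeight H w e).1 else τ'.reals 5 j) ∧
        ∀ j, ρ.reals 6 j = if j = e then (evWeight H w e).2 else τ'.reals 6 j) τ₁ := by
      simp [progWeight, wp, g8, heB, p1, F₁.2 1 (by decide), F₁.2 2 (by decide), F₁.2 3 (by decide),
        F₁.2 5 (by decide), F₁.2 6 (by decide), k4, k5, evWeight]
    refine wp_seq a2 fun τ₂ F₂ ⟨p4, p5⟩ => ?_
    have g8' : τ₂.words 8 0 = e := by rw [F₂.1 8 (by decide), g8]
    have q5 : τ₂.reals 5 e = (evWeight H w e).1 := by rw [p4, if_pos rfl]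
    have q6 : τ₂.reals 6 e = (evWeight H w e).2 := by rw [p5, if_pos rfl]
    have f₁ : ∀ a, a ∉ progKey.rmods → a ∉ progWeight.rmods → τ₂.reals a = τ'.reals a :=
      fun a h h' => (F₂.2 a h').trans (F₁.2 a h)
    have a3 : wp B progSegment (fun ρ =>
        (∀ j, ρ.reals 7 j = if j = e then (segBase (evWeight H w e)).1 else τ'.reals 7 j) ∧
        (∀ j, ρ.reals 8 j = if j = e then (segBase (evWeight H w e)).2 else τ'.reals 8 j) ∧
        (∀ j, ρ.reals 9 j = if j = e then (segStep (evWeight H w e)).1 else τ'.reals 9 j) ∧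
        (∀ j, ρ.reals 10 j = if j = e then (segStep (evWeight H w e)).2 else τ'.reals 10 j) ∧
        ∀ j, ρ.words 25 j = if j = e then (if (evWeight H w e).1 ≠ 0 then 1 else 0)
          else τ'.words 25 j) τ₂ := by
      have f7 := f₁ 7 (by decide) (by decide)
      have f8 := f₁ 8 (by decide) (by decide)
      have f9 := f₁ 9 (by decide) (by decide)
      have f10 := f₁ 10 (by decide) (by decide)
      have f25 : τ₂.words 25 = τ'.words 25 := by rw [F₂.1 25 (by decide), F₁.1 25 (by decide)]
      have b1 : 1 < B := by omega
      have b0 : 0 < B := by omega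
      by_cases c1 : 0 < (evWeight H w e).1
      · simp [progSegment, block, wp, g8', heB, q5, q6, c1, c1.ne', segBase, segStep, b1,
          f7, f8, f9, f10, f25]
      · by_cases c2 : (evWeight H w e).1 < 0
        · simp [progSegment, block, wp, g8', heB, q5, q6, c1, c2, c2.ne, segBase, segStep, b1,
            f7, f8, f9, f10, f25]
        · have c3 : (evWeight H w e).1 = 0 := le_antisymm (not_lt.1 c1) (not_lt.1 c2)
          by_cases c4 : 0 < (evWeight H w e).2
          · simp [progSegment, block, wp, g8', heB, q5, q6, c3, c4, segBase, segStep, b0,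
              f7, f8, f9, f10, f25]
          · simp [progSegment, block, wp, g8', heB, q5, q6, c3, c4, segBase, segStep, b0,
              f7, f8, f9, f10, f25]
    refine wp_seq a3 fun τ₃ F₃ ⟨p7, p8, p9, p10, p25⟩ => ?_
    have g8'' : τ₃.words 8 0 = e := by rw [F₃.1 8 (by decide), g8']
    have g2 : τ₃.words 2 0 = N := by
      rw [F₃.1 2 (by decide), F₂.1 2 (by decide), F₁.1 2 (by decide), k2]
    have r20 : τ₃.words 20 = τ'.words 20 := by
      rw [F₃.1 20 (by decide), F₂.1 20 (by decide), F₁.1 20 (by decide)]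
    have r22 : τ₃.words 22 = τ'.words 22 := by
      rw [F₃.1 22 (by decide), F₂.1 22 (by decide), F₁.1 22 (by decide)]
    have r23 : τ₃.words 23 = τ₁.words 23 := by rw [F₃.1 23 (by decide), F₂.1 23 (by decide)]
    have r4 : τ₃.reals 4 = τ₁.reals 4 := by rw [F₃.2 4 (by decide), F₂.2 4 (by decide)]
    have r5 : τ₃.reals 5 = τ₂.reals 5 := by rw [F₃.2 5 (by decide)]
    have r6 : τ₃.reals 6 = τ₂.reals 6 := by rw [F₃.2 6 (by decide)]
    have hNpos : N ≠ 0 := by omega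
    simp [progNext, block, wp, setV, g8'', g2, EventStored, ← hN, r4, r5, r6, r20, r22, r23, p2, p3,
      p4, p5, p7, p8, p9, p10, p25, hlt]
    refine ⟨heB, by omega, by omega, by omega, by omega, ⟨by omega, fun j hj => ?_⟩, by omega⟩
    rcases hj.lt_or_eq with h | rfl
    · have := hI j h
      simp only [EventStored, ← hN] at this
      simp [h.ne, hNpos, this]
    · simp
  · rintro τ' hF' ⟨⟨hle, hI⟩, hb⟩
    have e2 : τ'.words 2 0 = N := by rw [hF'.1 2 (by decide), hF.1 2 (by decide), h2]
    simp only [teval_wlt, weval_V, e2, not_lt] at hb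
    intro e he
    exact hI e (by omega)

end RealRAM

namespace RealRAM

/-! ### Nodes of the tree -/

/-- The node `v` of the tree with `2 ^ (H + 1)` leaves has height `h`. -/
def IsNode (H h v : ℕ) : Prop := v ≠ 0 ∧ Nat.log 2 v + h = H + 1

theorem exists_isNode {H v : ℕ} (h1 : v ≠ 0) (h2 : v < 2 * 2 ^ (H + 1)) : ∃ h, IsNode H h v := by
  have : Nat.log 2 v < H + 2 := Nat.log_lt_of_lt_pow h1 (by rw [pow_succ]; omega)
  exact ⟨H + 1 - Nat.log 2 v, h1, by omega⟩

theorem IsNode.unique {H h h' v : ℕ} (hn : IsNode H h v) (hn' : IsNode H h' v) : h = h' := by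
  have := hn.2; have := hn'.2; omega

/-- Together with `IsNode.lt` this says that the leaves below a node are true leaves of the tree. -/
theorem IsNode.le {H h v : ℕ} (hn : IsNode H h v) : 2 ^ (H + 1) ≤ v * 2 ^ h := by
  rw [← hn.2, pow_add]
  exact Nat.mul_le_mul_right _ (Nat.pow_log_le_self 2 hn.1)

theorem IsNode.lt {H h v : ℕ} (hn : IsNode H h v) : (v + 1) * 2 ^ h ≤ 2 * 2 ^ (H + 1) := by
  rw [← hn.2, pow_add, ← mul_assoc]
  refine Nat.mul_le_mul_right _ ?_
  have := Nat.lt_pow_succ_log_self one_lt_two v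
  rw [pow_succ] at this
  omega

theorem IsNode.lt_two_mul {H h v : ℕ} (hn : IsNode H h v) : v < 2 * 2 ^ (H + 1) := by
  have h1 := hn.lt
  have h2 : v + 1 ≤ (v + 1) * 2 ^ h := Nat.le_mul_of_pos_right _ (by positivity)
  omega

theorem IsNode.pow_le {H h v : ℕ} (hn : IsNode H h v) : 2 ^ h ≤ 2 ^ (H + 1) :=
  Nat.pow_le_pow_right (by norm_num) (by have := hn.2; omega)

theorem isNode_zero {H v : ℕ} (h1 : 2 ^ (H + 1) ≤ v) (h2 : v < 2 * 2 ^ (H + 1)) : IsNode H 0 v := by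
  have h3 : v ≠ 0 := by have : 0 < 2 ^ (H + 1) := by positivity
                        omega
  have : Nat.log 2 v = H + 1 := by
    rw [Nat.log_eq_iff (Or.inl (by omega))]
    exact ⟨h1, by rw [pow_succ]; omega⟩
  exact ⟨h3, by omega⟩

theorem IsNode.children {H h v : ℕ} (hn : IsNode H h v) (hv : v < 2 ^ (H + 1)) :
    ∃ h', h = h' + 1 ∧ IsNode H h' (2 * v) ∧ IsNode H h' (2 * v + 1) := by
  obtain ⟨h1, h2⟩ := hn
  have h3 : Nat.log 2 v < H + 1 := Nat.log_lt_of_lt_pow h1 hv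
  refine ⟨h - 1, by omega, ⟨by omega, ?_⟩, ⟨by omega, ?_⟩⟩
  · rw [mul_comm, Nat.log_mul_base one_lt_two h1]; omega
  · have : Nat.log 2 (2 * v + 1) = Nat.log 2 v + 1 := by
      rw [Nat.log_of_one_lt_of_le one_lt_two (by omega)]
      congr 2
      omega
    omega

theorem isNode_root (H : ℕ) : IsNode H (H + 1) 1 := ⟨one_ne_zero, by simp⟩

/-- The total size of the blocks of the first nodes. -/
def nodeSum (H v : ℕ) : ℕ := ∑ i ∈ Finset.Ico 1 v, 2 ^ (H + 1 - Nat.log 2 i)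

theorem nodeSum_succ {H h v : ℕ} (hn : IsNode H h v) : nodeSum H (v + 1) = nodeSum H v + 2 ^ h := by
  unfold nodeSum
  rw [Finset.sum_Ico_succ_top (Nat.one_le_iff_ne_zero.2 hn.1)]
  congr 2
  have := hn.2
  omega

/-- The blocks of one level partition the leaves, so every level contributes `2 ^ (H + 1)`. This is
the source of one logarithmic factor in the running time. -/
theorem nodeSum_pow (H k : ℕ) (hk : k ≤ H + 1) : nodeSum H (2 ^ k) = k * 2 ^ (H + 1) := by
  induction k with
  | zero => simp [nodeSum]
  | succ k ih =>
    have h1 := ih (by omega)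
    unfold nodeSum at h1 ⊢
    rw [← Finset.sum_Ico_consecutive _ (Nat.one_le_two_pow (n := k))
      (Nat.pow_le_pow_right (by norm_num) (Nat.le_succ k)), h1,
      Finset.sum_congr rfl (g := fun _ => 2 ^ (H + 1 - k))]
    · rw [Finset.sum_const, Nat.card_Ico, smul_eq_mul]
      have e1 : 2 ^ (k + 1) - 2 ^ k = 2 ^ k := by rw [pow_succ]; omega
      rw [e1, ← pow_add, add_mul, one_mul]
      congr 2
      omega
    · intro i hi
      rw [Finset.mem_Ico] at hi
      have : Nat.log 2 i = k := by
        rw [Nat.log_eq_iff (Or.inr ⟨one_lt_two, by have : 0 < 2 ^ k := by positivity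
                                                   omega⟩)]
        exact hi
      rw [this]

/-! ### Mergesort along the tree -/

/-- One step of merging the lists at the children of a node. -/
def progMergeStep (A : ℕ) (cmp : WExpr → WExpr → Test) : Program :=
  .seq (.ite (.and (.wlt (V 5) (.get 22 (.const 2 * V 4)))
      (.or (.not (.wlt (V 6) (.get 22 (.const 2 * V 4))))
        (cmp (.get A (.const 2 * V 4 * V 2 + V 5))
          (.get A ((.const 2 * V 4 + .const 1) * V 2 + V 6)))))
    (.seq (.wset A (V 4 * V 2 + V 7) (.get A (.const 2 * V 4 * V 2 + V 5)))
      (setV 5 (V 5 + .const 1)))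
    (.seq (.wset A (V 4 * V 2 + V 7) (.get A ((.const 2 * V 4 + .const 1) * V 2 + V 6)))
      (setV 6 (V 6 + .const 1))))
  (setV 7 (V 7 + .const 1))

/-- Merge the lists at the children of a node. -/
def progMerge (A : ℕ) (cmp : WExpr → WExpr → Test) : Program :=
  block [setV 5 (.const 0), setV 6 (.const 0), setV 7 (.const 0),
    .loop (.wlt (V 7) (.get 22 (V 4))) (progMergeStep A cmp)]

/-- Mergesort along the tree. -/
def progSort (A : ℕ) (cmp : WExpr → WExpr → Test) : Program := .seq (setV 4 (V 2))
  (.loop (.wlt (.const 1) (V 4)) (.seq (block [setV 4 (V 4 - .const 1),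
    .wset 22 (V 4) (.const 2 * .get 22 (.const 2 * V 4))]) (progMerge A cmp)))

/-- The test decides the relation on numbers below `N`, given the real arrays. -/
def Decides (r : ℕ → ℕ → ℝ) (N : ℕ) (cmp : WExpr → WExpr → Test) (le : ℕ → ℕ → Bool) : Prop :=
  ∀ ρ : State, ρ.reals = r → ∀ e f : WExpr, e.eval ρ < N → f.eval ρ < N →
    ((cmp e f).eval ρ ↔ le (e.eval ρ) (f.eval ρ) = true)

/-- Node `v` owns the cells from `v * N` on. The last clause says that nothing outside its list is
changed, so lists of other nodes stay valid. -/
theorem progMerge_spec {A B N v s : ℕ} {cmp : WExpr → WExpr → Test} {le : ℕ → ℕ → Bool}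
    {l₁ l₂ : List ℕ} {σ : State} (hA : A = 20 ∨ A = 21) (hc : Decides σ.reals N cmp le)
    (hB : 2 * N * N ≤ B) (hNB : 2 * N ≤ B) (hv0 : v ≠ 0) (hv : v < N) (hs : 2 * s ≤ N)
    (h4 : σ.words 4 0 = v) (h2 : σ.words 2 0 = N) (hs1 : σ.words 22 (2 * v) = s)
    (hs2 : σ.words 22 v = 2 * s) (hl₁ : arr (σ.words A) (2 * v * N) s = l₁)
    (hl₂ : arr (σ.words A) ((2 * v + 1) * N) s = l₂) (hb₁ : ∀ e ∈ l₁, e < N)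
    (hb₂ : ∀ e ∈ l₂, e < N) :
    Tri B (progMerge A cmp) σ ((progMerge A cmp).maxCost * (2 * s + 1)) fun τ =>
      arr (τ.words A) (v * N) (2 * s) = l₁.merge l₂ le ∧
      ∀ x, x < v * N ∨ v * N + 2 * s ≤ x → τ.words A x = σ.words A x := by
  have len₁ : l₁.length = s := by rw [← hl₁, length_arr]
  have len₂ : l₂.length = s := by rw [← hl₂, length_arr]
  rw [arr_eq_iff len₁] at hl₁
  rw [arr_eq_iff len₂] at hl₂
  have a1 : Tri B (setV 5 (.const 0)) σ _ fun τ => τ.words 5 0 = 0 :=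
    Tri.of_wp' (2 * s) (by simp [wp, setV]; omega)
  refine a1.seq' fun τ₁ F₁ z5 => ?_
  have a2 : Tri B (setV 6 (.const 0)) τ₁ _ fun τ => τ.words 6 0 = 0 :=
    Tri.of_wp' (2 * s) (by simp [wp, setV]; omega)
  refine a2.seq' fun τ₂ F₂ z6 => ?_
  have a3 : Tri B (setV 7 (.const 0)) τ₂ _ fun τ => τ.words 7 0 = 0 :=
    Tri.of_wp' (2 * s) (by simp [wp, setV]; omega)
  refine a3.seq' fun τ₃ F₃ z7 => ?_
  have y5 : τ₃.words 5 0 = 0 := by rw [F₃.1 5 (by decide), F₂.1 5 (by decide), z5]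
  have y6 : τ₃.words 6 0 = 0 := by rw [F₃.1 6 (by decide), z6]
  have hF : ∀ a, a ≠ 5 → a ≠ 6 → a ≠ 7 → τ₃.words a = σ.words a := fun a h5 h6 h7 => by
    rw [F₃.1 a (by simpa [setV, Program.wmods] using h7),
      F₂.1 a (by simpa [setV, Program.wmods] using h6),
      F₁.1 a (by simpa [setV, Program.wmods] using h5)]
  have hR : τ₃.reals = σ.reals := by
    funext a
    rw [F₃.2 a (by simp [setV, Program.rmods]), F₂.2 a (by simp [setV, Program.rmods]),
      F₁.2 a (by simp [setV, Program.rmods])]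
  have hA5 : A ≠ 5 ∧ A ≠ 6 ∧ A ≠ 7 ∧ A ≠ 4 ∧ A ≠ 2 ∧ A ≠ 22 := by omega
  have hA5' : 5 ≠ A ∧ 6 ≠ A ∧ 7 ≠ A ∧ 4 ≠ A ∧ 2 ≠ A ∧ 22 ≠ A := by omega
  have hvN : 2 * v * N + N ≤ 2 * N * N := by
    calc 2 * v * N + N = (2 * v + 1) * N := by ring
      _ ≤ 2 * N * N := Nat.mul_le_mul_right _ (by omega)
  -- Because `v` is not zero, the target region ends before the regions of the children begin, so
  -- writing does not destroy the input.
  have hvv : v * N + N ≤ 2 * v * N := by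
    calc v * N + N = (v + 1) * N := by ring
      _ ≤ 2 * v * N := Nat.mul_le_mul_right _ (by omega)
  have e21 : (2 * v + 1) * N = 2 * v * N + N := by ring
  have hNpos : 0 < N := by omega
  -- Invariant: what is written, followed by the merge of the unread remainders, is the full merge.
  refine (Tri.while (fun τ => ∃ i j, τ.words 5 0 = i ∧ τ.words 6 0 = j ∧ τ.words 7 0 = i + j ∧
      i ≤ s ∧ j ≤ s ∧ arr (τ.words A) (v * N) (i + j) ++ (l₁.drop i).merge (l₂.drop j) le =
        l₁.merge l₂ le ∧ ∀ x, x < v * N ∨ v * N + (i + j) ≤ x → τ.words A x = σ.words A x)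
    (fun τ => 2 * s - τ.words 7 0) ⟨0, 0, y5, y6, z7, by omega, by omega, by simp, fun x _ => by
      rw [hF A hA5.1 hA5.2.1 hA5.2.2.1]⟩ ?_).mono (Nat.mul_le_mul_left _ (by omega)) ?_
  · rintro τ F ⟨i, j, h5, h6, h7, hi, hj, hm, hx⟩ hb
    have k4 : τ.words 4 0 = v := by
      rw [F.1 4 (by simp [progMergeStep, Program.wmods, setV, hA5']), hF 4 (by decide) (by decide)
        (by decide), h4]
    have k2 : τ.words 2 0 = N := by
      rw [F.1 2 (by simp [progMergeStep, Program.wmods, setV, hA5']), hF 2 (by decide) (by decide)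
        (by decide), h2]
    have k22 : τ.words 22 = σ.words 22 := by
      rw [F.1 22 (by simp [progMergeStep, Program.wmods, setV, hA5']), hF 22 (by decide) (by decide)
        (by decide)]
    have kR : τ.reals = σ.reals := by
      funext a
      rw [F.2 a (by simp [progMergeStep, Program.rmods, setV]), hR]
    simp only [teval_wlt, weval_V, weval_get, h7, k4, k22, hs2] at hb
    have r₁ : ∀ h : i < l₁.length, τ.words A (2 * v * N + i) = l₁[i] := fun h => by
      rw [hx _ (Or.inr (by omega)), hl₁ i h]
    have r₂ : ∀ h : j < l₂.length, τ.words A ((2 * v + 1) * N + j) = l₂[j] := fun h => by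
      rw [hx _ (Or.inr (by omega)), hl₂ j h]
    have hcmp : ∀ (h : i < l₁.length) (h' : j < l₂.length),
        ((cmp (.get A (.const 2 * V 4 * V 2 + V 5))
          (.get A ((.const 2 * V 4 + .const 1) * V 2 + V 6))).eval τ ↔ le l₁[i] l₂[j]) := by
      intro h h'
      have q₁ : (WExpr.get A (.const 2 * V 4 * V 2 + V 5)).eval τ = l₁[i] := by
        simp only [weval_get, weval_add, weval_mul, weval_const, weval_V, k4, k2, h5, r₁ h]
      have q₂ : (WExpr.get A ((.const 2 * V 4 + .const 1) * V 2 + V 6)).eval τ = l₂[j] := by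
        simp only [weval_get, weval_add, weval_mul, weval_const, weval_V, k4, k2, h6, r₂ h']
      rw [hc τ kR _ _ (by rw [q₁]; exact hb₁ _ (List.getElem_mem _))
        (by rw [q₂]; exact hb₂ _ (List.getElem_mem _)), q₁, q₂]
    have hwB : v * N + (i + j) < B := by omega
    by_cases ht : i < s ∧ (s ≤ j ∨ (cmp (.get A (.const 2 * V 4 * V 2 + V 5))
          (.get A ((.const 2 * V 4 + .const 1) * V 2 + V 6))).eval τ)
    · have hi' : i < l₁.length := by omega
      have hbnd : l₁[i] < B := by have := hb₁ _ (List.getElem_mem hi'); omega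
      have hmm := merge_drop_left (le := le) hi' fun hj' =>
        (hcmp hi' hj').1 (ht.2.resolve_left (by omega))
      simp [progMergeStep, wp, setV, k4, k2, k22, hs1, h5, h6, h7, ht.1, ht.2, hA5, hA5', hwB,
        r₁ hi', hbnd]
      refine ⟨by omega, by omega, by omega, by omega, ⟨by omega, by omega, ?_, ?_⟩, by omega⟩
      · rw [show i + 1 + j = i + j + 1 by omega, arr_snoc (f := τ.words A) (x := l₁[i])
          (by intro y; simp [hA5]), List.append_assoc, List.singleton_append, ← hmm, hm]
      · intro x hx'
        rw [if_neg (by omega), hx x (by omega)]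
    · have hj' : j < l₂.length := by
        by_contra hcon
        exact ht ⟨by omega, Or.inl (by omega)⟩
      have hbnd : l₂[j] < B := by have := hb₂ _ (List.getElem_mem hj'); omega
      have hmm := merge_drop_right (le := le) hj' fun hi' hle =>
        ht ⟨by omega, Or.inr ((hcmp hi' hj').2 hle)⟩
      simp [progMergeStep, wp, setV, k4, k2, k22, hs1, h5, h6, h7, ht, hA5, hA5', hwB,
        r₂ hj', hbnd]
      refine ⟨by omega, by omega, by omega, by omega, ⟨by omega, by omega, by omega, ?_, ?_⟩, by omega⟩
      · rw [show i + (j + 1) = i + j + 1 from rfl, arr_snoc (f := τ.words A) (x := l₂[j])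
          (by intro y; simp [hA5, add_assoc]), List.append_assoc, List.singleton_append, ← hmm, hm]
      · intro x hx'
        rw [if_neg (by omega), hx x (by omega)]
  · rintro τ F ⟨⟨i, j, h5, h6, h7, hi, hj, hm, hx⟩, hb⟩
    have k4 : τ.words 4 0 = v := by
      rw [F.1 4 (by simp [progMergeStep, Program.wmods, setV, hA5']), hF 4 (by decide) (by decide)
        (by decide), h4]
    have k22 : τ.words 22 = σ.words 22 := by
      rw [F.1 22 (by simp [progMergeStep, Program.wmods, setV, hA5']), hF 22 (by decide) (by decide)
        (by decide)]
    simp only [teval_wlt, weval_V, weval_get, h7, k4, k22, hs2] at hb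
    obtain rfl : i = s := by omega
    obtain rfl : j = i := by omega
    rw [List.drop_eq_nil_of_le len₁.le, List.drop_eq_nil_of_le len₂.le, List.nil_merge,
      List.append_nil, ← two_mul] at hm
    exact ⟨hm, fun x hx' => hx x (by omega)⟩

end RealRAM

namespace RealRAM

/-- The rule for loops over all inner nodes in decreasing order. -/
theorem Tri.nodeLoop {B H c : ℕ} {p : Program} {σ : State} (I : ℕ → State → Prop) (hc : 1 ≤ c)
    (h4 : σ.words 4 0 = 2 ^ (H + 1)) (hI : I (2 ^ (H + 1)) σ)
    (h : ∀ τ v k, Frame p σ τ → τ.words 4 0 = v + 1 → v < 2 ^ (H + 1) → IsNode H k v → I (v + 1) τ →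
      Tri B p τ (p.maxCost * (c * 2 ^ k)) fun ρ => ρ.words 4 0 = v ∧ I v ρ) :
    Tri B (.loop (.wlt (.const 1) (V 4)) p) σ
      ((Program.loop (.wlt (.const 1) (V 4)) p).maxCost * (c * nodeSum H (2 ^ (H + 1)) + 1)) (I 1) := by
  set K := (Program.loop (.wlt (.const 1) (V 4)) p).maxCost with hK
  have hK' : K = p.maxCost + (Test.wlt (.const 1) (V 4)).cost + 1 := rfl
  refine (Tri.loop (fun τ => 1 ≤ τ.words 4 0 ∧ τ.words 4 0 ≤ 2 ^ (H + 1) ∧ I (τ.words 4 0) τ)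
    (fun τ => K * (c * nodeSum H (τ.words 4 0))) ⟨?_, ?_, ?_⟩ ?_).mono ?_ ?_
  · rw [h4]; exact Nat.one_le_two_pow
  · rw [h4]
  · rw [h4]; exact hI
  · rintro τ hF ⟨h1, h2, hI⟩ hb
    simp only [teval_wlt, weval_const, weval_V] at hb
    obtain ⟨v, hv⟩ : ∃ v, τ.words 4 0 = v + 1 := ⟨τ.words 4 0 - 1, by omega⟩
    rw [hv] at hb h2 hI
    obtain ⟨k, hk⟩ := exists_isNode (H := H) (v := v) (by omega) (by omega)
    refine ⟨_, (h τ v k hF hv (by omega) hk hI).mono le_rfl fun ρ _ ⟨e, hρ⟩ => ⟨?_, ?_⟩⟩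
    · rw [e]; exact ⟨by omega, by omega, hρ⟩
    · rw [e, hv, nodeSum_succ hk, mul_add, mul_add]
      -- A budget of at least one unit also pays for the loop test at this node.
      have : 1 ≤ c * 2 ^ k := Nat.mul_pos hc (by positivity)
      have h5 : K * (c * 2 ^ k) = p.maxCost * (c * 2 ^ k) +
          ((Test.wlt (.const 1) (V 4)).cost + 1) * (c * 2 ^ k) := by rw [hK']; ring
      have := Nat.le_mul_of_pos_right ((Test.wlt (.const 1) (V 4)).cost + 1) this
      omega
  · rw [h4, mul_add, mul_one, add_assoc]
    exact Nat.add_le_add_left (by omega) _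
  · rintro τ _ ⟨⟨h1, -, hI⟩, hb⟩
    simp only [teval_wlt, weval_const, weval_V] at hb
    rwa [show τ.words 4 0 = 1 by omega] at hI

/-- The lists at the nodes from `b` on are stored. -/
def NodesSorted (A H : ℕ) (le : ℕ → ℕ → Bool) (f : ℕ → ℕ) (b : ℕ) (σ : State) : Prop :=
  ∀ h v, b ≤ v → IsNode H h v →
    arr (σ.words A) (v * 2 ^ (H + 1)) (2 ^ h) = treeSort le f h v ∧ σ.words 22 v = 2 ^ h

theorem IsNode.treeSort_lt {H h v N : ℕ} {le : ℕ → ℕ → Bool} {f : ℕ → ℕ} (hn : IsNode H h v)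
    (hf : ∀ q < 2 * 2 ^ (H + 1), f q < N) : ∀ e ∈ treeSort le f h v, e < N := by
  intro e he
  rw [(treeSort_perm le f h v).mem_iff, List.mem_map] at he
  obtain ⟨q, hq, rfl⟩ := he
  refine hf q ?_
  rw [List.mem_range'_1] at hq
  have := hn.lt
  rw [add_mul, one_mul] at this
  omega

/-- Going through the inner nodes downwards meets the children `2 v` and `2 v + 1` before `v`. -/
theorem progSort_spec {A B H : ℕ} {cmp : WExpr → WExpr → Test} {le : ℕ → ℕ → Bool} {f : ℕ → ℕ}
    {σ : State} (hA : A = 20 ∨ A = 21) (hc : Decides σ.reals (2 ^ (H + 1)) cmp le)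
    (hB : 2 * 2 ^ (H + 1) * (2 * 2 ^ (H + 1) * 2 ^ (H + 1)) ≤ B)
    (h2 : σ.words 2 0 = 2 ^ (H + 1)) (hf : ∀ q < 2 * 2 ^ (H + 1), f q < 2 ^ (H + 1))
    (hσ : NodesSorted A H le f (2 ^ (H + 1)) σ) :
    Tri B (progSort A cmp) σ ((progSort A cmp).maxCost * (2 * nodeSum H (2 ^ (H + 1)) + 1))
      (NodesSorted A H le f 1) := by
  have hpos : 0 < 2 ^ (H + 1) := by positivity
  have hN1 : 2 ^ (H + 1) ≤ 2 ^ (H + 1) * 2 ^ (H + 1) := Nat.le_mul_of_pos_left _ hpos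
  have hN3 : 2 ^ (H + 1) * 2 ^ (H + 1) ≤ 2 ^ (H + 1) * 2 ^ (H + 1) * 2 ^ (H + 1) :=
    Nat.le_mul_of_pos_right _ hpos
  have hB' : 4 * (2 ^ (H + 1) * 2 ^ (H + 1) * 2 ^ (H + 1)) ≤ B := by linarith
  have hB2 : 2 * 2 ^ (H + 1) * 2 ^ (H + 1) ≤ B := by
    rw [mul_assoc]; omega
  have a1 : Tri B (setV 4 (V 2)) σ _ fun τ => τ.words 4 0 = 2 ^ (H + 1) :=
    Tri.of_wp' (2 * nodeSum H (2 ^ (H + 1))) (by simp [wp, setV, h2]; omega)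
  have hA4 : A ≠ 4 ∧ A ≠ 22 := by omega
  refine a1.seq' fun τ₁ F₁ h4 => Tri.nodeLoop (NodesSorted A H le f) (by omega) h4 ?_ ?_
  · intro h v hv hn
    have := hσ h v hv hn
    rwa [← F₁.1 A (by simp [setV, Program.wmods, hA4]), ← F₁.1 22 (by decide)] at this
  rintro τ v k F hτ4 hv hn hI
  have hA2 : 2 ≠ A := by omega
  have k2 : τ.words 2 0 = 2 ^ (H + 1) := by
    rw [F.1 2 (by simp [block, setV, progMerge, progMergeStep, Program.wmods, hA2]),
      F₁.1 2 (by decide), h2]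
  have kR : τ.reals = σ.reals := by
    funext a
    rw [F.2 a (by simp [block, setV, progMerge, progMergeStep, Program.rmods]),
      F₁.2 a (by simp [setV, Program.rmods])]
  obtain ⟨j, rfl, n1, n2⟩ := hn.children hv
  have hv0 := hn.1
  obtain ⟨i1, s1⟩ := hI j (2 * v) (by omega) n1
  obtain ⟨i2, -⟩ := hI j (2 * v + 1) (by omega) n2
  have hk : 2 * 2 ^ j ≤ 2 ^ (H + 1) := by have := hn.pow_le; rw [pow_succ] at this; omega
  have a2 : Tri B (block [setV 4 (V 4 - .const 1),
      .wset 22 (V 4) (.const 2 * .get 22 (.const 2 * V 4))]) τ _ fun ρ => ρ.words 4 0 = v ∧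
        ∀ x, ρ.words 22 x = if x = v then 2 * 2 ^ j else τ.words 22 x :=
    Tri.of_wp' (2 * 2 ^ j) (by
      simp [wp, setV, block, hτ4, s1]; omega)
  refine (a2.seq' (q := progMerge A cmp) fun ρ F' ⟨e4, e22⟩ =>
    (progMerge_spec (le := le) (N := 2 ^ (H + 1)) (v := v) (s := 2 ^ j) hA ?_ hB2 (by omega) hv0 hv hk e4
      ?_ ?_ ?_ (l₁ := treeSort le f j (2 * v)) (l₂ := treeSort le f j (2 * v + 1)) ?_ ?_ (n1.treeSort_lt hf)
        (n2.treeSort_lt hf)).mono le_rfl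
      fun τ' F'' ⟨q1, q2⟩ => ?_).mono ?_ fun _ _ h => h
  · have : ρ.reals = τ.reals := by
      funext a
      rw [F'.2 a (by simp [block, setV, Program.rmods])]
    rw [this, kR]; exact hc
  · rw [F'.1 2 (by decide), k2]
  · rw [e22, if_neg (by omega), s1]
  · rw [e22, if_pos rfl]
  · rw [F'.1 A (by simp [block, setV, Program.wmods, hA4]), i1]
  · rw [F'.1 A (by simp [block, setV, Program.wmods, hA4]), i2]
  -- Merging a block of size `2 ^ (j + 1)` uses `2 ^ (j + 1) + 1` units, which twice the block size
  -- covers.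
  · have h1 : 1 ≤ 2 ^ j := Nat.one_le_two_pow
    refine Nat.mul_le_mul_left _ ?_
    rw [pow_succ]; omega
  · have hA5 : 4 ≠ A ∧ 22 ≠ A := by omega
    refine ⟨by rw [F''.1 4 (by simp [block, setV, progMerge, progMergeStep, Program.wmods, hA5]), e4],
      fun h' v' hv' hn' => ?_⟩
    rw [F''.1 22 (by simp [block, setV, progMerge, progMergeStep, Program.wmods, hA5]), e22]
    rcases hv'.eq_or_lt with rfl | hlt
    · obtain rfl := hn.unique hn'
      rw [if_pos rfl, show 2 ^ (j + 1) = 2 * 2 ^ j from pow_succ' 2 j]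
      exact ⟨q1, rfl⟩
    · rw [if_neg (by omega), ← (hI h' v' (by omega) hn').1]
      refine ⟨arr_congr fun i hi => ?_, (hI h' v' (by omega) hn').2⟩
      rw [q2 _ (Or.inr ?_), F'.1 A (by simp [block, setV, Program.wmods, hA4])]
      have : (v + 1) * 2 ^ (H + 1) ≤ v' * 2 ^ (H + 1) := Nat.mul_le_mul_right _ hlt
      rw [add_mul, one_mul] at this
      omega

end RealRAM

namespace RealRAM

/-! ### The chains of the leaves -/

/-- The points whose coordinates are in two consecutive real arrays. -/
def pts (σ : State) (a : ℕ) (i : ℕ) : ℝ × ℝ := (σ.reals a i, σ.reals (a + 1) i)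

/-- The chains at the nodes from `b` on are stored. -/
def NodesChained (H : ℕ) (u : ℕ → ℝ) (w : ℕ → ℝ × ℝ) (b : ℕ) (σ : State) : Prop :=
  ∀ h v, b ≤ v → IsNode H h v →
    arr (pts σ 11) (v * (2 * 2 ^ (H + 1) * 2 ^ (H + 1))) (upperTree H u w h v).length =
      upperTree H u w h v ∧ σ.words 27 v = (upperTree H u w h v).length

/-- The chain of a leaf, and its event for the sorting by slopes. -/
def progLeaf : Program := block [
  setV 8 (.get 20 (V 2 + V 5)),
  .wset 24 (V 8) (V 2 + V 5),
  .wset 21 ((V 2 + V 5) * V 2) (V 8),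
  .wset 27 (V 2 + V 5) (.get 25 (V 8) + .const 1),
  .rset 11 ((V 2 + V 5) * V 3) (.get 7 (V 8)),
  .rset 12 ((V 2 + V 5) * V 3) (.get 8 (V 8)),
  .rset 11 ((V 2 + V 5) * V 3 + .const 1) (.get 7 (V 8) + .get 9 (V 8)),
  .rset 12 ((V 2 + V 5) * V 3 + .const 1) (.get 8 (V 8) + .get 10 (V 8)),
  setV 5 (V 5 + .const 1)]

/-- The chains of the leaves. -/
def progLeaves : Program := block [setV 5 (.const 0), .loop (.wlt (V 5) (V 2)) progLeaf]

/-- The constant data of the events are stored. -/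
structure EventData (H : ℕ) (u : ℕ → ℝ) (w : ℕ → ℝ × ℝ) (σ : State) : Prop where
  sizes : Sizes H σ
  partner : ∀ e < 2 ^ (H + 1), σ.words 23 e = evPartner H e
  weight : ∀ e < 2 ^ (H + 1), pts σ 5 e = evWeight H w e
  base : ∀ e < 2 ^ (H + 1), pts σ 7 e = segBase (evWeight H w e)
  step : ∀ e < 2 ^ (H + 1), pts σ 9 e = segStep (evWeight H w e)
  flag : ∀ e < 2 ^ (H + 1), σ.words 25 e = if (evWeight H w e).1 ≠ 0 then 1 else 0

theorem EventData.frame {H : ℕ} {u : ℕ → ℝ} {w : ℕ → ℝ × ℝ} {σ τ : State} (h : EventData H u w σ)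
    {p : Program} (hF : Frame p σ τ)
    (hw : 1 ∉ p.wmods ∧ 2 ∉ p.wmods ∧ 3 ∉ p.wmods ∧ 23 ∉ p.wmods ∧ 25 ∉ p.wmods)
    (hr : 5 ∉ p.rmods ∧ 6 ∉ p.rmods ∧ 7 ∉ p.rmods ∧ 8 ∉ p.rmods ∧ 9 ∉ p.rmods ∧ 10 ∉ p.rmods) :
    EventData H u w τ := by
  obtain ⟨w1, w2, w3, w23, w25⟩ := hw
  obtain ⟨r5, r6, r7, r8, r9, r10⟩ := hr
  obtain ⟨⟨a1, a2, a3⟩, b, c, d, e, f⟩ := h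
  refine ⟨⟨?_, ?_, ?_⟩, ?_, ?_, ?_, ?_, ?_⟩
  · rw [hF.1 1 w1, a1]
  · rw [hF.1 2 w2, a2]
  · rw [hF.1 3 w3, a3]
  · rw [hF.1 23 w23]; exact b
  · unfold pts; rw [hF.2 5 r5, hF.2 6 r6]; exact c
  · unfold pts; rw [hF.2 7 r7, hF.2 8 r8]; exact d
  · unfold pts; rw [hF.2 9 r9, hF.2 10 r10]; exact e
  · rw [hF.1 25 w25]; exact f

/-- The data of a leaf are stored. -/
def LeafStored (H : ℕ) (u : ℕ → ℝ) (w : ℕ → ℝ × ℝ) (σ : State) (q : ℕ) : Prop :=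
  σ.words 24 (evAt H u q) = q ∧ σ.words 21 (q * 2 ^ (H + 1)) = evAt H u q ∧
  σ.words 27 q = (if (evWeight H w (evAt H u q)).1 ≠ 0 then 1 else 0) + 1 ∧
  pts σ 11 (q * (2 * 2 ^ (H + 1) * 2 ^ (H + 1))) = segBase (evWeight H w (evAt H u q)) ∧
  pts σ 11 (q * (2 * 2 ^ (H + 1) * 2 ^ (H + 1)) + 1) =
    segBase (evWeight H w (evAt H u q)) + segStep (evWeight H w (evAt H u q))

/-- The chronological order is turned into its inverse permutation, stored in array 24, and the
leaves of the second tree receive their events for sorting by slope. -/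
theorem progLeaves_spec {B H : ℕ} {u : ℕ → ℝ} {w : ℕ → ℝ × ℝ} {σ : State} (hs : EventData H u w σ)
    (hB : 2 * 2 ^ (H + 1) * (2 * 2 ^ (H + 1) * 2 ^ (H + 1)) ≤ B)
    (h20 : arr (σ.words 20) (2 ^ (H + 1)) (2 ^ (H + 1)) = evOrder H u) :
    Tri B progLeaves σ (progLeaves.maxCost * (2 ^ (H + 1) + 1)) fun τ =>
      (∀ q, 2 ^ (H + 1) ≤ q → q < 2 * 2 ^ (H + 1) → τ.words 21 (q * 2 ^ (H + 1)) = evAt H u q) ∧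
      (∀ e < 2 ^ (H + 1), τ.words 24 e = leafOf H u e) ∧ NodesChained H u w (2 ^ (H + 1)) τ := by
  have hpos : 0 < 2 ^ (H + 1) := by positivity
  have hev : ∀ i < 2 ^ (H + 1), σ.words 20 (2 ^ (H + 1) + i) = evAt H u (2 ^ (H + 1) + i) := by
    intro i hi
    rw [arr_eq_iff (length_evOrder H u)] at h20
    rw [h20 i (by rw [length_evOrder]; exact hi), evAt, Nat.add_sub_cancel_left,
      List.getD_eq_getElem]
  have hevN : ∀ q, evAt H u q < 2 ^ (H + 1) := evAt_lt H u
  -- Different leaves carry different events, so later writes to array 24 never overwrite an earlier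
  -- entry.
  have hinj : ∀ q q', 2 ^ (H + 1) ≤ q → q < 2 * 2 ^ (H + 1) → 2 ^ (H + 1) ≤ q' →
      q' < 2 * 2 ^ (H + 1) → evAt H u q = evAt H u q' → q = q' := fun q q' h1 h2 h3 h4 h => by
    rw [← leafOf_evAt H u h1 h2, h, leafOf_evAt H u h3 h4]
  have hfin : ∀ τ : State, (∀ q, 2 ^ (H + 1) ≤ q → q < 2 * 2 ^ (H + 1) → LeafStored H u w τ q) →
      (∀ q, 2 ^ (H + 1) ≤ q → q < 2 * 2 ^ (H + 1) → τ.words 21 (q * 2 ^ (H + 1)) = evAt H u q) ∧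
      (∀ e < 2 ^ (H + 1), τ.words 24 e = leafOf H u e) ∧ NodesChained H u w (2 ^ (H + 1)) τ := by
    intro τ h
    refine ⟨fun q h1 h2 => (h q h1 h2).2.1, fun e he => ?_, fun k v hv hn => ?_⟩
    · have := (h _ (le_leafOf H u e) (leafOf_lt H u he)).1
      rwa [evAt_leafOf H u he] at this
    · obtain rfl : k = 0 := hn.unique (isNode_zero hv hn.lt_two_mul)
      obtain ⟨-, -, h3, h4, h5⟩ := h v hv hn.lt_two_mul
      -- Two points are written at every leaf; for a vertical segment the stored length one hides
      -- the second.
      unfold upperTree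
      rw [h3]
      split_ifs
      · simp [arr, h4, h5, List.range_succ]
      · simp [arr, h4]
  obtain ⟨⟨h1, h2, h3⟩, -, -, hb, hst, hf⟩ := hs
  unfold LeafStored at hfin
  generalize hN : 2 ^ (H + 1) = N at *
  have hN1 : N ≤ N * N := Nat.le_mul_of_pos_left _ (by omega)
  have hN3 : N * N ≤ N * N * N := Nat.le_mul_of_pos_right _ (by omega)
  have hB' : 4 * (N * N * N) ≤ B := by linarith
  have hL : 2 ≤ 2 * N * N := by rw [mul_assoc]; omega
  generalize hLL : 2 * N * N = L at *
  have i1 : Tri B (setV 5 (.const 0)) σ _ fun τ => τ.words 5 0 = 0 := Tri.of_wp' N (by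
    simp [wp, setV]; omega)
  refine i1.seq' fun τ hF hτ => (Tri.while
    (fun τ => τ.words 5 0 ≤ N ∧ ∀ q, N ≤ q → q < N + τ.words 5 0 →
      τ.words 24 (evAt H u q) = q ∧ τ.words 21 (q * N) = evAt H u q ∧
      τ.words 27 q = (if (evWeight H w (evAt H u q)).1 ≠ 0 then 1 else 0) + 1 ∧
      pts τ 11 (q * L) = segBase (evWeight H w (evAt H u q)) ∧
      pts τ 11 (q * L + 1) =
        segBase (evWeight H w (evAt H u q)) + segStep (evWeight H w (evAt H u q)))
    (fun τ => N - τ.words 5 0) (by rw [hτ]; exact ⟨by omega, by omega⟩) ?_).mono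
      (by simp [hτ, block]) ?_
  · rintro τ' hF' ⟨hle, hI⟩ hb'
    have k2 : τ'.words 2 0 = N := by rw [hF'.1 2 (by decide), hF.1 2 (by decide), h2]
    have k3 : τ'.words 3 0 = L := by rw [hF'.1 3 (by decide), hF.1 3 (by decide), h3]
    have k20 : τ'.words 20 = σ.words 20 := by rw [hF'.1 20 (by decide), hF.1 20 (by decide)]
    have k25 : τ'.words 25 = σ.words 25 := by rw [hF'.1 25 (by decide), hF.1 25 (by decide)]
    have k7 : τ'.reals 7 = σ.reals 7 := by rw [hF'.2 7 (by decide), hF.2 7 (by decide)]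
    have k8 : τ'.reals 8 = σ.reals 8 := by rw [hF'.2 8 (by decide), hF.2 8 (by decide)]
    have k9 : τ'.reals 9 = σ.reals 9 := by rw [hF'.2 9 (by decide), hF.2 9 (by decide)]
    have k10 : τ'.reals 10 = σ.reals 10 := by rw [hF'.2 10 (by decide), hF.2 10 (by decide)]
    simp only [teval_wlt, weval_V, k2] at hb'
    generalize hi : τ'.words 5 0 = i at *
    have heN := hevN (N + i)
    have b25 : (if (evWeight H w (evAt H u (N + i))).1 = 0 then 0 else 1) + 1 < B := by
      split_ifs <;> omega
    have hq : N + i + 1 ≤ 2 * N := by omega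
    have hqN : (N + i) * N + N ≤ 2 * N * N := by
      calc _ = (N + i + 1) * N := by ring
        _ ≤ 2 * N * N := Nat.mul_le_mul_right _ hq
    have hqL : (N + i) * L + L ≤ 2 * N * L := by
      calc _ = (N + i + 1) * L := by ring
        _ ≤ 2 * N * L := Nat.mul_le_mul_right _ hq
    have d1 : evAt H u (N + i) < B := by omega
    have d2 : N + i < B := by omega
    have d3 : (N + i) * N < B := by have := Nat.le_mul_of_pos_left L (n := 2 * N) (by omega); omega
    have d4 : (N + i) * L < B := by omega
    have d5 : (N + i) * L + 1 < B := by omega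
    have hdd : ∀ q < N + i, q * L + 1 < (N + i) * L := fun q hq => by
      have : (q + 1) * L ≤ (N + i) * L := Nat.mul_le_mul_right _ hq
      rw [add_mul, one_mul] at this
      omega
    have hf' := hf _ heN
    have hb1 := hb _ heN
    have hst1 := hst _ heN
    have hN0 : N ≠ 0 := by omega
    simp [progLeaf, block, wp, setV, k2, k3, k20, k25, k7, k8, k9, k10, hi, hev i hb', hf', hN0,
      d1, d2, d3, d4, d5, b25]
    refine ⟨by omega, by omega, ⟨by omega, fun q hq1 hq2 => ?_⟩, by omega⟩
    have hq3 : q < N + i ∨ q = N + i := by omega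
    rcases hq3 with hlt | rfl
    · obtain ⟨t1, t2, t3, t4, t5⟩ := hI q hq1 hlt
      have g1 : evAt H u q ≠ evAt H u (N + i) := fun h =>
        hlt.ne (hinj _ _ hq1 (by omega) (by omega) (by omega) h)
      have g2 := hdd q hlt
      have g3 : q * L ≠ (N + i) * L := by omega
      have g4 : q * L ≠ (N + i) * L + 1 := by omega
      have g5 : q * L + 1 ≠ (N + i) * L := by omega
      unfold pts at t4 t5
      simp only [ne_eq, ite_not] at t3
      refine ⟨by rw [if_neg g1, t1], by rw [if_neg hlt.ne, t2], by rw [if_neg hlt.ne, t3], ?_, ?_⟩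
      · simp only [pts, setReal_reals, setWord_reals, g3, g4, and_false, if_false, t4]
      · simp only [pts, setReal_reals, setWord_reals, add_left_inj, g3, g5, and_false, if_false, t5]
    · unfold pts at hb1 hst1 ⊢
      rw [← hb1, ← hst1]
      simp
  · rintro τ' hF' ⟨⟨hle, hI⟩, hb⟩
    have e2 : τ'.words 2 0 = N := by rw [hF'.1 2 (by decide), hF.1 2 (by decide), h2]
    simp only [teval_wlt, weval_V, e2, not_lt] at hb
    exact hfin τ' fun q hq hq' => hI q hq (by omega)

end RealRAM

theorem getElem_steps (l : List (ℝ × ℝ)) (i : ℕ) (h : i + 1 < l.length)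
    (h' : i < (steps l).length) : (steps l)[i] = l[i + 1] - l[i] := by
  induction l generalizing i with
  | nil => simp at h
  | cons a l ih =>
    cases l with
    | nil => simp at h
    | cons b l =>
      cases i with
      | zero => rfl
      | succ i => exact ih i (by simpa using h) (by simpa [steps] using h')

theorem evPartner_lt {H e : ℕ} (he : e < 2 ^ (H + 1)) : evPartner H e < 2 ^ (H + 1) := by
  unfold evPartner
  rw [pow_succ] at *
  split_ifs <;> omega

namespace RealRAM

/-! ### The side chains of a node -/

/-- The data of the events and of the mergesort trees are stored. -/
structure TreeData (H : ℕ) (u : ℕ → ℝ) (w : ℕ → ℝ × ℝ) (σ : State) : Prop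
    extends EventData H u w σ where
  leaf : ∀ e < 2 ^ (H + 1), σ.words 24 e = leafOf H u e
  sorted : NodesSorted 21 H (evSlopeLe H w) (evAt H u) 1 σ

theorem TreeData.frame {H : ℕ} {u : ℕ → ℝ} {w : ℕ → ℝ × ℝ} {σ τ : State} (h : TreeData H u w σ)
    {p : Program} (hF : Frame p σ τ)
    (hw : (1 ∉ p.wmods ∧ 2 ∉ p.wmods ∧ 3 ∉ p.wmods ∧ 23 ∉ p.wmods ∧ 25 ∉ p.wmods) ∧
      21 ∉ p.wmods ∧ 22 ∉ p.wmods ∧ 24 ∉ p.wmods)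
    (hr : 5 ∉ p.rmods ∧ 6 ∉ p.rmods ∧ 7 ∉ p.rmods ∧ 8 ∉ p.rmods ∧ 9 ∉ p.rmods ∧ 10 ∉ p.rmods) :
    TreeData H u w τ := by
  obtain ⟨hw, w21, w22, w24⟩ := hw
  refine ⟨h.toEventData.frame hF hw hr, ?_, ?_⟩
  · rw [hF.1 24 w24]; exact h.leaf
  · unfold NodesSorted
    rw [hF.1 21 w21, hF.1 22 w22]; exact h.sorted

/-- Add an event with its partner outside of the given range to the events of a side chain. -/
def progOpen : Program :=
  .ite (.or (.wlt (.get 24 (.get 23 (V 8))) (V 11)) (.not (.wlt (.get 24 (.get 23 (V 8))) (V 12))))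
    (block [setR 15 (R 15 + .get 7 (V 8)), setR 16 (R 16 + .get 8 (V 8)), .wset 26 (V 15) (V 8),
      setV 15 (V 15 + .get 25 (V 8))]) .skip

/-- Add the weight of an event to the shift of a side chain. -/
def progShift : Program :=
  .ite (.not (.wlt (V 8) (V 13)))
    (.seq (setR 15 (R 15 + .get 5 (V 8))) (setR 16 (R 16 + .get 6 (V 8)))) .skip

/-- Determine the events and the shift of a side chain. -/
def progFilter : Program := .seq (block [setV 5 (.const 0), setV 15 (.const 0),
  setR 15 (.get 11 (V 9 * V 3)), setR 16 (.get 12 (V 9 * V 3))])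
  (.loop (.wlt (V 5) (.get 22 (V 10))) (block [setV 8 (.get 21 (V 10 * V 2 + V 5)),
    progOpen, progShift, setV 5 (V 5 + .const 1)]))

/-- The open events of a list with nonvertical segments. -/
noncomputable def stepEvents (H : ℕ) (u : ℕ → ℝ) (w : ℕ → ℝ × ℝ) (l : List ℕ) (s t : ℕ) : List ℕ :=
  (openEvents H u l s t).filter fun e => decide ((evWeight H w e).1 ≠ 0)

/-- The start of a side chain. -/
noncomputable def sideStart (H : ℕ) (u : ℕ → ℝ) (w : ℕ → ℝ × ℝ) (p : ℝ × ℝ) (l : List ℕ)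
    (s t g : ℕ) : ℝ × ℝ :=
  p + (((openEvents H u l s t).map fun e => segBase (evWeight H w e)).sum +
      ((l.filter fun e => decide (g ≤ e)).map (evWeight H w)).sum)

theorem stepEvents_snoc (H : ℕ) (u : ℕ → ℝ) (w : ℕ → ℝ × ℝ) (l : List ℕ) (e s t : ℕ) :
    stepEvents H u w (l ++ [e]) s t = if (leafOf H u (evPartner H e) < s ∨
      t ≤ leafOf H u (evPartner H e)) ∧ (evWeight H w e).1 ≠ 0 then stepEvents H u w l s t ++ [e]
      else stepEvents H u w l s t := by
  unfold stepEvents openEvents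
  split_ifs with h
  · simp [h]
  · rw [List.filter_append, List.filter_append]
    simp only [not_and, not_not] at h
    by_cases h' : leafOf H u (evPartner H e) < s ∨ t ≤ leafOf H u (evPartner H e)
    · simp [h', h h']
    · simp [h']

theorem sideStart_snoc (H : ℕ) (u : ℕ → ℝ) (w : ℕ → ℝ × ℝ) (p : ℝ × ℝ) (l : List ℕ)
    (e s t g : ℕ) : sideStart H u w p (l ++ [e]) s t g = sideStart H u w p l s t g +
      (if leafOf H u (evPartner H e) < s ∨ t ≤ leafOf H u (evPartner H e) then
        segBase (evWeight H w e) else 0) + if g ≤ e then evWeight H w e else 0 := by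
  unfold sideStart openEvents
  rw [List.filter_append, List.filter_append, List.map_append, List.map_append, List.sum_append,
    List.sum_append]
  by_cases h : leafOf H u (evPartner H e) < s ∨ t ≤ leafOf H u (evPartner H e) <;>
  by_cases h' : g ≤ e <;> simp [h, h'] <;> abel

/-- One pass over the sorted events accumulates the start of the side chain and collects the events
that contribute steps, already ordered by slope. -/
theorem progFilter_spec {B H h c b s t g : ℕ} {u : ℕ → ℝ} {w : ℕ → ℝ × ℝ} {σ : State}
    (hd : TreeData H u w σ) (hB : 2 * 2 ^ (H + 1) < B) (hb : IsNode H h b)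
    (h9 : σ.words 9 0 = c) (h10 : σ.words 10 0 = b) (h11 : σ.words 11 0 = s)
    (h12 : σ.words 12 0 = t) (h13 : σ.words 13 0 = g) :
    Tri B progFilter σ (progFilter.maxCost * (2 ^ h + 1)) fun τ =>
      pts τ 15 0 = sideStart H u w (pts σ 11 (c * (2 * 2 ^ (H + 1) * 2 ^ (H + 1))))
        (slopeTree H u w h b) s t g ∧
      arr (τ.words 26) 0 (stepEvents H u w (slopeTree H u w h b) s t).length =
        stepEvents H u w (slopeTree H u w h b) s t ∧
      τ.words 15 0 = (stepEvents H u w (slopeTree H u w h b) s t).length := by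
  have hlt : ∀ e ∈ slopeTree H u w h b, e < 2 ^ (H + 1) :=
    hb.treeSort_lt fun q _ => evAt_lt H u q
  obtain ⟨hl, h22⟩ := hd.sorted h b (Nat.one_le_iff_ne_zero.2 hb.1) hb
  have hlen := length_treeSort (evSlopeLe H w) (evAt H u) h b
  rw [arr_eq_iff hlen] at hl
  change (slopeTree H u w h b).length = _ at hlen
  change ∀ i (h_1 : i < (slopeTree H u w h b).length), _ = (slopeTree H u w h b)[i] at hl
  have hle := hb.pow_le
  set l := slopeTree H u w h b
  set N := 2 ^ (H + 1) with hN
  set p₀ := pts σ 11 (c * (2 * N * N)) with hp₀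
  have i1 : Tri B (block [setV 5 (.const 0), setV 15 (.const 0),
    setR 15 (.get 11 (V 9 * V 3)), setR 16 (.get 12 (V 9 * V 3))]) σ _ fun τ =>
      τ.words 5 0 = 0 ∧ τ.words 15 0 = 0 ∧ pts τ 15 0 = p₀ := Tri.of_wp' (2 ^ h) (by
    have := hd.sizes.2.2
    simp [block, wp, setV, setR, pts, h9, this, hp₀, ← hN]; omega)
  refine i1.seq' fun τ hF ⟨z5, z15, zp⟩ => (Tri.while
    (fun τ => τ.words 5 0 ≤ 2 ^ h ∧ pts τ 15 0 = sideStart H u w p₀ (l.take (τ.words 5 0)) s t g ∧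
      arr (τ.words 26) 0 (stepEvents H u w (l.take (τ.words 5 0)) s t).length =
        stepEvents H u w (l.take (τ.words 5 0)) s t ∧
      τ.words 15 0 = (stepEvents H u w (l.take (τ.words 5 0)) s t).length)
    (fun τ => 2 ^ h - τ.words 5 0) (by
      rw [z5, z15, zp]; simp [sideStart, openEvents, stepEvents]) ?_).mono
      (by rw [z5, Nat.sub_zero]) ?_
  · rintro τ' hF' ⟨hi, hp, h26, h15⟩ hb'
    have hd' := (hd.frame hF (by decide) (by decide)).frame hF' (by decide) (by decide)
    have k2 : τ'.words 2 0 = N := hd'.sizes.2.1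
    have k9 : τ'.words 9 0 = c := by rw [hF'.1 9 (by decide), hF.1 9 (by decide), h9]
    have k10 : τ'.words 10 0 = b := by rw [hF'.1 10 (by decide), hF.1 10 (by decide), h10]
    have k11 : τ'.words 11 0 = s := by rw [hF'.1 11 (by decide), hF.1 11 (by decide), h11]
    have k12 : τ'.words 12 0 = t := by rw [hF'.1 12 (by decide), hF.1 12 (by decide), h12]
    have k13 : τ'.words 13 0 = g := by rw [hF'.1 13 (by decide), hF.1 13 (by decide), h13]
    have k21 : τ'.words 21 = σ.words 21 := by rw [hF'.1 21 (by decide), hF.1 21 (by decide)]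
    have k22 : τ'.words 22 = σ.words 22 := by rw [hF'.1 22 (by decide), hF.1 22 (by decide)]
    simp only [teval_wlt, weval_V, weval_get, k10, k22, h22] at hb'
    generalize hii : τ'.words 5 0 = i at *
    have hil : i < l.length := by omega
    have he : l[i] < N := hlt _ (List.getElem_mem hil)
    have htake : l.take (i + 1) = l.take i ++ [l[i]] := List.take_succ_eq_append_getElem hil
    have hcnt : (stepEvents H u w (l.take i) s t).length ≤ i := by
      refine ((List.length_filter_le _ _).trans (List.length_filter_le _ _)).trans ?_
      rw [List.length_take]; omega
    generalize hee : l[i] = e at *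
    generalize hcc : (stepEvents H u w (l.take i) s t).length = cnt at *
    have a1 : wp B (setV 8 (.get 21 (V 10 * V 2 + V 5))) (fun ρ => ρ.words 8 0 = e) τ' := by
      simp [wp, setV, k10, k2, k21, hii, hl i hil, hee]; omega
    refine wp_seq a1 fun τ₁ F₁ e8 => ?_
    have d1 := hd'.frame F₁ (by decide) (by decide)
    have l11 : τ₁.words 11 0 = s := by rw [F₁.1 11 (by decide), k11]
    have l12 : τ₁.words 12 0 = t := by rw [F₁.1 12 (by decide), k12]
    have l15 : τ₁.words 15 0 = cnt := by rw [F₁.1 15 (by decide), h15]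
    have b1 := d1.base e he
    have b2 := d1.flag e he
    have b3 := d1.leaf _ (evPartner_lt he)
    have a2 : wp B progOpen (fun ρ =>
        (pts ρ 15 0 = pts τ' 15 0 + if leafOf H u (evPartner H e) < s ∨
          t ≤ leafOf H u (evPartner H e) then segBase (evWeight H w e) else 0) ∧
        arr (ρ.words 26) 0 (stepEvents H u w (l.take i ++ [e]) s t).length =
          stepEvents H u w (l.take i ++ [e]) s t ∧
        ρ.words 15 0 = (stepEvents H u w (l.take i ++ [e]) s t).length) τ₁ := by
      rw [stepEvents_snoc]
      have l26 : τ₁.words 26 = τ'.words 26 := by rw [F₁.1 26 (by decide)]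
      have lr15 : τ₁.reals 15 = τ'.reals 15 := by rw [F₁.2 15 (by decide)]
      have lr16 : τ₁.reals 16 = τ'.reals 16 := by rw [F₁.2 16 (by decide)]
      have lp := d1.partner e he
      have q0 : 0 < B := by omega
      have q1 : cnt < B := by omega
      have q2 : e < B := by omega
      have q3 : cnt + 1 < B := by omega
      by_cases ho : leafOf H u (evPartner H e) < s ∨ t ≤ leafOf H u (evPartner H e)
      · by_cases hv : (evWeight H w e).1 = 0
        -- A vertical segment is written to array 26 without advancing the counter, so the valid
        -- prefix is unchanged and the entry may be overwritten later.
        · simp [progOpen, block, wp, setV, setR, e8, l11, l12, l15, lp, b2, b3, ho, hv, pts, l26,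
            lr15, lr16, q0, q1, q2, hcc, ← b1]
          rw [← h26]
          exact arr_congr fun y hy => by simp; rw [if_neg (by omega), l26]
        · simp [progOpen, block, wp, setV, setR, e8, l11, l12, l15, lp, b2, b3, ho, hv, pts, l26,
            lr15, lr16, q0, q1, q2, q3, hcc, ← b1]
          rw [arr_snoc (f := τ'.words 26) (x := e) (by intro y; simp [l26]), h26]
      · simp [progOpen, wp, e8, l11, l12, l15, lp, b3, ho, pts, l26, lr15, lr16, h26, hcc]
    refine wp_seq a2 fun τ₂ F₂ ⟨f1, f2, f3⟩ => ?_
    have d2 := d1.frame F₂ (by decide) (by decide)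
    have m8 : τ₂.words 8 0 = e := by rw [F₂.1 8 (by decide), e8]
    have m13 : τ₂.words 13 0 = g := by rw [F₂.1 13 (by decide), F₁.1 13 (by decide), k13]
    have b4 := d2.weight e he
    have a3 : wp B progShift (fun ρ => pts ρ 15 0 = pts τ₂ 15 0 + if g ≤ e then evWeight H w e else 0)
        τ₂ := by
      by_cases hg : g ≤ e
      · simp [progShift, wp, setR, m8, m13, hg, pts, ← b4]; omega
      · simp [progShift, wp, m8, m13, hg]
    refine wp_seq a3 fun τ₃ F₃ f4 => ?_
    have m5 : τ₃.words 5 0 = i := by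
      rw [F₃.1 5 (by decide), F₂.1 5 (by decide), F₁.1 5 (by decide), hii]
    have m15 : τ₃.words 15 = τ₂.words 15 := F₃.1 15 (by decide)
    have m26 : τ₃.words 26 = τ₂.words 26 := F₃.1 26 (by decide)
    have hfin : pts τ₃ 15 0 = sideStart H u w p₀ (l.take (i + 1)) s t g := by
      rw [htake, sideStart_snoc, f4, f1, hp]
    rw [← htake] at f2 f3
    simp only [block, wp, setV, weval_const, weval_add, weval_V, m5, setWord_words]
    refine ⟨by omega, by omega, ⟨?_, ?_, ?_, ?_⟩, ?_⟩
    · simp; omega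
    · simp only [and_self, if_true]
      exact hfin
    · simp only [and_self, if_true]
      exact (arr_congr fun y _ => by simp [m26]).trans f2
    · simp [m15, f3]
    · simp; omega
  · rintro τ' hF' ⟨⟨hi, hp, h26, h15⟩, hb'⟩
    have k10 : τ'.words 10 0 = b := by rw [hF'.1 10 (by decide), hF.1 10 (by decide), h10]
    have k22 : τ'.words 22 = σ.words 22 := by rw [hF'.1 22 (by decide), hF.1 22 (by decide)]
    simp only [teval_wlt, weval_V, weval_get, k10, k22, h22, not_lt] at hb'
    rw [List.take_of_length_le (by omega)] at hp h26 h15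
    exact ⟨hp, h26, h15⟩

end RealRAM

/-! ### Merging steps into a side chain -/

namespace RealRAM

theorem wp_ite_true {B : ℕ} {b : Test} {p q : Program} {σ : State} {Q : State → Prop}
    (hb : b.eval σ) (h : wp B p Q σ) : wp B (.ite b p q) Q σ := ⟨fun _ => h, fun h' => absurd hb h'⟩

theorem wp_ite_false {B : ℕ} {b : Test} {p q : Program} {σ : State} {Q : State → Prop}
    (hb : ¬ b.eval σ) (h : wp B q Q σ) : wp B (.ite b p q) Q σ := ⟨fun h' => absurd h' hb, fun _ => h⟩

/-- Go to the next point of a side chain. -/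
def progAdvance : Program :=
  .ite (.and (.wlt (V 5) (.get 27 (V 9) - .const 1)) (.or (.not (.wlt (V 6) (V 15)))
      (.not (.rlt (R 22 * .get 9 (.get 26 (V 6))) (.get 10 (.get 26 (V 6)) * R 21)))))
    (block [setR 15 (R 15 + R 21), setR 16 (R 16 + R 22), setV 5 (V 5 + .const 1)])
    (block [setR 15 (R 15 + .get 9 (.get 26 (V 6))), setR 16 (R 16 + .get 10 (.get 26 (V 6))),
      setV 6 (V 6 + .const 1)])

/-- The current step of the given chain. -/
def progDiff : Program := .seq
  (setR 21 (.get 11 (V 9 * V 3 + V 5 + .const 1) - .get 11 (V 9 * V 3 + V 5)))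
  (setR 22 (.get 12 (V 9 * V 3 + V 5 + .const 1) - .get 12 (V 9 * V 3 + V 5)))

/-- Append a point to a side chain. -/
def progEmit : Program := block [setV 7 (V 7 + .const 1), .rset 13 (V 14 + V 7) (R 15),
  .rset 14 (V 14 + V 7) (R 16)]

/-- One step of the computation of a side chain. -/
def progPathStep : Program := .seq progDiff (.seq progAdvance progEmit)

/-- Compute a side chain from its start and its events. -/
def progPath : Program := .seq (block [setV 5 (.const 0), setV 6 (.const 0), setV 7 (.const 0),
    .rset 13 (V 14) (R 15), .rset 14 (V 14) (R 16)])
  (.loop (.wlt (V 7) (.get 27 (V 9) - .const 1 + V 15)) progPathStep)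

/-- The steps of the old chain are differences computed on the fly, those of the segments are looked
up. The invariant is that of a merge, with the current point equal to the last point written. -/
theorem progPath_spec {B L c ob : ℕ} {C : List (ℝ × ℝ)} {F : List ℕ} {f : ℕ → ℝ × ℝ} {σ : State}
    (hC : C ≠ []) (hC' : ∀ z ∈ steps C, 0 < z.1) (hf : ∀ e ∈ F, 0 < (f e).1 ∧ pts σ 9 e = f e)
    (hB : ob + C.length + F.length < B) (h3 : σ.words 3 0 = L) (h9 : σ.words 9 0 = c)
    (h14 : σ.words 14 0 = ob) (h15 : σ.words 15 0 = F.length) (h27 : σ.words 27 c = C.length)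
    (hCs : arr (pts σ 11) (c * L) C.length = C) (hFs : arr (σ.words 26) 0 F.length = F) :
    Tri B progPath σ (progPath.maxCost * (C.length + F.length + 1)) fun τ =>
      arr (pts τ 13) ob (C.length + F.length) =
        walk (pts σ 15 0) ((steps C).merge (F.map f) slopeLe) ∧
      τ.words 7 0 + 1 = C.length + F.length ∧ ∀ x < ob, pts τ 13 x = pts σ 13 x := by
  rw [arr_eq_iff rfl] at hCs hFs
  have hC0 : 0 < C.length := List.length_pos_iff.2 hC
  have hS : (steps C).length = C.length - 1 := length_steps C
  set p₀ := pts σ 15 0 with hp₀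
  have i1 : Tri B (block [setV 5 (.const 0), setV 6 (.const 0), setV 7 (.const 0),
    .rset 13 (V 14) (R 15), .rset 14 (V 14) (R 16)]) σ _ fun τ => τ.words 5 0 = 0 ∧
      τ.words 6 0 = 0 ∧ τ.words 7 0 = 0 ∧ (pts τ 13 ob = p₀ ∧ pts τ 15 0 = p₀) ∧
      ∀ x < ob, pts τ 13 x = pts σ 13 x := Tri.of_wp' (C.length + F.length) (by
    simp [block, wp, setV, pts, h14, hp₀]
    exact ⟨by omega, by omega, fun x hx => ⟨fun h => by omega, fun h => by omega⟩⟩)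
  refine i1.seq' fun τ hF ⟨z5, z6, z7, ⟨zp, zr⟩, zx⟩ => (Tri.while
    (fun τ => ∃ i j, τ.words 5 0 = i ∧ τ.words 6 0 = j ∧ τ.words 7 0 = i + j ∧
      i + 1 ≤ C.length ∧ j ≤ F.length ∧ pts τ 13 (ob + (i + j)) = pts τ 15 0 ∧
      arr (pts τ 13) ob (i + j) ++ walk (pts τ 15 0)
        (((steps C).drop i).merge ((F.map f).drop j) slopeLe) =
        walk p₀ ((steps C).merge (F.map f) slopeLe) ∧ ∀ x < ob, pts τ 13 x = pts σ 13 x)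
    (fun τ => C.length + F.length - τ.words 7 0) ⟨0, 0, z5, z6, z7, by omega, by omega,
      by rw [zr]; exact zp, by simp [zr], zx⟩ ?_).mono
      (by rw [z7, Nat.sub_zero]) ?_
  · rintro τ' hF' ⟨i, j, h5, h6, h7, hi, hj, hp, hw, hx⟩ hb
    have k3 : τ'.words 3 0 = L := by rw [hF'.1 3 (by decide), hF.1 3 (by decide), h3]
    have k9 : τ'.words 9 0 = c := by rw [hF'.1 9 (by decide), hF.1 9 (by decide), h9]
    have k14 : τ'.words 14 0 = ob := by rw [hF'.1 14 (by decide), hF.1 14 (by decide), h14]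
    have k15 : τ'.words 15 0 = F.length := by rw [hF'.1 15 (by decide), hF.1 15 (by decide), h15]
    have k26 : τ'.words 26 = σ.words 26 := by rw [hF'.1 26 (by decide), hF.1 26 (by decide)]
    have k27 : τ'.words 27 = σ.words 27 := by rw [hF'.1 27 (by decide), hF.1 27 (by decide)]
    have k9' : τ'.reals 9 = σ.reals 9 := by rw [hF'.2 9 (by decide), hF.2 9 (by decide)]
    have k10 : τ'.reals 10 = σ.reals 10 := by rw [hF'.2 10 (by decide), hF.2 10 (by decide)]
    have k11 : τ'.reals 11 = σ.reals 11 := by rw [hF'.2 11 (by decide), hF.2 11 (by decide)]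
    have k12 : τ'.reals 12 = σ.reals 12 := by rw [hF'.2 12 (by decide), hF.2 12 (by decide)]
    simp only [teval_wlt, weval_V, weval_get, weval_add, weval_sub, weval_const, k9, k15, k27, h27,
      h7] at hb
    -- Past the end of the chain the difference is meaningless; the claim is conditional, and the
    -- test in `progAdvance` then never prefers it.
    have a1 : wp B progDiff (fun ρ => ∀ h : i < (steps C).length, pts ρ 21 0 = (steps C)[i]) τ' := by
      simp [progDiff, wp, setR, k9, k3, h5, pts, k11, k12]
      refine ⟨by omega, fun h => ?_⟩
      rw [getElem_steps _ _ (by omega), ← hCs i (by omega), ← hCs (i + 1) (by omega)]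
      rfl
    refine wp_seq a1 fun τ₁ F₁ hst => ?_
    have m5 : τ₁.words 5 0 = i := by rw [F₁.1 5 (by decide), h5]
    have m6 : τ₁.words 6 0 = j := by rw [F₁.1 6 (by decide), h6]
    have m9 : τ₁.words 9 0 = c := by rw [F₁.1 9 (by decide), k9]
    have m15 : τ₁.words 15 0 = F.length := by rw [F₁.1 15 (by decide), k15]
    have m26 : τ₁.words 26 = σ.words 26 := by rw [F₁.1 26 (by decide), k26]
    have m27 : τ₁.words 27 = σ.words 27 := by rw [F₁.1 27 (by decide), k27]
    have m9' : τ₁.reals 9 = σ.reals 9 := by rw [F₁.2 9 (by decide), k9']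
    have m10 : τ₁.reals 10 = σ.reals 10 := by rw [F₁.2 10 (by decide), k10]
    have m15' : τ₁.reals 15 = τ'.reals 15 := F₁.2 15 (by decide)
    have m16 : τ₁.reals 16 = τ'.reals 16 := F₁.2 16 (by decide)
    have hFj : ∀ h : j < F.length, σ.words 26 j = F[j] ∧ (F.map f)[j]'(by simpa using h) = f F[j] ∧
        0 < (f F[j]).1 ∧ σ.reals 9 F[j] = (f F[j]).1 ∧ σ.reals 10 F[j] = (f F[j]).2 := fun h => by
      have e := hFs j h
      rw [zero_add] at e
      have e' := hf F[j] (List.getElem_mem h)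
      exact ⟨e, by simp, e'.1, congrArg Prod.fst e'.2, congrArg Prod.snd e'.2⟩
    have hst' : ∀ h : i < (steps C).length, τ₁.reals 21 0 = (steps C)[i].1 ∧
        τ₁.reals 22 0 = (steps C)[i].2 := fun h =>
      ⟨congrArg Prod.fst (hst h), congrArg Prod.snd (hst h)⟩
    have a2 : wp B progAdvance (fun ρ => ∃ i' j' e, ρ.words 5 0 = i' ∧ ρ.words 6 0 = j' ∧
        i' + j' = i + j + 1 ∧ i' + 1 ≤ C.length ∧ j' ≤ F.length ∧
        pts ρ 15 0 = pts τ' 15 0 + e ∧ ((steps C).drop i).merge ((F.map f).drop j) slopeLe =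
          e :: ((steps C).drop i').merge ((F.map f).drop j') slopeLe) τ₁ := by
      have hle : ∀ (h : i < (steps C).length) (h' : j < F.length),
          slopeLe (steps C)[i] ((F.map f)[j]'(by simpa using h')) ↔
            ¬ τ₁.reals 22 0 * (f F[j]).1 < (f F[j]).2 * τ₁.reals 21 0 := fun h h' => by
        rw [(hFj h').2.1, slopeLe_iff (hC' _ (List.getElem_mem h)) (hFj h').2.2.1, not_lt,
          (hst' h).1, (hst' h).2]
      by_cases ht : i < C.length - 1 ∧ (F.length ≤ j ∨
          ¬ τ₁.reals 22 0 * σ.reals 9 (σ.words 26 j) < σ.reals 10 (σ.words 26 j) * τ₁.reals 21 0)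
      · have hi'' : i < (steps C).length := by omega
        have hmm := merge_drop_left (le := slopeLe) (l₂ := F.map f) (j := j) hi'' fun hj' => by
          have hj'' : j < F.length := by simpa using hj'
          have := ht.2.resolve_left (by omega)
          obtain ⟨g1, -, -, g2, g3⟩ := hFj hj''
          rw [g1, g2, g3] at this
          exact (hle hi'' hj'').2 this
        have h21 := hst hi''
        have : B ≠ 0 := by omega
        refine wp_ite_true (by simpa [m5, m6, m9, m15, m26, m27, m9', m10, h27] using ht) ?_
        simp only [block, wp, setV, setR, weval_const, weval_V, weval_add, reval_add, reval_R,
          setReal_words, setWord_words, m5, m6]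
        refine ⟨by omega, by omega, by omega, by omega, i + 1, j, _, rfl, by simp, by omega, by omega, by omega,
          ?_, hmm⟩
        rw [← h21]
        simp [pts, m15', m16]
      · have hj'' : j < F.length := by
          by_contra hcon
          exact ht ⟨by omega, Or.inl (by omega)⟩
        obtain ⟨g1, g2, -, g3, g4⟩ := hFj hj''
        have hj' : j < (F.map f).length := by simpa using hj''
        have hmm := merge_drop_right (le := slopeLe) (l₁ := steps C) (i := i) hj' fun hi' hl =>
          ht ⟨by omega, Or.inr (by rw [g1, g3, g4]; exact (hle hi' hj'').1 hl)⟩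
        rw [g2] at hmm
        refine wp_ite_false (by simpa [m5, m6, m9, m15, m26, m27, m9', m10, h27] using ht) ?_
        simp only [block, wp, setV, setR, weval_const, weval_V, weval_add, weval_get, reval_add, reval_R,
          reval_get, setReal_words, setWord_words, m6, m26]
        refine ⟨by omega, by omega, by omega, by omega, i, j + 1, _, by simp [m5], rfl, by omega, by omega, by omega,
          ?_, hmm⟩
        rw [g1]
        simp [pts, m15', m16, m9', m10, g3, g4]
        rfl
    refine wp_seq a2 fun τ₂ F₂ ⟨i', j', e, n5, n6, hij, hi', hj', hr, hm⟩ => ?_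
    have n7 : τ₂.words 7 0 = i + j := by rw [F₂.1 7 (by decide), F₁.1 7 (by decide), h7]
    have n14 : τ₂.words 14 0 = ob := by rw [F₂.1 14 (by decide), F₁.1 14 (by decide), k14]
    have n13' : τ₂.reals 13 = τ'.reals 13 := by rw [F₂.2 13 (by decide), F₁.2 13 (by decide)]
    have n14' : τ₂.reals 14 = τ'.reals 14 := by rw [F₂.2 14 (by decide), F₁.2 14 (by decide)]
    have a3 : wp B progEmit (fun ρ => (ρ.words 7 0 = i + j + 1 ∧ pts ρ 15 0 = pts τ₂ 15 0) ∧
        ∀ x, pts ρ 13 x = if x = ob + (i + j + 1) then pts τ₂ 15 0 else pts τ' 13 x) τ₂ := by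
      simp [progEmit, block, wp, setV, n7, n14, pts, n13', n14']
      refine ⟨by omega, by omega, by omega, fun x => ?_⟩
      split_ifs <;> rfl
    refine wp_mono a3 fun ρ F₃ ⟨⟨o7, o15⟩, o13⟩ => ⟨⟨i', j', ?_, ?_, by omega, hi', hj', ?_, ?_, ?_⟩, ?_⟩
    · rw [F₃.1 5 (by decide), n5]
    · rw [F₃.1 6 (by decide), n6]
    · rw [o13, if_pos (by omega), o15]
    · rw [hij, arr_succ, o13, if_neg (by omega), hp, o15, hr, ← hw, hm, walk, List.append_assoc,
        List.singleton_append]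
      congr 1
      exact arr_congr fun y hy => by rw [o13, if_neg (by omega)]
    · intro x hx'
      rw [o13, if_neg (by omega), hx x hx']
    · rw [o7, h7]; omega
  · rintro τ' hF' ⟨⟨i, j, h5, h6, h7, hi, hj, hp, hw, hx⟩, hb⟩
    have k9 : τ'.words 9 0 = c := by rw [hF'.1 9 (by decide), hF.1 9 (by decide), h9]
    have k15 : τ'.words 15 0 = F.length := by rw [hF'.1 15 (by decide), hF.1 15 (by decide), h15]
    have k27 : τ'.words 27 = σ.words 27 := by rw [hF'.1 27 (by decide), hF.1 27 (by decide)]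
    simp only [teval_wlt, weval_V, weval_get, weval_add, weval_sub, weval_const, k9, k15, k27, h27,
      h7] at hb
    have e1 : i + 1 = C.length := by omega
    obtain rfl : j = F.length := by omega
    rw [List.drop_eq_nil_of_le (by omega), List.drop_eq_nil_of_le (by simp), List.merge_right, walk, ← hp,
      ← arr_succ] at hw
    exact ⟨by rw [← hw, ← e1]; congr 1; omega, by omega, hx⟩

end RealRAM

namespace RealRAM

theorem Tri.le {B T T' : ℕ} {p : Program} {σ : State} {Q : State → Prop} (h : Tri B p σ T Q)
    (hT : T ≤ T') : Tri B p σ T' Q := h.mono hT fun _ _ h => h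

/-- Compute a side chain. -/
def progSide : Program := .seq progFilter progPath

theorem sideChain_eq (H : ℕ) (u : ℕ → ℝ) (w : ℕ → ℝ × ℝ) (C : List (ℝ × ℝ)) (l : List ℕ)
    (s t g : ℕ) : sideChain H u w C l s t g = walk (sideStart H u w (C.headD 0) l s t g)
      ((steps C).merge ((stepEvents H u w l s t).map fun e => segStep (evWeight H w e)) slopeLe) :=
  rfl

/-- The last clause lets the second side chain of a node be written behind the first without
destroying it. -/
theorem progSide_spec {B H h c b s t g ob : ℕ} {u : ℕ → ℝ} {w : ℕ → ℝ × ℝ} {C : List (ℝ × ℝ)}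
    {σ : State} (hd : TreeData H u w σ) (hB : 2 * 2 ^ (H + 1) < B) (hb : IsNode H h b)
    (h9 : σ.words 9 0 = c) (h10 : σ.words 10 0 = b) (h11 : σ.words 11 0 = s)
    (h12 : σ.words 12 0 = t) (h13 : σ.words 13 0 = g) (h14 : σ.words 14 0 = ob)
    (hC : C ≠ []) (hC' : ∀ z ∈ steps C, 0 < z.1) (hB' : ob + C.length + 2 ^ h < B)
    (h27 : σ.words 27 c = C.length)
    (hCs : arr (pts σ 11) (c * (2 * 2 ^ (H + 1) * 2 ^ (H + 1))) C.length = C) :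
    Tri B progSide σ (progSide.maxCost * (C.length + 2 ^ h + 1)) fun τ =>
      arr (pts τ 13) ob (sideChain H u w C (slopeTree H u w h b) s t g).length =
        sideChain H u w C (slopeTree H u w h b) s t g ∧
      τ.words 7 0 + 1 = (sideChain H u w C (slopeTree H u w h b) s t g).length ∧
      ∀ x < ob, pts τ 13 x = pts σ 13 x := by
  have hlt : ∀ e ∈ slopeTree H u w h b, e < 2 ^ (H + 1) :=
    hb.treeSort_lt fun q _ => evAt_lt H u q
  have hlen : (slopeTree H u w h b).length = 2 ^ h := length_treeSort _ _ _ _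
  have hF : (stepEvents H u w (slopeTree H u w h b) s t).length ≤ 2 ^ h := by
    rw [← hlen]; exact (List.length_filter_le _ _).trans (List.length_filter_le _ _)
  have hlenS : (sideChain H u w C (slopeTree H u w h b) s t g).length =
      C.length + (stepEvents H u w (slopeTree H u w h b) s t).length := by
    unfold sideChain
    rw [length_addSegments _ _ hC, segSteps, List.length_map]; rfl
  have hhead : pts σ 11 (c * (2 * 2 ^ (H + 1) * 2 ^ (H + 1))) = C.headD 0 := by
    cases C with
    | nil => exact absurd rfl hC
    | cons a C => exact (arr_eq_iff rfl).1 hCs 0 (by simp)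
  rw [hlenS, sideChain_eq, ← hhead]
  refine ((progFilter_spec hd hB hb h9 h10 h11 h12 h13).le ?_).seq' fun τ hFr ⟨q1, q2, q3⟩ =>
    ((progPath_spec (f := fun e => segStep (evWeight H w e)) hC hC' ?_ (by omega) (hd.frame hFr
      (by decide) (by decide)).sizes.2.2 ((congrFun (hFr.1 9 (by decide)) 0).trans h9)
      ((congrFun (hFr.1 14 (by decide)) 0).trans h14) q3 ((congrFun (hFr.1 27 (by decide)) c).trans h27)
      ?_ q2).le ?_).mono le_rfl fun ρ _ ⟨r1, r2, r3⟩ => ⟨?_, r2, fun x hx => ?_⟩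
  · exact Nat.mul_le_mul_left _ (by omega)
  · intro e he
    have he' : e ∈ slopeTree H u w h b := List.mem_of_mem_filter (List.mem_of_mem_filter he)
    exact ⟨segStep_pos _, (hd.frame hFr (by decide) (by decide)).step e (hlt e he')⟩
  · refine Eq.trans (arr_congr fun i _ => ?_) hCs
    unfold pts
    rw [hFr.2 11 (by decide), hFr.2 12 (by decide)]
  · exact Nat.mul_le_mul_left _ (by omega)
  · rw [r1, q1]
  · rw [r3 x hx]
    unfold pts
    rw [hFr.2 13 (by decide), hFr.2 14 (by decide)]

end RealRAM

/-! ### Sizes of the stack in the hull scan -/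

theorem length_popStack_le (p : ℝ × ℝ) (s : List (ℝ × ℝ)) : (popStack p s).length ≤ s.length := by
  induction s with
  | nil => simp [popStack]
  | cons b s ih =>
    cases s with
    | nil => simp [popStack]
    | cons a s =>
      unfold popStack
      split_ifs
      · exact ih.trans (by simp)
      · simp

theorem popStack_cons_cons (p a b : ℝ × ℝ) (s : List (ℝ × ℝ)) : popStack p (b :: a :: s) =
    if 0 ≤ orientation a b p then popStack p (a :: s) else b :: a :: s := by
  rw [popStack]

/-- The empty stack and a top with another abscissa are treated alike, as in the single branch of
the program. -/
theorem pushStack_eq_pop (p : ℝ × ℝ) (s : List (ℝ × ℝ)) (h : ∀ b ∈ s.head?, b.1 ≠ p.1) :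
    pushStack s p = p :: popStack p s := by
  cases s with
  | nil => simp [pushStack, popStack]
  | cons b s => simp [pushStack, h b (by simp)]

theorem length_pushStack_le (p : ℝ × ℝ) (s : List (ℝ × ℝ)) :
    (pushStack s p).length ≤ s.length + 1 := by
  cases s with
  | nil => simp [pushStack]
  | cons b s =>
    simp only [pushStack]
    split_ifs
    · simp
    · simpa using length_popStack_le p (b :: s)

namespace RealRAM

/-! ### The hull scan -/

/-- Pop points from the hull. -/
def progPop : Program :=
  .loop (.and (.wlt (.const 1) (V 18)) (.not (.rlt
    ((.get 11 (V 4 * V 3 + V 18 - .const 1) - .get 11 (V 4 * V 3 + V 18 - .const 2)) *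
      (R 20 - .get 12 (V 4 * V 3 + V 18 - .const 2)) -
      (.get 12 (V 4 * V 3 + V 18 - .const 1) - .get 12 (V 4 * V 3 + V 18 - .const 2)) *
      (R 19 - .get 11 (V 4 * V 3 + V 18 - .const 2)))
    (.const 0)))) (setV 18 (V 18 - .const 1))

/-- The stack is the chain region read backwards, so popping only lowers the counter. The cost is
charged to the number of removed points. -/
theorem progPop_spec {B b k : ℕ} {σ : State} (hB : k < B) (hb : σ.words 4 0 * σ.words 3 0 = b)
    (hk : σ.words 18 0 = k) :
    Tri B progPop σ (progPop.maxCost *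
        (k - (popStack (pts σ 19 0) (arr (pts σ 11) b k).reverse).length + 1)) fun τ =>
      (arr (pts σ 11) b (τ.words 18 0)).reverse = popStack (pts σ 19 0) (arr (pts σ 11) b k).reverse ∧
      τ.words 18 0 ≤ k := by
  set p := pts σ 19 0 with hp
  set S := popStack p (arr (pts σ 11) b k).reverse with hS
  have hrev : ∀ i, (arr (pts σ 11) b (i + 2)).reverse =
      pts σ 11 (b + i + 1) :: pts σ 11 (b + i) :: (arr (pts σ 11) b i).reverse := fun i => by
    rw [arr_succ, arr_succ, List.reverse_append, List.reverse_append]; rfl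
  refine (Tri.while (fun τ => τ.words 18 0 ≤ k ∧
    popStack p (arr (pts σ 11) b (τ.words 18 0)).reverse = S)
    (fun τ => τ.words 18 0 - S.length) (by rw [hk]; exact ⟨le_rfl, rfl⟩) ?_).mono (by rw [hk]; rfl) ?_
  all_goals
    intro τ F
    have k3 : τ.words 3 0 = σ.words 3 0 := by rw [F.1 3 (by decide)]
    have k4 : τ.words 4 0 = σ.words 4 0 := by rw [F.1 4 (by decide)]
    have kr : τ.reals = σ.reals := by
      funext a
      rw [F.2 a (by simp [setV, Program.rmods])]
  · rintro ⟨h1, h2⟩ ht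
    simp only [teval_and, teval_not, teval_wlt, teval_rlt, weval_const, weval_V, reval_get, reval_R,
      reval_mul, reval_sub, weval_add, weval_sub, weval_mul, reval_const, k3, k4, kr, hb,
      Int.cast_zero] at ht
    obtain ⟨ht1, ht2⟩ := ht
    obtain ⟨i, hi⟩ : ∃ i, τ.words 18 0 = i + 2 := ⟨τ.words 18 0 - 2, by omega⟩
    rw [hi] at h1 h2 ht2
    rw [← add_assoc b i 2, Nat.add_sub_cancel, show b + i + 2 - 1 = b + i + 1 by omega, not_lt] at ht2
    have ht3 : 0 ≤ orientation (pts σ 11 (b + i)) (pts σ 11 (b + i + 1)) p := by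
      unfold orientation
      exact ht2
    rw [hrev, popStack_cons_cons, if_pos ht3] at h2
    have e : (arr (pts σ 11) b (i + 1)).reverse =
        pts σ 11 (b + i) :: (arr (pts σ 11) b i).reverse := by
      rw [arr_succ, List.reverse_append]; rfl
    rw [← e] at h2
    have hlen : S.length ≤ i + 1 := by
      rw [← h2]
      simpa using length_popStack_le p (arr (pts σ 11) b (i + 1)).reverse
    simp [wp, setV, hi, h2]
    omega
  · rintro ⟨⟨h1, h2⟩, ht⟩
    refine ⟨?_, h1⟩
    rw [← h2]
    simp only [teval_and, teval_not, teval_wlt, teval_rlt, weval_const, weval_V, reval_get, reval_R,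
      reval_mul, reval_sub, weval_add, weval_sub, weval_mul, reval_const, k3, k4, kr, hb,
      Int.cast_zero] at ht
    rcases Nat.lt_or_ge 1 (τ.words 18 0) with h | h
    · obtain ⟨i, hi⟩ : ∃ i, τ.words 18 0 = i + 2 := ⟨τ.words 18 0 - 2, by omega⟩
      rw [hi] at ht ⊢
      rw [← add_assoc b i 2, Nat.add_sub_cancel, show b + i + 2 - 1 = b + i + 1 by omega] at ht
      rw [hrev, popStack_cons_cons, if_neg]
      intro ht3
      refine ht ⟨by omega, not_lt.2 ?_⟩
      unfold orientation at ht3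
      exact ht3
    · interval_cases τ.words 18 0
      · simp [popStack]
      · simp [arr, popStack]

/-- Process a point. -/
def progPush : Program :=
  .ite (.and (.wlt (.const 0) (V 18)) (.req (.get 11 (V 4 * V 3 + V 18 - .const 1)) (R 19))) .skip
    (.seq progPop (block [.rset 11 (V 4 * V 3 + V 18) (R 19), .rset 12 (V 4 * V 3 + V 18) (R 20),
      setV 18 (V 18 + .const 1)]))

/-- The factor is one plus the number of removed points if the point is pushed, and two if it is
discarded. Writing it through the new stack size lets the costs telescope. -/
theorem progPush_spec {B b k : ℕ} {σ : State} (hB : b + k + 1 < B)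
    (hb : σ.words 4 0 * σ.words 3 0 = b) (hk : σ.words 18 0 = k) :
    Tri B progPush σ (progPush.maxCost *
        (k + 2 - (pushStack (arr (pts σ 11) b k).reverse (pts σ 19 0)).length)) fun τ =>
      (arr (pts τ 11) b (τ.words 18 0)).reverse =
        pushStack (arr (pts σ 11) b k).reverse (pts σ 19 0) ∧
      ∀ x, x < b ∨ b + k < x → pts τ 11 x = pts σ 11 x := by
  set p := pts σ 19 0 with hp
  by_cases ht : 0 < k ∧ σ.reals 11 (b + k - 1) = σ.reals 19 0
  · have hpush : pushStack (arr (pts σ 11) b k).reverse p = (arr (pts σ 11) b k).reverse := by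
      obtain ⟨i, rfl⟩ : ∃ i, k = i + 1 := ⟨k - 1, by omega⟩
      rw [arr_succ, List.reverse_append]
      exact if_pos ht.2
    rw [hpush]
    refine (Tri.of_wp (wp_ite_true (by simpa [hb, hk] using ht) ?_)).le ?_
    · exact ⟨by rw [hk], fun _ _ => rfl⟩
    · rw [List.length_reverse, length_arr]
      exact Nat.le_mul_of_pos_right _ (by omega)
  · have hpush : pushStack (arr (pts σ 11) b k).reverse p =
        p :: popStack p (arr (pts σ 11) b k).reverse := by
      refine pushStack_eq_pop _ _ fun q hq h => ?_
      cases k with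
      | zero => simp at hq
      | succ i =>
        rw [arr_succ, List.reverse_append] at hq
        simp at hq
        exact ht ⟨by omega, by subst hq; exact h⟩
    have hle := length_popStack_le p (arr (pts σ 11) b k).reverse
    rw [List.length_reverse, length_arr] at hle
    rw [hpush, List.length_cons,
      show k + 2 - ((popStack p (arr (pts σ 11) b k).reverse).length + 1) =
        k - (popStack p (arr (pts σ 11) b k).reverse).length + 1 by omega]
    have a1 := (progPop_spec (by omega) hb hk).seq' (B := B)
      (q := block [.rset 11 (V 4 * V 3 + V 18) (R 19), .rset 12 (V 4 * V 3 + V 18) (R 20),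
      setV 18 (V 18 + .const 1)]) (Q := fun τ => (arr (pts τ 11) b (τ.words 18 0)).reverse =
        p :: popStack p (arr (pts σ 11) b k).reverse ∧
      ∀ x, x < b ∨ b + k < x → pts τ 11 x = pts σ 11 x) fun τ F ⟨q1, q2⟩ => Tri.of_wp' _ ?_
    · refine (Tri.ite (T₁ := 0) (fun h => absurd (by simpa [hb, hk] using h) ht) fun _ => a1).le ?_
      change _ ≤ (_ + 1 + 1 + (Program.seq progPop _).maxCost) * _
      rw [zero_add, add_mul]
      exact Nat.add_le_add_right ((Nat.le_add_right _ _).trans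
        (Nat.le_mul_of_pos_right _ (Nat.succ_pos _))) _
    · have k3 : τ.words 4 0 * τ.words 3 0 = b := by rw [F.1 3 (by decide), F.1 4 (by decide), hb]
      have kr : τ.reals = σ.reals := by
        funext a
        rw [F.2 a (by simp [progPop, setV, Program.rmods])]
      generalize hk' : τ.words 18 0 = k' at *
      simp [block, wp, setV, k3, kr, hk']
      refine ⟨by omega, by omega, by omega, ?_, fun x hx => ?_⟩
      · rw [arr_snoc (f := pts σ 11) (x := p), ← q1, List.reverse_reverse]
        · intro y
          simp only [pts, setReal_reals, setWord_reals, kr, hp]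
          split_ifs <;> simp_all
      · have h' : x ≠ b + k' := by omega
        simp [pts, h', kr]

/-- Take the next point of the two side chains. -/
def progPick : Program :=
  .ite (.and (.wlt (V 5) (V 16)) (.or (.not (.wlt (V 6) (V 17)))
      (.or (.rlt (.get 13 (V 5)) (.get 13 (V 3 + V 6)))
        (.and (.req (.get 13 (V 5)) (.get 13 (V 3 + V 6)))
          (.not (.rlt (.get 14 (V 5)) (.get 14 (V 3 + V 6))))))))
    (block [setR 19 (.get 13 (V 5)), setR 20 (.get 14 (V 5)), setV 5 (V 5 + .const 1)])
    (block [setR 19 (.get 13 (V 3 + V 6)), setR 20 (.get 14 (V 3 + V 6)), setV 6 (V 6 + .const 1)])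

/-- Compute the upper hull of the two side chains. -/
def progScan : Program := .seq (block [setV 5 (.const 0), setV 6 (.const 0), setV 18 (.const 0)])
  (.seq (.loop (.wlt (V 5 + V 6) (V 16 + V 17)) (.seq progPick progPush)) (.wset 27 (V 4) (V 18)))

/-- The next point of the lexicographic merge is taken without storing the merged list; the second
chain starts at offset `L`. -/
theorem progPick_spec {B L i j : ℕ} {l₁ l₂ : List (ℝ × ℝ)} {σ : State} (h3 : σ.words 3 0 = L)
    (hl₁ : arr (pts σ 13) 0 l₁.length = l₁) (hl₂ : arr (pts σ 13) L l₂.length = l₂)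
    (h16 : σ.words 16 0 = l₁.length) (h17 : σ.words 17 0 = l₂.length) (h5 : σ.words 5 0 = i)
    (h6 : σ.words 6 0 = j) (hi : i ≤ l₁.length) (hj : j ≤ l₂.length)
    (hij : i + j < l₁.length + l₂.length) (hB : l₁.length + l₂.length < B) :
    wp B progPick (fun τ => ∃ i' j', τ.words 5 0 = i' ∧ τ.words 6 0 = j' ∧ i' ≤ l₁.length ∧
      j' ≤ l₂.length ∧ i' + j' = i + j + 1 ∧ (l₁.drop i).merge (l₂.drop j) lexLe =
        pts τ 19 0 :: (l₁.drop i').merge (l₂.drop j') lexLe) σ := by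
  rw [arr_eq_iff rfl] at hl₁ hl₂
  have hle : ∀ (h : i < l₁.length) (h' : j < l₂.length), lexLe l₁[i] l₂[j] ↔
      (σ.reals 13 i < σ.reals 13 (L + j) ∨
        σ.reals 13 i = σ.reals 13 (L + j) ∧ ¬ σ.reals 14 i < σ.reals 14 (L + j)) := fun h h' => by
    rw [← hl₁ i h, ← hl₂ j h', zero_add, not_lt]
    rw [lexLe, decide_eq_true_eq]
    rfl
  by_cases ht : i < l₁.length ∧ (l₂.length ≤ j ∨ (σ.reals 13 i < σ.reals 13 (L + j) ∨
        σ.reals 13 i = σ.reals 13 (L + j) ∧ ¬ σ.reals 14 i < σ.reals 14 (L + j)))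
  · have hmm := merge_drop_left (le := lexLe) (l₂ := l₂) (j := j) ht.1 fun hj' =>
      (hle ht.1 hj').2 (ht.2.resolve_left (by omega))
    refine wp_ite_true (by simpa [h3, h5, h6, h16, h17] using ht) ?_
    rw [hmm, ← hl₁ i ht.1]
    simp only [block, wp, setV, setR, weval_const, weval_V, weval_add, reval_get,
      setReal_words, setWord_words, h5, h6]
    refine ⟨by omega, by omega, by omega, by omega, i + 1, j, rfl, by simp, by omega, by omega, by omega, ?_⟩
    simp [pts]
  · have hj' : j < l₂.length := by
      by_contra hcon
      exact ht ⟨by omega, Or.inl (by omega)⟩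
    have hmm := merge_drop_right (le := lexLe) (l₁ := l₁) (i := i) hj' fun hi' hl =>
      ht ⟨hi', Or.inr ((hle hi' hj').1 hl)⟩
    refine wp_ite_false (by simpa [h3, h5, h6, h16, h17] using ht) ?_
    rw [hmm, ← hl₂ j hj']
    simp only [block, wp, setV, setR, weval_const, weval_V, weval_add, reval_get,
      setReal_words, setWord_words, h3, h6]
    refine ⟨by omega, by omega, by omega, by omega, i, j + 1, by simp [h5], rfl, by omega, by omega, by omega, ?_⟩
    simp [pts]

/-- A single point may cause many removals, but every point is removed at most once. So the total
cost is linear in the lengths of the two side chains. -/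
theorem progScan_spec {B L v : ℕ} {l₁ l₂ : List (ℝ × ℝ)} {σ : State} (h3 : σ.words 3 0 = L)
    (h4 : σ.words 4 0 = v)
    (hl₁ : arr (pts σ 13) 0 l₁.length = l₁) (hl₂ : arr (pts σ 13) L l₂.length = l₂)
    (h16 : σ.words 16 0 = l₁.length) (h17 : σ.words 17 0 = l₂.length)
    (hB : v * L + l₁.length + l₂.length < B) (hvB : v < B) :
    Tri B progScan σ (progScan.maxCost * (2 * (l₁.length + l₂.length) + 1)) fun τ =>
      arr (pts τ 11) (v * L) (scanHull (l₁.merge l₂ lexLe)).length = scanHull (l₁.merge l₂ lexLe) ∧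
      (∀ y, τ.words 27 y = if y = v then (scanHull (l₁.merge l₂ lexLe)).length else σ.words 27 y) ∧
      ∀ x, x < v * L ∨ v * L + (l₁.length + l₂.length) ≤ x → pts τ 11 x = pts σ 11 x := by
  set M := l₁.length + l₂.length with hM
  have i1 : Tri B (block [setV 5 (.const 0), setV 6 (.const 0), setV 18 (.const 0)]) σ _ fun τ =>
      τ.words 5 0 = 0 ∧ τ.words 6 0 = 0 ∧ τ.words 18 0 = 0 := Tri.of_wp' (2 * M) (by
    simp [block, wp, setV]; omega)
  refine i1.seq' fun τ F ⟨z5, z6, z18⟩ => Tri.seq' (P := fun τ =>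
      arr (pts τ 11) (v * L) (τ.words 18 0) = scanHull (l₁.merge l₂ lexLe) ∧ τ.words 18 0 ≤ M ∧
      ∀ x, x < v * L ∨ v * L + M ≤ x → pts τ 11 x = pts σ 11 x) ?_ fun ρ F' ⟨q1, q2, q3⟩ => ?_
  · set b : Test := .wlt (V 5 + V 6) (V 16 + V 17) with hb
    set K := (Program.loop b (.seq progPick progPush)).maxCost with hK
    have hK' : K = progPick.maxCost + progPush.maxCost + b.cost + 1 := rfl
    -- In the potential an unread point counts twice and a stack point once, so each point pays in
    -- advance for its arrival and for its later removal.
    refine (Tri.loop (fun τ => ∃ i j k, τ.words 5 0 = i ∧ τ.words 6 0 = j ∧ τ.words 18 0 = k ∧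
      i ≤ l₁.length ∧ j ≤ l₂.length ∧ k ≤ i + j ∧
      ((l₁.drop i).merge (l₂.drop j) lexLe).foldl pushStack (arr (pts τ 11) (v * L) k).reverse =
        (l₁.merge l₂ lexLe).foldl pushStack [] ∧
      ∀ x, x < v * L ∨ v * L + (i + j) ≤ x → pts τ 11 x = pts σ 11 x)
      (fun τ => K * (2 * (M - (τ.words 5 0 + τ.words 6 0)) + τ.words 18 0))
      ⟨0, 0, 0, z5, z6, z18, by omega, by omega, by omega, by simp, fun x _ => ?_⟩ ?_).mono ?_ ?_
    · unfold pts
      rw [F.2 11 (by decide), F.2 12 (by decide)]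
    · rintro τ' F' ⟨i, j, k, h5, h6, h18, hi, hj, hk, hfold, hx⟩ ht
      have k3 : τ'.words 3 0 = L := by rw [F'.1 3 (by decide), F.1 3 (by decide), h3]
      have k4 : τ'.words 4 0 = v := by rw [F'.1 4 (by decide), F.1 4 (by decide), h4]
      have k16 : τ'.words 16 0 = l₁.length := by rw [F'.1 16 (by decide), F.1 16 (by decide), h16]
      have k17 : τ'.words 17 0 = l₂.length := by rw [F'.1 17 (by decide), F.1 17 (by decide), h17]
      have kM : pts τ' 13 = pts σ 13 := by
        unfold pts
        rw [F'.2 13 (by decide), F'.2 14 (by decide), F.2 13 (by decide), F.2 14 (by decide)]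
      simp only [hb, teval_wlt, weval_add, weval_V, h5, h6, k16, k17] at ht
      have a1 := progPick_spec (B := B) k3 (by rw [kM, hl₁]) (by rw [kM, hl₂]) k16 k17 h5 h6 hi hj ht
        (by omega)
      set S := (arr (pts τ' 11) (v * L) k).reverse with hS
      set p := (((l₁.drop i).merge (l₂.drop j) lexLe).headD 0) with hp
      have hpl := length_pushStack_le p S
      rw [hS, List.length_reverse, length_arr, ← hS] at hpl
      refine ⟨progPick.maxCost + progPush.maxCost * (k + 2 - (pushStack S p).length),
        (Tri.of_wp a1).seq fun τ₁ F₁ ⟨i', j', g5, g6, hi', hj', hij, hm⟩ => ?_⟩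
      have e1 : pts τ₁ 19 0 = p := by rw [hp, hm]; rfl
      have e2 : pts τ₁ 11 = pts τ' 11 := by
        unfold pts
        rw [F₁.2 11 (by decide), F₁.2 12 (by decide)]
      have a2 := progPush_spec (B := B) (b := v * L) (k := k) (σ := τ₁) (by omega)
          (by rw [F₁.1 3 (by decide), F₁.1 4 (by decide), k3, k4]) (by rw [F₁.1 18 (by decide), h18])
      rw [e1, e2, ← hS] at a2
      refine a2.mono le_rfl fun ρ F₂ ⟨q1, q2⟩ => ?_
      have e3 : ρ.words 18 0 = (pushStack S p).length := by
        rw [← q1, List.length_reverse, length_arr]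
      refine ⟨⟨i', j', _, by rw [F₂.1 5 (by decide), g5], by rw [F₂.1 6 (by decide), g6], rfl, hi', hj',
        by omega, ?_, fun x hx' => ?_⟩, ?_⟩
      · rw [← hfold, hm, e1, List.foldl_cons, q1]
      · rw [q2 x (by omega), hx x (by omega)]
      · rw [F₂.1 5 (by decide), g5, F₂.1 6 (by decide), g6, e3, h5, h6, h18, hij]
        -- The drop of the potential is exactly the factor in `progPush_spec`. It is at least one,
        -- so it also pays for picking the point and for the loop test.
        have e4 : 2 * (M - (i + j)) + k = 2 * (M - (i + j + 1)) + (pushStack S p).length +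
          (k + 2 - (pushStack S p).length) := by omega
        have e5 : 1 ≤ k + 2 - (pushStack S p).length := by omega
        rw [e4]
        generalize k + 2 - (pushStack S p).length = d at e5 ⊢
        rw [mul_add K _ d]
        have e6 : K * d = progPush.maxCost * d + (progPick.maxCost + b.cost + 1) * d := by
          rw [hK']; ring
        have e7 := Nat.le_mul_of_pos_right (progPick.maxCost + b.cost + 1) e5
        omega
    · rw [z5, z6, z18, add_zero, add_zero, Nat.sub_zero, mul_add_one K]
      omega
    · rintro τ' F' ⟨⟨i, j, k, h5, h6, h18, hi, hj, hk, hfold, hx⟩, ht⟩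
      have k16 : τ'.words 16 0 = l₁.length := by rw [F'.1 16 (by decide), F.1 16 (by decide), h16]
      have k17 : τ'.words 17 0 = l₂.length := by rw [F'.1 17 (by decide), F.1 17 (by decide), h17]
      simp only [hb, teval_wlt, weval_add, weval_V, h5, h6, k16, k17] at ht
      rw [List.drop_eq_nil_of_le (by omega), List.drop_eq_nil_of_le (by omega), List.merge_right,
        List.foldl_nil] at hfold
      refine ⟨?_, by omega, fun x hx' => hx x (by omega)⟩
      rw [scanHull, ← hfold, List.reverse_reverse, h18]
  · have k4 : ρ.words 4 0 = v := by rw [F'.1 4 (by decide), F.1 4 (by decide), h4]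
    have k27 : ρ.words 27 = σ.words 27 := by rw [F'.1 27 (by decide), F.1 27 (by decide)]
    refine Tri.of_wp' (2 * M) ?_
    have hlen : (scanHull (l₁.merge l₂ lexLe)).length = ρ.words 18 0 := by rw [← q1, length_arr]
    have b1 : ρ.words 18 0 < B := by omega
    rw [hlen]
    simp [wp, k4, k27, hvB, b1]
    exact ⟨q1, fun x hx => q3 x (by omega)⟩

end RealRAM

/-! ### From the chains of the children to the chain of a node -/

namespace RealRAM

/-- The parameters of the first side chain of a node. -/
def progLeft : Program := block [setV 4 (V 4 - .const 1), setV 9 (.const 2 * V 4),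
  setV 10 (.const 2 * V 4 + .const 1), setV 11 (V 4 * .get 22 (V 4)), setV 12 (.const 2 * V 2),
  setV 13 (V 2), setV 14 (.const 0)]

/-- The parameters of the second side chain of a node. -/
def progRight : Program := block [setV 16 (V 7 + .const 1), setV 9 (.const 2 * V 4 + .const 1),
  setV 10 (.const 2 * V 4), setV 11 (.const 0), setV 12 ((V 4 + .const 1) * .get 22 (V 4)),
  setV 13 (V 1), setV 14 (V 3)]

/-- Compute the chain of a node from the chains of its children. -/
def progNode : Program := .seq progLeft (.seq progSide (.seq progRight (.seq progSide
  (.seq (setV 17 (V 7 + .const 1)) progScan))))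

/-- Compute all chains. -/
def progCombine : Program := .seq (setV 4 (V 2)) (.loop (.wlt (.const 1) (V 4)) progNode)

/-- Both side chains together have at most `2 ^ (j + 1) * (H + 3)` points, which makes the node cost
its block size times a logarithm. -/
theorem progNode_spec {B H j v : ℕ} {u : ℕ → ℝ} {w : ℕ → ℝ × ℝ} {σ : State} (hd : TreeData H u w σ)
    (hB : 2 * 2 ^ (H + 1) * (2 * 2 ^ (H + 1) * 2 ^ (H + 1)) ≤ B) (h4 : σ.words 4 0 = v + 1)
    (hv : v < 2 ^ (H + 1)) (hn : IsNode H (j + 1) v) (n1 : IsNode H j (2 * v))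
    (n2 : IsNode H j (2 * v + 1)) (hI : NodesChained H u w (v + 1) σ) :
    Tri B progNode σ (progNode.maxCost * ((2 * H + 7) * 2 ^ (j + 1))) fun τ =>
      τ.words 4 0 = v ∧ NodesChained H u w v τ := by
  obtain ⟨-, ⟨c1, c1', -⟩, l1⟩ := upperTree_spec H u w j (2 * v) n1.le n1.lt
  obtain ⟨-, ⟨c2, c2', -⟩, l2⟩ := upperTree_spec H u w j (2 * v + 1) n2.le n2.lt
  have hv0 := hn.1
  obtain ⟨s1, s1'⟩ := hI j (2 * v) (by omega) n1
  obtain ⟨s2, s2'⟩ := hI j (2 * v + 1) (by omega) n2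
  have h22 : σ.words 22 v = 2 ^ (j + 1) := (hd.sorted (j + 1) v (by omega) hn).2
  have hdef : upperTree H u w (j + 1) v = scanHull
      ((sideChain H u w (upperTree H u w j (2 * v)) (slopeTree H u w j (2 * v + 1))
        (v * 2 ^ (j + 1)) (2 * 2 ^ (H + 1)) (2 ^ (H + 1))).merge
      (sideChain H u w (upperTree H u w j (2 * v + 1)) (slopeTree H u w j (2 * v))
        0 ((v + 1) * 2 ^ (j + 1)) (2 ^ H)) lexLe) := rfl
  have m1 := length_sideChain_le H u w c1 (slopeTree H u w j (2 * v + 1)) (v * 2 ^ (j + 1))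
    (2 * 2 ^ (H + 1)) (2 ^ (H + 1))
  have m2 := length_sideChain_le H u w c2 (slopeTree H u w j (2 * v)) 0 ((v + 1) * 2 ^ (j + 1)) (2 ^ H)
  rw [show (slopeTree H u w j (2 * v + 1)).length = 2 ^ j from length_treeSort _ _ _ _] at m1
  rw [show (slopeTree H u w j (2 * v)).length = 2 ^ j from length_treeSort _ _ _ _] at m2
  set S₁ := sideChain H u w (upperTree H u w j (2 * v)) (slopeTree H u w j (2 * v + 1))
        (v * 2 ^ (j + 1)) (2 * 2 ^ (H + 1)) (2 ^ (H + 1)) with hS₁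
  set S₂ := sideChain H u w (upperTree H u w j (2 * v + 1)) (slopeTree H u w j (2 * v))
        0 ((v + 1) * 2 ^ (j + 1)) (2 ^ H) with hS₂
  have hj : j + 1 ≤ H + 1 := by have := hn.2; omega
  have hs : 2 ^ (j + 1) ≤ 2 ^ (H + 1) := hn.pow_le
  have hH : H + 3 ≤ 2 * 2 ^ (H + 1) := by
    have := Nat.lt_two_pow_self (n := H + 2)
    rw [pow_succ] at this
    omega
  have hH1 : 2 ^ H ≤ 2 ^ (H + 1) := Nat.pow_le_pow_right (by norm_num) (Nat.le_succ H)
  have hjs : 2 ^ (j + 1) = 2 * 2 ^ j := pow_succ' 2 j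
  have hs0 : 1 ≤ 2 ^ j := Nat.one_le_two_pow
  have hsum : S₁.length + S₂.length ≤ 2 ^ (j + 1) * (H + 3) := by
    calc _ ≤ 2 * (2 ^ j * (j + 2) + 2 ^ j) := by omega
      _ = 2 ^ (j + 1) * (j + 3) := by rw [hjs]; ring
      _ ≤ _ := Nat.mul_le_mul_left _ (by omega)
  -- The scan uses two units for each point of the side chains; the additional one is absorbed by
  -- raising `2 H + 6` to `2 H + 7`.
  have hcost : 2 * (2 ^ (j + 1) * (H + 3)) + 1 ≤ (2 * H + 7) * 2 ^ (j + 1) := by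
    calc _ ≤ 2 * (2 ^ (j + 1) * (H + 3)) + 2 ^ (j + 1) := by omega
      _ = _ := by ring
  have hside : 2 * (2 ^ j * (j + 2) + 2 ^ j) ≤ 2 ^ (j + 1) * (H + 3) := by
    calc _ = 2 ^ (j + 1) * (j + 3) := by rw [hjs]; ring
      _ ≤ _ := Nat.mul_le_mul_left _ (by omega)
  -- This explains the region length `2 N²` with `N = 2 ^ (H + 1)`: it is generous, but needs no
  -- logarithm and keeps addresses polynomial.
  have hsumL : 2 ^ (j + 1) * (H + 3) ≤ 2 * 2 ^ (H + 1) * 2 ^ (H + 1) := by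
    calc _ ≤ 2 ^ (H + 1) * (2 * 2 ^ (H + 1)) := Nat.mul_le_mul hs hH
      _ = _ := by ring
  have hvN : (v + 1) * 2 ^ (j + 1) ≤ 2 * 2 ^ (H + 1) := hn.lt
  have hvN' : v * 2 ^ (j + 1) ≤ 2 * 2 ^ (H + 1) :=
    (Nat.mul_le_mul_right _ (Nat.le_succ v)).trans hvN
  have h1 : σ.words 1 0 = 2 ^ H := hd.sizes.1
  have h2 : σ.words 2 0 = 2 ^ (H + 1) := hd.sizes.2.1
  have h3 : σ.words 3 0 = 2 * 2 ^ (H + 1) * 2 ^ (H + 1) := hd.sizes.2.2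
  have hLB : 2 * (2 * 2 ^ (H + 1) * 2 ^ (H + 1)) ≤ 2 * 2 ^ (H + 1) * (2 * 2 ^ (H + 1) * 2 ^ (H + 1)) :=
    Nat.mul_le_mul_right _ (by omega)
  have hvL : (v + 1) * (2 * 2 ^ (H + 1) * 2 ^ (H + 1)) + 2 * 2 ^ (H + 1) * 2 ^ (H + 1) ≤
      2 * 2 ^ (H + 1) * (2 * 2 ^ (H + 1) * 2 ^ (H + 1)) := by
    calc _ = (v + 2) * (2 * 2 ^ (H + 1) * 2 ^ (H + 1)) := by ring
      _ ≤ _ := Nat.mul_le_mul_right _ (by omega)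
  have hL2 : 2 * 2 ^ (H + 1) ≤ 2 * 2 ^ (H + 1) * 2 ^ (H + 1) := Nat.le_mul_of_pos_right _ (by positivity)
  have hL4 : 4 ≤ 2 * 2 ^ (H + 1) := by rw [pow_succ]; have := Nat.one_le_two_pow (n := H); omega
  have hcost' : 1 ≤ (2 * H + 7) * 2 ^ (j + 1) := by omega
  obtain ⟨X, hX⟩ : ∃ X, (2 * H + 7) * 2 ^ (j + 1) = X + 1 := ⟨_, (Nat.sub_add_cancel hcost').symm⟩
  have a1 : Tri B progLeft σ (progLeft.maxCost * ((2 * H + 7) * 2 ^ (j + 1))) fun τ =>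
      τ.words 4 0 = v ∧ τ.words 9 0 = 2 * v ∧ τ.words 10 0 = 2 * v + 1 ∧
      τ.words 11 0 = v * 2 ^ (j + 1) ∧ τ.words 12 0 = 2 * 2 ^ (H + 1) ∧
      τ.words 13 0 = 2 ^ (H + 1) ∧ τ.words 14 0 = 0 := by
    rw [hX]
    refine Tri.of_wp' X ?_
    simp only [progLeft, block, wp, setV, weval_const, weval_V, weval_add, weval_mul, weval_sub,
      weval_get, setWord_words, h4, h2]
    simp [h22]
    omega
  refine a1.seq' fun τ₁ F₁ ⟨e4, e9, e10, e11, e12, e13, e14⟩ => ?_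
  have d1 := hd.frame F₁ (by decide) (by decide)
  have p1 : pts τ₁ 11 = pts σ 11 := by unfold pts; rw [F₁.2 11 (by decide), F₁.2 12 (by decide)]
  have w1 : τ₁.words 27 = σ.words 27 := F₁.1 27 (by decide)
  refine ((progSide_spec d1 (by omega) n2 e9 e10 e11 e12 e13 e14 c1 c1' (by omega)
    (by rw [w1, s1']) (by rw [p1, s1])).le (Nat.mul_le_mul_left _ (by omega))).seq'
    fun τ₂ F₂ ⟨q1, q2, _⟩ => ?_
  have d2 := d1.frame F₂ (by decide) (by decide)
  have p2 : pts τ₂ 11 = pts σ 11 := by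
    rw [← p1]; unfold pts; rw [F₂.2 11 (by decide), F₂.2 12 (by decide)]
  have w2 : τ₂.words 27 = σ.words 27 := by rw [F₂.1 27 (by decide), w1]
  have f4 : τ₂.words 4 0 = v := by rw [F₂.1 4 (by decide), e4]
  have f22 : τ₂.words 22 v = 2 ^ (j + 1) := by rw [F₂.1 22 (by decide), F₁.1 22 (by decide), h22]
  rw [← hS₁] at q1 q2
  have a2 : Tri B progRight τ₂ (progRight.maxCost * ((2 * H + 7) * 2 ^ (j + 1))) fun τ =>
      τ.words 16 0 = S₁.length ∧ τ.words 9 0 = 2 * v + 1 ∧ τ.words 10 0 = 2 * v ∧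
      τ.words 11 0 = 0 ∧ τ.words 12 0 = (v + 1) * 2 ^ (j + 1) ∧
      τ.words 13 0 = 2 ^ H ∧ τ.words 14 0 = 2 * 2 ^ (H + 1) * 2 ^ (H + 1) := by
    rw [hX]
    refine Tri.of_wp' X ?_
    have g1 := d2.sizes.1
    have g3 := d2.sizes.2.2
    simp only [progRight, block, wp, setV, weval_const, weval_V, weval_add, weval_mul,
      weval_get, setWord_words, f4, q2]
    simp [f22, g1, g3]
    omega
  refine a2.seq' fun τ₃ F₃ ⟨g16, g9, g10, g11, g12, g13, g14⟩ => ?_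
  have d3 := d2.frame F₃ (by decide) (by decide)
  have p3 : pts τ₃ 11 = pts σ 11 := by
    rw [← p2]; unfold pts; rw [F₃.2 11 (by decide), F₃.2 12 (by decide)]
  have p3' : pts τ₃ 13 = pts τ₂ 13 := by
    unfold pts; rw [F₃.2 13 (by decide), F₃.2 14 (by decide)]
  have w3 : τ₃.words 27 = σ.words 27 := by rw [F₃.1 27 (by decide), w2]
  refine ((progSide_spec d3 (by omega) n1 g9 g10 g11 g12 g13 g14 c2 c2' (by omega)
    (by rw [w3, s2']) (by rw [p3, s2])).le (Nat.mul_le_mul_left _ (by omega))).seq'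
    fun τ₄ F₄ ⟨r1, r2, r3⟩ => ?_
  have p4 : pts τ₄ 11 = pts σ 11 := by
    rw [← p3]; unfold pts; rw [F₄.2 11 (by decide), F₄.2 12 (by decide)]
  have w4 : τ₄.words 27 = σ.words 27 := by rw [F₄.1 27 (by decide), w3]
  rw [← hS₂] at r1 r2
  have a3 : Tri B (setV 17 (V 7 + .const 1)) τ₄
      ((setV 17 (V 7 + .const 1)).maxCost * ((2 * H + 7) * 2 ^ (j + 1))) fun τ =>
      τ.words 17 0 = S₂.length := by
    rw [hX]
    refine Tri.of_wp' X ?_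
    simp only [wp, setV, weval_const, weval_V, weval_add, setWord_words, r2]
    simp
    omega
  refine a3.seq' fun τ₅ F₅ t17 => ?_
  have d5 := (d3.frame F₄ (by decide) (by decide)).frame F₅ (by decide) (by decide)
  have p5 : pts τ₅ 11 = pts σ 11 := by
    rw [← p4]; unfold pts; rw [F₅.2 11 (by decide), F₅.2 12 (by decide)]
  have p5' : pts τ₅ 13 = pts τ₄ 13 := by
    unfold pts; rw [F₅.2 13 (by decide), F₅.2 14 (by decide)]
  have w5 : τ₅.words 27 = σ.words 27 := by rw [F₅.1 27 (by decide), w4]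
  have t4 : τ₅.words 4 0 = v := by
    rw [F₅.1 4 (by decide), F₄.1 4 (by decide), F₃.1 4 (by decide), f4]
  have t16 : τ₅.words 16 0 = S₁.length := by rw [F₅.1 16 (by decide), F₄.1 16 (by decide), g16]
  -- The first side chain fits into the cells before offset `L`, which the second computation leaves
  -- alone.
  have o1 : arr (pts τ₅ 13) 0 S₁.length = S₁ := by
    rw [p5']
    refine Eq.trans (arr_congr fun i hi => ?_) q1
    rw [r3 _ (by omega), p3']
  refine ((progScan_spec d5.sizes.2.2 t4 o1 (by rw [p5', r1]) t16 t17 (by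
    rw [add_mul, one_mul] at hvL; omega) (by omega)).le (Nat.mul_le_mul_left _ (by omega))).mono le_rfl
    fun ρ F₆ ⟨x1, x2, x3⟩ => ⟨by rw [F₆.1 4 (by decide), t4], fun h v' hv' hn' => ?_⟩
  rcases hv'.eq_or_lt with rfl | hlt
  · obtain rfl := hn.unique hn'
    rw [hdef, x2, if_pos rfl]
    exact ⟨x1, rfl⟩
  -- Nodes with larger numbers own regions further to the right, so their chains are untouched.
  · obtain ⟨y1, y2⟩ := hI h v' hlt hn'
    rw [x2, if_neg (by omega), w5]
    refine ⟨?_, y2⟩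
    refine Eq.trans (arr_congr fun i hi => ?_) y1
    have : (v + 1) * (2 * 2 ^ (H + 1) * 2 ^ (H + 1)) ≤ v' * (2 * 2 ^ (H + 1) * 2 ^ (H + 1)) :=
      Nat.mul_le_mul_right _ hlt
    rw [add_mul, one_mul] at this
    rw [x3 _ (Or.inr (by omega)), p5]

theorem progCombine_spec {B H : ℕ} {u : ℕ → ℝ} {w : ℕ → ℝ × ℝ} {σ : State} (hd : TreeData H u w σ)
    (hB : 2 * 2 ^ (H + 1) * (2 * 2 ^ (H + 1) * 2 ^ (H + 1)) ≤ B)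
    (hI : NodesChained H u w (2 ^ (H + 1)) σ) :
    Tri B progCombine σ (progCombine.maxCost * ((2 * H + 7) * nodeSum H (2 ^ (H + 1)) + 1))
      (NodesChained H u w 1) := by
  have h2 : σ.words 2 0 = 2 ^ (H + 1) := hd.sizes.2.1
  have hpos : 0 < 2 ^ (H + 1) := by positivity
  have hL : 2 * 2 ^ (H + 1) ≤ 2 * 2 ^ (H + 1) * (2 * 2 ^ (H + 1) * 2 ^ (H + 1)) :=
    Nat.le_mul_of_pos_right _ (by positivity)
  have a1 : Tri B (setV 4 (V 2)) σ _ fun τ => τ.words 4 0 = 2 ^ (H + 1) :=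
    Tri.of_wp' ((2 * H + 7) * nodeSum H (2 ^ (H + 1))) (by simp [wp, setV, h2]; omega)
  refine a1.seq' fun τ₁ F₁ h4 => Tri.nodeLoop (NodesChained H u w) (by omega) h4 ?_ ?_
  · intro h v hv hn
    have := hI h v hv hn
    unfold pts at this ⊢
    rwa [F₁.2 11 (by decide), F₁.2 12 (by decide), F₁.1 27 (by decide)]
  · intro τ v k F hτ hv hn hI'
    obtain ⟨j, rfl, n1, n2⟩ := hn.children hv
    exact progNode_spec ((hd.frame F₁ (by decide) (by decide)).frame F (by decide) (by decide)) hB hτ hv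
      hn n1 n2 hI'

end RealRAM

namespace RealRAM

/-! ### The main program -/

/-- The comparison of events by time. -/
def keyCmp (e f : WExpr) : Test :=
  .or (.rlt (.get 4 e) (.get 4 f)) (.and (.req (.get 4 e) (.get 4 f)) (.not (.wlt f e)))

/-- The comparison of events by slope. -/
def slopeCmp (e f : WExpr) : Test :=
  .not (.rlt (.get 10 e * .get 9 f) (.get 10 f * .get 9 e))

/-- Compute the upper chain of the root. -/
def progChain : Program := .seq progEvents (.seq (progSort 20 keyCmp) (.seq progLeaves
  (.seq (progSort 21 slopeCmp) progCombine)))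

/-- The number of operations, up to a constant factor. -/
def timeBound (H : ℕ) : ℕ := (2 * H + 8) * ((H + 1) * 2 ^ (H + 1)) + 1

theorem mul_add_one_le_timeBound {H c : ℕ} (hc : c ≤ (2 * H + 8) * (H + 1)) :
    c * 2 ^ (H + 1) + 1 ≤ timeBound H := by
  unfold timeBound
  rw [← mul_assoc]
  exact Nat.add_le_add_right (Nat.mul_le_mul_right _ hc) 1

/-- Sorting costs the total block size of the inner nodes and combining costs a logarithm more;
`timeBound` dominates each phase, so the phases share one factor. -/
theorem progChain_spec {B H : ℕ} {u : ℕ → ℝ} {w : ℕ → ℝ × ℝ} {σ : State} (hs : Sizes H σ)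
    (hB : 2 * 2 ^ (H + 1) * (2 * 2 ^ (H + 1) * 2 ^ (H + 1)) ≤ B) (hu : σ.reals 0 = u)
    (hx : ∀ i, σ.reals 1 i = (w i).1) (hy : ∀ i, σ.reals 3 0 * σ.reals 2 i = (w i).2) :
    Tri B progChain σ (progChain.maxCost * timeBound H) fun τ =>
      arr (pts τ 11) (τ.words 3 0) (rootChain H u w).length = rootChain H u w ∧
      τ.words 27 1 = (rootChain H u w).length := by
  have hsum : nodeSum H (2 ^ (H + 1)) = (H + 1) * 2 ^ (H + 1) := nodeSum_pow H (H + 1) le_rfl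
  have t1 : 2 ^ (H + 1) + 1 ≤ timeBound H := by
    have := mul_add_one_le_timeBound (H := H) (c := 1) (Nat.mul_pos (by omega) (by omega))
    rwa [one_mul] at this
  have t2 : 2 * nodeSum H (2 ^ (H + 1)) + 1 ≤ timeBound H := by
    rw [hsum, ← mul_assoc]
    exact mul_add_one_le_timeBound (Nat.mul_le_mul_right _ (by omega))
  have t3 : (2 * H + 7) * nodeSum H (2 ^ (H + 1)) + 1 ≤ timeBound H := by
    rw [hsum, ← mul_assoc]
    exact mul_add_one_le_timeBound (Nat.mul_le_mul_right _ (by omega))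
  refine ((progEvents_spec hs hB hu hx hy).le (Nat.mul_le_mul_left _ t1)).seq' fun τ₁ F₁ h₁ => ?_
  have s1 : Sizes H τ₁ := by
    obtain ⟨a, b, c⟩ := hs
    exact ⟨by rw [F₁.1 1 (by decide), a], by rw [F₁.1 2 (by decide), b], by rw [F₁.1 3 (by decide), c]⟩
  have d1 : EventData H u w τ₁ := by
    refine ⟨s1, ?_, ?_, ?_, ?_, ?_⟩ <;> intro e he <;> obtain ⟨-, a1, a2, a3, a4, a5, -⟩ := h₁ e he
    exacts [a1, a2, a3, a4, a5]
  have c1 : Decides τ₁.reals (2 ^ (H + 1)) keyCmp (keyLe H u) := by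
    intro ρ hρ e f he hf
    have k1 := (h₁ _ he).1
    have k2 := (h₁ _ hf).1
    simp only [keyCmp, teval_or, teval_and, teval_not, teval_rlt, teval_req, teval_wlt, reval_get, hρ,
      k1, k2, keyLe, decide_eq_true_eq, not_lt]
  -- Before sorting, leaf `2 ^ (H + 1) + e` carries event `e`; block sizes at leaves are set once
  -- and reused by the second sort.
  have i1 : NodesSorted 20 H (keyLe H u) (fun q => q - 2 ^ (H + 1)) (2 ^ (H + 1)) τ₁ := by
    intro h v hv hn
    obtain rfl : h = 0 := hn.unique (isNode_zero hv hn.lt_two_mul)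
    have hlt := hn.lt_two_mul
    obtain ⟨-, -, -, -, -, -, a1, a2⟩ := h₁ (v - 2 ^ (H + 1)) (by omega)
    rw [Nat.add_sub_cancel' hv] at a1 a2
    exact ⟨by simp [arr, treeSort, a1], a2⟩
  refine ((progSort_spec (Or.inl rfl) c1 hB s1.2.1 (fun q hq => by omega) i1).le
    (Nat.mul_le_mul_left _ t2)).seq' fun τ₂ F₂ h₂ => ?_
  have d2 := d1.frame F₂ (by decide) (by decide)
  have o2 := (h₂ (H + 1) 1 le_rfl (isNode_root H)).1
  rw [one_mul] at o2
  refine ((progLeaves_spec d2 hB o2).le (Nat.mul_le_mul_left _ t1)).seq' fun τ₃ F₃ ⟨p1, p2, p3⟩ => ?_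
  have d3 := d2.frame F₃ (by decide) (by decide)
  have c3 : Decides τ₃.reals (2 ^ (H + 1)) slopeCmp (evSlopeLe H w) := by
    intro ρ hρ e f he hf
    have k1 := d3.step _ he
    have k2 := d3.step _ hf
    rw [evSlopeLe, slopeLe_iff (segStep_pos _) (segStep_pos _), ← k1, ← k2]
    simp only [slopeCmp, teval_not, teval_rlt, reval_get, reval_mul, hρ, not_lt]
    rfl
  have i3 : NodesSorted 21 H (evSlopeLe H w) (evAt H u) (2 ^ (H + 1)) τ₃ := by
    intro h v hv hn
    obtain rfl : h = 0 := hn.unique (isNode_zero hv hn.lt_two_mul)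
    refine ⟨by simp [arr, treeSort, p1 v hv hn.lt_two_mul], ?_⟩
    rw [F₃.1 22 (by decide)]
    exact (h₂ 0 v (Nat.one_le_iff_ne_zero.2 hn.1) hn).2
  refine ((progSort_spec (Or.inr rfl) c3 hB d3.sizes.2.1 (fun q _ => evAt_lt H u q) i3).le
    (Nat.mul_le_mul_left _ t2)).seq' fun τ₄ F₄ h₄ => ?_
  have d4 : TreeData H u w τ₄ := ⟨d3.frame F₄ (by decide) (by decide), by
    rw [F₄.1 24 (by decide)]; exact p2, h₄⟩
  have p4 : NodesChained H u w (2 ^ (H + 1)) τ₄ := by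
    unfold NodesChained pts at p3 ⊢
    rw [F₄.2 11 (by decide), F₄.2 12 (by decide), F₄.1 27 (by decide)]
    exact p3
  refine ((progCombine_spec d4 hB p4).le (Nat.mul_le_mul_left _ t3)).mono le_rfl fun τ F h => ?_
  rw [F.1 3 (by decide), d4.sizes.2.2]
  have := h (H + 1) 1 le_rfl (isNode_root H)
  rwa [one_mul] at this

end RealRAM

/-! ### Assembling both chains into the output -/

namespace RealRAM

/-- Save the chain of the root, reflected at the first axis. -/
def progSave : Program := .seq (setV 5 (.const 0)) (.seq
  (.loop (.wlt (V 5) (.get 27 (.const 1))) (block [.rset 17 (V 5) (.get 11 (V 3 + V 5)),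
    .rset 18 (V 5) (.const 0 - .get 12 (V 3 + V 5)), setV 5 (V 5 + .const 1)]))
  (setV 19 (V 5)))

/-- Write the saved chain to the output. -/
def progCopy : Program := .loop (.wlt (V 5) (V 19)) (block [.rset 1 (V 5) (.get 17 (V 5)),
  .rset 2 (V 5) (.get 18 (V 5)), setV 5 (V 5 + .const 1)])

/-- Append the chain of the root in reverse order to the output, without the ends of the
saved chain. -/
def progAppend : Program := .loop (.wlt (.const 0) (V 6)) (.seq (setV 6 (V 6 - .const 1))
  (.ite (.or (.and (.req (.get 11 (V 3 + V 6)) (R 17)) (.req (.get 12 (V 3 + V 6)) (R 18)))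
      (.and (.req (.get 11 (V 3 + V 6)) (.get 17 (V 19 - .const 1)))
        (.req (.get 12 (V 3 + V 6)) (.get 18 (V 19 - .const 1))))) .skip
    (block [.rset 1 (V 5) (.get 11 (V 3 + V 6)), .rset 2 (V 5) (.get 12 (V 3 + V 6)),
      setV 5 (V 5 + .const 1)])))

/-- Write the output. -/
def progOut : Program := .seq (setV 5 (.const 0)) (.seq progCopy
  (.seq (setV 6 (.get 27 (.const 1))) (.seq progAppend (setV 0 (V 5)))))

/-- The program that constructs the polygon. -/
def progMain : Program := .seq progSize (.seq (setR 3 (.const (-1))) (.seq progChain (.seq progSave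
  (.seq (setR 3 (.const 1)) (.seq progChain progOut)))))

theorem progSave_spec {B L : ℕ} {D : List (ℝ × ℝ)} {σ : State} (h3 : σ.words 3 0 = L)
    (h27 : σ.words 27 1 = D.length) (hD : arr (pts σ 11) L D.length = D) (hB : D.length < B) :
    Tri B progSave σ (progSave.maxCost * (D.length + 1)) fun τ =>
      arr (pts τ 17) 0 D.length = D.map reflectY ∧ τ.words 19 0 = D.length := by
  rw [arr_eq_iff rfl] at hD
  have a1 : Tri B (setV 5 (.const 0)) σ _ fun τ => τ.words 5 0 = 0 := Tri.of_wp' D.length (by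
    simp [wp, setV]; omega)
  refine a1.seq' fun τ F z5 => Tri.seq' (P := fun τ => arr (pts τ 17) 0 D.length = D.map reflectY ∧
    τ.words 5 0 = D.length) ((Tri.while (fun τ => ∃ i, τ.words 5 0 = i ∧ i ≤ D.length ∧
      arr (pts τ 17) 0 i = (D.take i).map reflectY) (fun τ => D.length - τ.words 5 0)
      ⟨0, z5, by omega, by simp⟩ ?_).mono (by rw [z5, Nat.sub_zero]) ?_) fun ρ _ ⟨q1, q2⟩ =>
      Tri.of_wp' D.length ?_
  · rintro τ' F' ⟨i, h5, hi, ha⟩ hb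
    have k3 : τ'.words 3 0 = L := by rw [F'.1 3 (by decide), F.1 3 (by decide), h3]
    have k27 : τ'.words 27 1 = D.length := by rw [F'.1 27 (by decide), F.1 27 (by decide), h27]
    have kp : pts τ' 11 = pts σ 11 := by
      unfold pts
      rw [F'.2 11 (by decide), F'.2 12 (by decide), F.2 11 (by decide), F.2 12 (by decide)]
    simp only [teval_wlt, weval_V, weval_get, weval_const, k27, h5] at hb
    have hz := hD i hb
    rw [← kp] at hz
    simp only [block, wp, setV, weval_const, weval_V, weval_add, setReal_words, setWord_words, h5]
    refine ⟨by omega, by omega, by omega, by omega, ⟨i + 1, by simp, hb, ?_⟩, by simp; omega⟩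
    rw [List.take_succ_eq_append_getElem hb, List.map_append, ← ha,
      arr_snoc (f := pts τ' 17) (x := reflectY D[i])]
    · rfl
    · intro y
      rw [← hz]
      simp only [pts, reflectY, setReal_reals, setWord_reals]
      by_cases hy : y = i <;> simp [hy, k3, h5]
  · rintro τ' F' ⟨⟨i, h5, hi, ha⟩, hb⟩
    have k27 : τ'.words 27 1 = D.length := by rw [F'.1 27 (by decide), F.1 27 (by decide), h27]
    simp only [teval_wlt, weval_V, weval_get, weval_const, k27, h5] at hb
    obtain rfl : i = D.length := by omega
    rw [List.take_length] at ha
    exact ⟨ha, h5⟩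
  · have : 0 < B := by omega
    simp [wp, setV, q2, hB, this]
    exact q1

theorem progCopy_spec {B : ℕ} {R : List (ℝ × ℝ)} {σ : State} (h5 : σ.words 5 0 = 0)
    (h19 : σ.words 19 0 = R.length) (hR : arr (pts σ 17) 0 R.length = R) (hB : R.length < B) :
    Tri B progCopy σ (progCopy.maxCost * (R.length + 1)) fun τ =>
      arr (pts τ 1) 0 R.length = R ∧ τ.words 5 0 = R.length := by
  rw [arr_eq_iff rfl] at hR
  refine (Tri.while (fun τ => ∃ i, τ.words 5 0 = i ∧ i ≤ R.length ∧
      arr (pts τ 1) 0 i = R.take i) (fun τ => R.length - τ.words 5 0)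
      ⟨0, h5, by omega, by simp⟩ ?_).mono (by rw [h5, Nat.sub_zero]; rfl) ?_
  · rintro τ' F' ⟨i, h5, hi, ha⟩ hb
    have k19 : τ'.words 19 0 = R.length := by rw [F'.1 19 (by decide), h19]
    have kp : pts τ' 17 = pts σ 17 := by
      unfold pts
      rw [F'.2 17 (by decide), F'.2 18 (by decide)]
    simp only [teval_wlt, weval_V, k19, h5] at hb
    have hz := hR i hb
    rw [← kp, zero_add] at hz
    simp only [block, wp, setV, weval_const, weval_V, weval_add, setReal_words, setWord_words, h5]
    refine ⟨by omega, by omega, by omega, by omega, ⟨i + 1, by simp, hb, ?_⟩, by simp; omega⟩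
    rw [List.take_succ_eq_append_getElem hb, ← ha, arr_snoc (f := pts τ' 1) (x := R[i])]
    intro y
    rw [← hz]
    simp only [pts, setReal_reals, setWord_reals]
    by_cases hy : y = i <;> simp [hy, h5]
  · rintro τ' F' ⟨⟨i, h5, hi, ha⟩, hb⟩
    have k19 : τ'.words 19 0 = R.length := by rw [F'.1 19 (by decide), h19]
    simp only [teval_wlt, weval_V, k19, h5] at hb
    obtain rfl : i = R.length := by omega
    rw [List.take_length] at ha
    exact ⟨ha, h5⟩

/-- The test of equality with one of two points. -/
noncomputable def isEnd (a b p : ℝ × ℝ) : Bool := open Classical in decide (p = a ∨ p = b)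

/-- The invariant splits the answer into the points already written and the filtered part of the
chain still to be read from its right end. -/
theorem progAppend_spec {B L : ℕ} {a b : ℝ × ℝ} {R U : List (ℝ × ℝ)} {σ : State}
    (h3 : σ.words 3 0 = L) (h5 : σ.words 5 0 = R.length) (h6 : σ.words 6 0 = U.length)
    (hR : arr (pts σ 1) 0 R.length = R) (ha : pts σ 17 0 = a)
    (hb : pts σ 17 (σ.words 19 0 - 1) = b) (hU : arr (pts σ 11) L U.length = U)
    (hB : R.length + U.length < B) :
    Tri B progAppend σ (progAppend.maxCost * (U.length + 1)) fun τ =>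
      τ.words 5 0 < B ∧ arr (pts τ 1) 0 (τ.words 5 0) =
        R ++ U.reverse.filter fun p => ! isEnd a b p := by
  rw [arr_eq_iff rfl] at hU
  refine (Tri.while (fun τ => ∃ i k, τ.words 6 0 = i ∧ τ.words 5 0 = k ∧ i ≤ U.length ∧
      k + i ≤ R.length + U.length ∧
      arr (pts τ 1) 0 k ++ (U.take i).reverse.filter (fun p => ! isEnd a b p) =
        R ++ U.reverse.filter fun p => ! isEnd a b p) (fun τ => τ.words 6 0)
      ⟨U.length, R.length, h6, h5, le_rfl, le_rfl, by rw [hR, List.take_length]⟩ ?_).mono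
        (by rw [h6]; rfl) ?_
  · rintro τ' F' ⟨i, k, h6, h5, hi, hk, he⟩ ht
    have k3 : τ'.words 3 0 = L := by rw [F'.1 3 (by decide), h3]
    have k19 : τ'.words 19 0 = σ.words 19 0 := by rw [F'.1 19 (by decide)]
    have kp : pts τ' 17 = pts σ 17 := by
      unfold pts
      rw [F'.2 17 (by decide), F'.2 18 (by decide)]
    have kq : pts τ' 11 = pts σ 11 := by
      unfold pts
      rw [F'.2 11 (by decide), F'.2 12 (by decide)]
    simp only [teval_wlt, weval_V, weval_const, h6] at ht
    obtain ⟨j, rfl⟩ : ∃ j, i = j + 1 := ⟨i - 1, by omega⟩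
    have hz := hU j hi
    rw [← kq] at hz
    rw [← kp] at ha hb
    rw [← k19] at hb
    rw [List.take_succ_eq_append_getElem hi, List.reverse_append, List.reverse_singleton,
      List.singleton_append, List.filter_cons] at he
    have a1 : wp B (setV 6 (V 6 - .const 1)) (fun ρ => ρ.words 6 0 = j) τ' := by
      simp [wp, setV, h6]; omega
    refine wp_seq a1 fun τ F e6 => ?_
    have g3 : τ.words 3 0 = L := by rw [F.1 3 (by decide), k3]
    have g5 : τ.words 5 0 = k := by rw [F.1 5 (by decide), h5]
    have g19 : τ.words 19 0 = τ'.words 19 0 := by rw [F.1 19 (by decide)]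
    have gr : τ.reals = τ'.reals := by
      funext x
      rw [F.2 x (by simp [setV, Program.rmods])]
    have hiff : isEnd a b U[j] = true ↔
        (τ'.reals 11 (L + j) = τ'.reals 17 0 ∧ τ'.reals 12 (L + j) = τ'.reals 18 0) ∨
        (τ'.reals 11 (L + j) = τ'.reals 17 (τ'.words 19 0 - 1) ∧
          τ'.reals 12 (L + j) = τ'.reals 18 (τ'.words 19 0 - 1)) := by
      rw [isEnd, decide_eq_true_eq, ← hz, ← ha, ← hb]
      simp [pts]
    by_cases hc : isEnd a b U[j] = true
    · refine wp_ite_true ?_ ?_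
      · simpa [g3, g19, gr, e6] using hiff.1 hc
      · refine ⟨⟨j, k, e6, g5, by omega, by omega, ?_⟩, by omega⟩
        rw [hc] at he
        have : pts τ 1 = pts τ' 1 := by unfold pts; rw [gr]
        rw [← he, this]
        simp
    · refine wp_ite_false ?_ ?_
      · simpa [g3, g19, gr, e6] using fun h => hc (hiff.2 h)
      · simp only [block, wp, setV, weval_const, weval_V, weval_add, setReal_words, setWord_words, g5]
        refine ⟨by omega, by omega, by omega, by omega, ⟨j, k + 1, by simp [e6], by simp, by omega,
          by omega, ?_⟩, by simp; omega⟩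
        rw [Bool.not_eq_true] at hc
        rw [hc] at he
        rw [← he, arr_snoc (f := pts τ' 1) (x := U[j])]
        · simp
        · intro y
          rw [← hz]
          simp only [pts, setReal_reals, setWord_reals]
          by_cases hy : y = k <;> simp [hy, g3, gr, e6]
  · rintro τ' F' ⟨⟨i, k, h6, h5, hi, hk, he⟩, ht⟩
    simp only [teval_wlt, weval_V, weval_const, h6] at ht
    obtain rfl : i = 0 := by omega
    rw [h5]
    exact ⟨by omega, by simpa using he⟩

theorem progOut_spec {B L : ℕ} {U D : List (ℝ × ℝ)} {σ : State} (hD0 : D ≠ [])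
    (h3 : σ.words 3 0 = L) (h19 : σ.words 19 0 = D.length) (h27 : σ.words 27 1 = U.length)
    (hD : arr (pts σ 17) 0 D.length = D.map reflectY) (hU : arr (pts σ 11) L U.length = U)
    (hB : D.length + U.length < B) :
    Tri B progOut σ (progOut.maxCost * (D.length + U.length + 1)) fun τ =>
      arr (pts τ 1) 0 (τ.words 0 0) = cyclicList U D := by
  have hlen : (D.map reflectY).length = D.length := List.length_map _
  have hpos : 0 < D.length := List.length_pos_iff.2 hD0
  have ha : pts σ 17 0 = reflectY (D.headD 0) := by
    rw [arr_eq_iff hlen] at hD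
    have := hD 0 (by omega)
    rw [zero_add] at this
    rw [this, List.getElem_map]
    cases D with
    | nil => exact absurd rfl hD0
    | cons a D => rfl
  have hb : pts σ 17 (D.length - 1) = reflectY (D.getLastD 0) := by
    rw [arr_eq_iff hlen] at hD
    have := hD (D.length - 1) (by omega)
    rw [zero_add] at this
    -- The saved chain is nonempty, so the truncated index `D.length - 1` is its true last place and
    -- the defaults of `headD` and `getLastD` play no role.
    rw [this, List.getElem_map, List.getLastD_eq_getLast?, List.getLast?_eq_getElem?,
      List.getElem?_eq_getElem (by omega)]
    rfl
  have hfin : cyclicList U D = D.map reflectY ++ U.reverse.filter fun p =>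
      ! isEnd (reflectY (D.headD 0)) (reflectY (D.getLastD 0)) p := by
    unfold cyclicList
    congr 2
    funext p
    simp [isEnd]
  have a1 : Tri B (setV 5 (.const 0)) σ _ fun τ => τ.words 5 0 = 0 :=
    Tri.of_wp' (D.length + U.length) (by simp [wp, setV]; omega)
  refine a1.seq' fun τ₁ F₁ z5 => ?_
  refine ((progCopy_spec z5 (R := D.map reflectY) (by rw [F₁.1 19 (by decide), hlen, h19]) (by
    unfold pts at hD ⊢
    rw [F₁.2 17 (by decide), F₁.2 18 (by decide), hlen, hD]) (by omega)).le
    (Nat.mul_le_mul_left _ (by omega))).seq' fun τ₂ F₂ ⟨q1, q2⟩ => ?_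
  have w27 : τ₂.words 27 1 = U.length := by rw [F₂.1 27 (by decide), F₁.1 27 (by decide), h27]
  have a2 : Tri B (setV 6 (.get 27 (.const 1))) τ₂ _ fun τ => τ.words 6 0 = U.length :=
    Tri.of_wp' (D.length + U.length) (by simp [wp, setV, w27]; omega)
  refine a2.seq' fun τ₃ F₃ z6 => ?_
  have e3 : τ₃.words 3 0 = L := by
    rw [F₃.1 3 (by decide), F₂.1 3 (by decide), F₁.1 3 (by decide), h3]
  have e5 : τ₃.words 5 0 = (D.map reflectY).length := by rw [F₃.1 5 (by decide), q2]
  have e19 : τ₃.words 19 0 = D.length := by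
    rw [F₃.1 19 (by decide), F₂.1 19 (by decide), F₁.1 19 (by decide), h19]
  have p1 : pts τ₃ 1 = pts τ₂ 1 := by unfold pts; rw [F₃.2 1 (by decide), F₃.2 2 (by decide)]
  have p17 : pts τ₃ 17 = pts σ 17 := by
    unfold pts
    rw [F₃.2 17 (by decide), F₃.2 18 (by decide), F₂.2 17 (by decide), F₂.2 18 (by decide),
      F₁.2 17 (by decide), F₁.2 18 (by decide)]
  have p11 : pts τ₃ 11 = pts σ 11 := by
    unfold pts
    rw [F₃.2 11 (by decide), F₃.2 12 (by decide), F₂.2 11 (by decide), F₂.2 12 (by decide),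
      F₁.2 11 (by decide), F₁.2 12 (by decide)]
  refine ((progAppend_spec (a := reflectY (D.headD 0)) (b := reflectY (D.getLastD 0)) e3 e5 z6 (by rw [p1, q1]) (by rw [p17, ha]) (by rw [p17, e19, hb])
    (by rw [p11, hU]) (by omega)).le (Nat.mul_le_mul_left _ (by omega))).seq'
    fun τ₄ F₄ ⟨r1, r2⟩ => Tri.of_wp' _ ?_
  rw [hfin, ← r2]
  have : 0 < B := by omega
  simp [wp, setV, r1, this]
  rfl

/-- The chain computation runs twice, first with sign `-1` for the lower chain, then with sign `1`
for the upper chain. The input arrays 1 and 2 are overwritten only at the very end, so the second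
run still finds the weights. -/
theorem progMain_spec {B n : ℕ} {u : ℕ → ℝ} {w : ℕ → ℝ × ℝ} {σ : State} (hn : σ.words 0 0 = n)
    (hB : 2 * 2 ^ (Nat.clog 2 n + 1) * (2 * 2 ^ (Nat.clog 2 n + 1) * 2 ^ (Nat.clog 2 n + 1)) ≤ B)
    (hu : σ.reals 0 = u) (hx : ∀ i, σ.reals 1 i = (w i).1) (hy : ∀ i, σ.reals 2 i = (w i).2) :
    Tri B progMain σ (progMain.maxCost * timeBound (Nat.clog 2 n)) fun τ =>
      arr (pts τ 1) 0 (τ.words 0 0) = rootVertices (Nat.clog 2 n) u w := by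
  have hnH : n ≤ 2 ^ Nat.clog 2 n := Nat.le_pow_clog one_lt_two n
  set H := Nat.clog 2 n
  have t0 : (H + 3) * 2 ^ (H + 1) + 1 ≤ timeBound H :=
    mul_add_one_le_timeBound (by nlinarith)
  have t00 : 2 * (H + 3) * 2 ^ (H + 1) + 1 ≤ timeBound H :=
    mul_add_one_le_timeBound (by nlinarith)
  have hN : 2 ^ (H + 1) = 2 * 2 ^ H := pow_succ' 2 H
  have t1 : n + 1 ≤ timeBound H := by nlinarith
  -- The summand one in `timeBound` lets single assignments be charged in the form that `Tri.of_wp'`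
  -- requires.
  obtain ⟨X, hX⟩ : ∃ X, timeBound H = X + 1 := ⟨_, rfl⟩
  obtain ⟨-, ⟨hD0, -⟩, lD⟩ := rootChain_spec H u (reflectY ∘ w)
  obtain ⟨-, -, lU⟩ := rootChain_spec H u w
  have hH : H + 3 ≤ 2 * 2 ^ (H + 1) := by
    have := Nat.lt_two_pow_self (n := H + 2)
    rw [pow_succ] at this
    omega
  have hL : 2 ^ (H + 1) * (H + 3) ≤ 2 * 2 ^ (H + 1) * 2 ^ (H + 1) :=
    (Nat.mul_le_mul_left _ hH).trans (mul_comm _ _).le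
  have hL4 : 4 ≤ 2 * 2 ^ (H + 1) := by have := Nat.one_le_two_pow (n := H); omega
  have hLB : 4 * (2 * 2 ^ (H + 1) * 2 ^ (H + 1)) ≤ B := (Nat.mul_le_mul_right _ hL4).trans hB
  have hB0 : 0 < B := by
    have : 0 < 2 * 2 ^ (H + 1) * 2 ^ (H + 1) := by positivity
    omega
  refine ((progSize_spec hn hB).le (Nat.mul_le_mul_left _ t1)).seq' fun τ₁ F₁ s1 => ?_
  have a1 : Tri B (setR 3 (.const (-1))) τ₁ ((setR 3 (.const (-1))).maxCost * timeBound H)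
      fun τ => τ.reals 3 0 = -1 := by
    rw [hX]
    exact Tri.of_wp' X (by simp [wp, setR, hB0])
  refine a1.seq' fun τ₂ F₂ r2 => ?_
  have s2 : Sizes H τ₂ := by
    unfold Sizes
    rw [F₂.1 1 (by decide), F₂.1 2 (by decide), F₂.1 3 (by decide)]; exact s1
  refine (progChain_spec (u := u) (w := reflectY ∘ w) s2 hB ?_ ?_ ?_).seq' fun τ₃ F₃ ⟨q1, q2⟩ => ?_
  · rw [F₂.2 0 (by decide), F₁.2 0 (by decide), hu]
  · intro i
    rw [F₂.2 1 (by decide), F₁.2 1 (by decide), hx]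
    rfl
  · intro i
    rw [r2, F₂.2 2 (by decide), F₁.2 2 (by decide), hy]
    simp [reflectY]
  refine ((progSave_spec rfl q2 q1 (by omega)).le (Nat.mul_le_mul_left _ (by
    rw [mul_comm] at lD; omega))).seq' fun τ₄ F₄ ⟨q3, q4⟩ => ?_
  have a2 : Tri B (setR 3 (.const 1)) τ₄ ((setR 3 (.const 1)).maxCost * timeBound H)
      fun τ => τ.reals 3 0 = 1 := by
    rw [hX]
    exact Tri.of_wp' X (by simp [wp, setR, hB0])
  refine a2.seq' fun τ₅ F₅ r5 => ?_
  have s5 : Sizes H τ₅ := by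
    unfold Sizes
    rw [F₅.1 1 (by decide), F₅.1 2 (by decide), F₅.1 3 (by decide), F₄.1 1 (by decide),
      F₄.1 2 (by decide), F₄.1 3 (by decide), F₃.1 1 (by decide), F₃.1 2 (by decide),
      F₃.1 3 (by decide)]
    exact s2
  refine (progChain_spec (u := u) (w := w) s5 hB ?_ ?_ ?_).seq' fun τ₆ F₆ ⟨q5, q6⟩ => ?_
  · rw [F₅.2 0 (by decide), F₄.2 0 (by decide), F₃.2 0 (by decide), F₂.2 0 (by decide),
      F₁.2 0 (by decide), hu]
  · intro i
    rw [F₅.2 1 (by decide), F₄.2 1 (by decide), F₃.2 1 (by decide), F₂.2 1 (by decide),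
      F₁.2 1 (by decide), hx]
  · intro i
    rw [r5, one_mul, F₅.2 2 (by decide), F₄.2 2 (by decide), F₃.2 2 (by decide), F₂.2 2 (by decide),
      F₁.2 2 (by decide), hy]
  refine (progOut_spec hD0 rfl ?_ q6 ?_ q5 (by omega)).le (Nat.mul_le_mul_left _ ?_)
  · rw [F₆.1 19 (by decide), F₅.1 19 (by decide), q4]
  · unfold pts at q3 ⊢
    rw [F₆.2 17 (by decide), F₆.2 18 (by decide), F₅.2 17 (by decide), F₅.2 18 (by decide), q3]
  · rw [mul_comm] at lD lU
    rw [mul_assoc] at t00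
    omega

end RealRAM

/-! ### From the final memory and the explicit bounds to the theorem -/

theorem RealRAM.outputs_of_arr {τ : RealRAM.State} {K : Set (ℝ × ℝ)} {l : List (ℝ × ℝ)}
    (h : arr (RealRAM.pts τ 1) 0 (τ.words 0 0) = l)
    (hl : IsVertexList (fun j : Fin l.length => l[j]) K) : RealRAM.Outputs τ K := by
  subst h
  refine ⟨_, rfl, ?_⟩
  obtain ⟨m, hm⟩ : ∃ m, τ.words 0 0 = m := ⟨_, rfl⟩
  rw [hm] at hl ⊢
  have e : (arr (RealRAM.pts τ 1) 0 m).length = m := length_arr _ _ _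
  have key : (fun j : Fin m => (τ.reals 1 j, τ.reals 2 j)) =
      (fun j : Fin (arr (RealRAM.pts τ 1) 0 m).length => (arr (RealRAM.pts τ 1) 0 m)[j]) ∘
        Fin.cast e.symm := by
    funext j
    simp [RealRAM.pts]
  obtain ⟨h1, h2, h3⟩ := hl
  rw [key]
  refine ⟨h1.comp (Fin.cast_injective _), ?_, fun i j k hij hjk => h3 _ _ _ hij hjk⟩
  rw [Set.range_comp, (finCongr e.symm).surjective.range_eq (f := Fin.cast e.symm), Set.image_univ, h2]

/-- Addresses are polynomially bounded. -/
theorem address_bound (n : ℕ) : 2 * 2 ^ (Nat.clog 2 n + 1) *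
    (2 * 2 ^ (Nat.clog 2 n + 1) * 2 ^ (Nat.clog 2 n + 1)) ≤ (n + 2) ^ 11 := by
  have h : 2 ^ Nat.clog 2 n ≤ 2 * (n + 2) := by
    -- For `n = 0` the tree still has one dummy element, so the bound is stated with `n + 2`.
    rcases Nat.eq_zero_or_pos n with rfl | h
    · simp
    · exact (two_pow_clog_le h).trans (by omega)
  calc _ = 32 * (2 ^ Nat.clog 2 n) ^ 3 := by ring
    _ ≤ 32 * (2 * (n + 2)) ^ 3 := Nat.mul_le_mul_left _ (Nat.pow_le_pow_left h 3)
    _ = 2 ^ 8 * (n + 2) ^ 3 := by ring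
    -- The constant `2 ^ 8` is absorbed into eight further powers of `n + 2 ≥ 2`, which gives the
    -- exponent `11`.
    _ ≤ (n + 2) ^ 8 * (n + 2) ^ 3 := Nat.mul_le_mul_right _ (Nat.pow_le_pow_left (by omega) 8)
    _ = (n + 2) ^ 11 := by ring

/-- With `2 ^ H ≤ 2 n` the bound is at most `8 n (H + 4) ^ 2`, and `H + 4 ≤ 12 log n`; the constant
is `8 * 144`. -/
theorem timeBound_le {n : ℕ} (hn : 2 ≤ n) :
    (RealRAM.timeBound (Nat.clog 2 n) : ℝ) ≤ 1152 * (n * Real.log n ^ 2) := by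
  have h1 := clog_add_le hn 4
  have h2 := two_pow_clog_le (n := n) (by omega)
  have h3 : RealRAM.timeBound (Nat.clog 2 n) ≤ 4 * n * (2 * (Nat.clog 2 n + 4) ^ 2) := by
    unfold RealRAM.timeBound
    calc _ ≤ (2 * Nat.clog 2 n + 8) * ((Nat.clog 2 n + 1) * 2 ^ (Nat.clog 2 n + 1)) +
          (2 * Nat.clog 2 n + 8) * (1 * 2 ^ (Nat.clog 2 n + 1)) := by
          refine Nat.add_le_add_left ?_ _
          exact Nat.mul_pos (by omega) (by positivity)
      _ = 2 ^ Nat.clog 2 n * (4 * (Nat.clog 2 n + 4) * (Nat.clog 2 n + 2)) := by ring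
      _ ≤ 2 * n * (4 * (Nat.clog 2 n + 4) * (Nat.clog 2 n + 4)) := by gcongr; omega
      _ = _ := by ring
  have hlog : 0 ≤ Real.log n := Real.log_natCast_nonneg n
  have h4 : (RealRAM.timeBound (Nat.clog 2 n) : ℝ) ≤
      4 * n * (2 * ((Nat.clog 2 n + 4 : ℕ) : ℝ) ^ 2) := by exact_mod_cast h3
  refine h4.trans ?_
  calc (4 * n * (2 * ((Nat.clog 2 n + 4 : ℕ) : ℝ) ^ 2) : ℝ)
      ≤ 4 * n * (2 * ((2 * (4 : ℕ) + 4) * Real.log n) ^ 2) := by gcongr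
    _ = 1152 * (n * Real.log n ^ 2) := by push_cast; ring

theorem mainTheorem1 :
    -- the polygon has `O(n log n)` vertices
    (∃ C : ℝ, ∀ (S : Type*) [PartialOrder S] (n : ℕ) (_ : Nonempty (Fin n ≃ S))
        (u : S → ℝ) (w : S → ℝ × ℝ), IsSemiorderUtility u → 2 ≤ n →
        ((polygon w).extremePoints ℝ).Finite ∧
          (((polygon w).extremePoints ℝ).ncard : ℝ) ≤ C * (n * Real.log n)) ∧
    -- one real RAM program, with words of `O(log n)` bits, constructs it in `O(n log² n)` time
    (∃ (p : RealRAM.Program) (k : ℕ) (C : ℝ),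
      ∀ (S : Type*) [PartialOrder S] (n : ℕ) (x : Fin n ≃ S)
        (u : S → ℝ) (w : S → ℝ × ℝ), IsSemiorderUtility u →
        ∃ (t : ℕ) (τ : RealRAM.State),
          RealRAM.Exec ((n + 2) ^ k) p (RealRAM.input (u ∘ x) (w ∘ x)) t τ ∧
          RealRAM.Outputs τ (polygon w) ∧
          (2 ≤ n → (t : ℝ) ≤ C * (n * Real.log n ^ 2))) := by
  -- Words below `(n + 2) ^ 11` have `O(log n)` bits. The time constant combines the fixed cost of
  -- the program text with the constant from `timeBound_le`.
  refine ⟨⟨80, fun S _ n ⟨x⟩ u w hu hn => card_extremePoints_le x w hu hn⟩,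
    RealRAM.progMain, 11, RealRAM.progMain.maxCost * 1152, fun S _ n x u w hu => ?_⟩
  have h0 : (RealRAM.input (u ∘ x) (w ∘ x)).reals 0 = extendZero (u ∘ x) := by
    funext i
    by_cases h : i < n <;> simp [RealRAM.input, extendZero, h]
  have h1 : ∀ i, (RealRAM.input (u ∘ x) (w ∘ x)).reals 1 i = (extendZero (w ∘ x) i).1 := by
    intro i
    by_cases h : i < n <;> simp [RealRAM.input, extendZero, h]
  have h2 : ∀ i, (RealRAM.input (u ∘ x) (w ∘ x)).reals 2 i = (extendZero (w ∘ x) i).2 := by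
    intro i
    by_cases h : i < n <;> simp [RealRAM.input, extendZero, h]
  obtain ⟨t, τ, he, ht, hτ⟩ := RealRAM.progMain_spec (n := n) rfl (address_bound n) h0 h1 h2
  refine ⟨t, τ, he, RealRAM.outputs_of_arr hτ
    (isVertexList_rootVertices x w hu (Nat.le_pow_clog one_lt_two n)), fun hn => ?_⟩
  have h3 : (t : ℝ) ≤ RealRAM.progMain.maxCost * RealRAM.timeBound (Nat.clog 2 n) := by
    exact_mod_cast ht
  rw [mul_assoc]
  exact h3.trans (mul_le_mul_of_nonneg_left (timeBound_le hn) (Nat.cast_nonneg _))
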